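/- Let $G$ be a compact connected Lie group with Lie algebra $\mathfrak g$. Fix an inner product on $\mathfrak g$ with norm $|\cdot|$, let $d_G$ be the distance of the associated left-invariant Riemannian metric, and fix a maximal abelian subalgebra $\mathfrak t\subset\mathfrak g$ and a Weyl chamber (a choice of positive roots). For an irreducible (hence finite-dimensional) unitary representation $\pi$ of $G$ on $H_\pi$, let $\lambda_\pi$ be its highest weight, a real linear form on $\mathfrak t$ after division by $i$, and $|\lambda_\pi|$ its norm. Put $m_G=(\dim G-\dim\mathfrak t)/2$. A subset $\Gamma\subset G$ is Diophantine if there are $C,\delta>0$ such that for all nontrivial irreducible $\pi$ and all $v\in H_\pi$ there is $g\in\Gamma$ with $\|v-\pi(g)v\|\ge \delta|\lambda_\pi|^{-C}\|v\|$. Let $A$ be an aperiodic $N\times N$ matrix of zeros and ones, $X$ and $X^+$ the two-sided and one-sided subshifts of finite type of $A$, with shift $\sigma$ and coordinate projection $\Pi_+:X\to X^+$, let $\lambda\in(0,1)$, and give $X^+$ the metric $d_\lambda(x,y)=\lambda^{\min\{i:\,x_i\ne y_i\}}$. Let $\varphi:X^+\to\mathbb R$, $r:X^+\to(0,\infty)$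 and $\Theta:X^+\to(G,d_G)$ be Lipschitz, with $\sum_{\sigma y=x}e^{\varphi(y)}=1$ for every $x\in X^+$. Write $r_n=\sum_{i<n}r\circ\sigma^i$ and $\Theta_n=(\Theta\circ\sigma^{n-1})\cdots(\Theta\circ\sigma)\,\Theta$, and regard $r,\Theta,r_n,\Theta_n$ also as functions on $X$ through $\Pi_+$. A stable leg of size $n_0$ from $x\in X$ to $y\in X$ requires $y_i=x_i$ for all $i\ge n_0$; it has displacement $\Delta^s(x,y)=\lim_n (r_n(y)-r_n(x))$ and twist $\Theta^s(x,y)=\lim_n\Theta_n(y)^{-1}\Theta_n(x)$. An unstable leg of size $n_0$ requires $y_i=x_i$ for all $i\le -n_0$; it has displacement $\Delta^u(x,y)=\lim_n (r_n(\sigma^{-n}x)-r_n(\sigma^{-n}y))$ and twist $\Theta^u(x,y)=\lim_n\Theta_n(\sigma^{-n}y)\Theta_n(\sigma^{-n}x)^{-1}$. Let $\Gamma(w,n_0,p_0)\subset G$ be the set of products $g_{p-1}\cdots g_0$ of the successive twists of the closed chains at $w$ that consist of $p\le p_0$ legs of size $n_0$ and have total displacement $0$. Assume that $\Gamma(w,n_0,p_0)$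 is Diophantine for some $w\in X$, $n_0\in\mathbb N$, $p_0\ge1$. For $b\in\mathbb R$ and an irreducible unitary representation $\pi$ let $$\mathcal L_{ib,\pi}h(x)=\sum_{\sigma y=x}e^{\varphi(y)-ib\,r(y)}\,\pi(\Theta(y))h(y),\qquad h:X^+\to H_\pi,$$ and, for constants $C_{15}>0$ and $C_{18}\ge1$, put $b_\pi=|b|+C_{15}|\lambda_\pi|^{1+m_G/2}$ and $\|h\|_{b_\pi}=\max\{\|h\|_\infty,\ |h|_{\mathrm{Lip}}/(C_{18}b_\pi)\}$, where $|h|_{\mathrm{Lip}}$ is the Lipschitz constant for $d_\lambda$. Then for every sufficiently large $C_{15}$ and, given $C_{15}$, every sufficiently large $C_{18}$, there are $C_{23},C_{25}>0$ such that for every nontrivial irreducible unitary representation $\pi$ of $G$ and every $b\in\mathbb R$ one has $b_\pi>1$ and, for every Lipschitz $h:X^+\to H_\pi$, the function $\mathcal L_{ib,\pi}^{n}h$ with $n=\lceil C_{25}\log b_\pi\rceil$ is Lipschitz and $$\|\mathcal L_{ib,\pi}^{n}h\|_{b_\pi}\le\bigl(1-b_\pi^{-C_{23}}\bigr)\|h\|_{b_\pi}.$$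 -/

import Mathlib

open scoped Manifold ContDiff Topology
open Filter

/-! ### Subshifts of finite type -/

/-- Every entry of `A` is `0` or `1`. -/
def IsZeroOne {N : ℕ} (A : Matrix (Fin N) (Fin N) ℕ) : Prop :=
  ∀ i j, A i j = 0 ∨ A i j = 1

/-- Some power `A ^ n`, `n ≥ 1`, has only positive entries. -/
def IsAperiodic {N : ℕ} (A : Matrix (Fin N) (Fin N) ℕ) : Prop :=
  ∃ n : ℕ, 1 ≤ n ∧ ∀ i j, 0 < (A ^ n) i j

/-- The two-sided shift space `X` of the transition matrix `A`. -/
def TwoSided {N : ℕ} (A : Matrix (Fin N) (Fin N) ℕ) : Type :=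
  {x : ℤ → Fin N // ∀ i, A (x i) (x (i + 1)) = 1}

/-- The one-sided shift space `X⁺` of the transition matrix `A`. -/
def OneSided {N : ℕ} (A : Matrix (Fin N) (Fin N) ℕ) : Type :=
  {x : ℕ → Fin N // ∀ i, A (x i) (x (i + 1)) = 1}

section Shift

variable {N : ℕ} {A : Matrix (Fin N) (Fin N) ℕ}

/-- The shift `σ : X⁺ → X⁺`. -/
def OneSided.shift (x : OneSided A) : OneSided A :=
  ⟨fun i => x.1 (i + 1), fun i => x.2 (i + 1)⟩

/-- The power `σ⁻ⁿ : X → X` of the inverse of the two-sided shift. -/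
def TwoSided.shiftBack (n : ℕ) (x : TwoSided A) : TwoSided A :=
  ⟨fun i => x.1 (i - n), fun i => by
    have h := x.2 (i - n)
    rwa [show i - (n : ℤ) + 1 = i + 1 - n by ring] at h⟩

/-- The coordinate projection `Π₊ : X → X⁺`. -/
def TwoSided.future (x : TwoSided A) : OneSided A :=
  ⟨fun i => x.1 (i : ℤ), fun i => by
    have h := x.2 (i : ℤ)
    simpa using h⟩

open Classical in
/-- The metric `d_λ(x, y) = λ ^ min {i | x_i ≠ y_i}` on `X⁺`, with `d_λ(x, x) = 0`. -/
noncomputable def OneSided.dist (lam : ℝ) (x y : OneSided A) : ℝ :=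
  if x = y then 0 else lam ^ sInf {i : ℕ | x.1 i ≠ y.1 i}

/-- `F_λ(X⁺, V)`: the functions `X⁺ → V` that are Lipschitz for `d_λ`. -/
def MemLip {V : Type*} [NormedAddCommGroup V] (lam : ℝ) (h : OneSided A → V) : Prop :=
  ∃ K : ℝ, ∀ x y, ‖h x - h y‖ ≤ K * OneSided.dist lam x y

/-- The supremum norm. -/
noncomputable def supNorm {V : Type*} [NormedAddCommGroup V] (h : OneSided A → V) : ℝ :=
  ⨆ x, ‖h x‖

/-- The Lipschitz seminorm for `d_λ`. (Pairs with `x = y` contribute `0 / 0 = 0`.) -/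
noncomputable def lipNorm {V : Type*} [NormedAddCommGroup V] (lam : ℝ) (h : OneSided A → V) : ℝ :=
  ⨆ p : OneSided A × OneSided A, ‖h p.1 - h p.2‖ / OneSided.dist lam p.1 p.2

/-- The norm `max {‖h‖_∞, |h|_Lip / (K β)}`. -/
noncomputable def scaledNorm {V : Type*} [NormedAddCommGroup V] (lam K β : ℝ)
    (h : OneSided A → V) : ℝ :=
  max (supNorm h) (lipNorm lam h / (K * β))

/-- `∑_{σ y = x} e^{φ y} = 1` for every `x`, i.e. the transfer operator of `φ` fixes the constant
function `1`. -/
def IsNormalizedPotential (φ : OneSided A → ℝ) : Prop :=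
  ∀ x : OneSided A, ∑ᶠ (y : OneSided A) (_ : y.shift = x), Real.exp (φ y) = 1

/-- The Birkhoff sum `r_n = r + r ∘ σ + ⋯ + r ∘ σ^{n-1}`. -/
noncomputable def roofSum (r : OneSided A → ℝ) (n : ℕ) (x : OneSided A) : ℝ :=
  birkhoffSum OneSided.shift r n x

/-- The cocycle `Θ_n(x) = Θ(σ^{n-1} x) ⋯ Θ(σ x) Θ(x)`. -/
def cocycle {G : Type*} [Group G] (Θ : OneSided A → G) : ℕ → OneSided A → G
  | 0, _ => 1
  | n + 1, x => Θ (OneSided.shift^[n] x) * cocycle Θ n x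

/-- A leg of size `n₀` from `x` to `y`, with time displacement `t` and twist `g`. Either
`y ∈ W^s_{n₀}(x)` and `t = Δ^s(x, y)`, `g = Θ^s(x, y)`, or `y ∈ W^u_{n₀}(x)` and
`t = Δ^u(x, y)`, `g = Θ^u(x, y)`; the four quantities are the indicated limits. -/
def IsLeg {G : Type*} [Group G] [TopologicalSpace G] (r : OneSided A → ℝ) (Θ : OneSided A → G)
    (n₀ : ℕ) (x y : TwoSided A) (t : ℝ) (g : G) : Prop :=
  ((∀ i : ℤ, (n₀ : ℤ) ≤ i → y.1 i = x.1 i) ∧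
    Tendsto (fun n => roofSum r n y.future - roofSum r n x.future) atTop (𝓝 t) ∧
    Tendsto (fun n => (cocycle Θ n y.future)⁻¹ * cocycle Θ n x.future) atTop (𝓝 g)) ∨
  ((∀ i : ℤ, i ≤ -(n₀ : ℤ) → y.1 i = x.1 i) ∧
    Tendsto (fun n => roofSum r n (x.shiftBack n).future - roofSum r n (y.shiftBack n).future)
      atTop (𝓝 t) ∧
    Tendsto (fun n => cocycle Θ n (y.shiftBack n).future * (cocycle Θ n (x.shiftBack n).future)⁻¹)
      atTop (𝓝 g))

/-- The set `Γ(w, n₀, p₀)` of the twists `g_{p-1} ⋯ g_1 g_0` of the closed chains at `w` with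
`p ≤ p₀` legs of size `n₀` and with total time displacement zero. -/
def chainTwists {G : Type*} [Group G] [TopologicalSpace G] (r : OneSided A → ℝ)
    (Θ : OneSided A → G) (w : TwoSided A) (n₀ p₀ : ℕ) : Set G :=
  {a | ∃ (p : ℕ) (c : ℕ → TwoSided A) (t : ℕ → ℝ) (g : ℕ → G),
    p ≤ p₀ ∧ c 0 = w ∧ c p = w ∧ (∀ i < p, IsLeg r Θ n₀ (c i) (c (i + 1)) (t i) (g i)) ∧
    ∑ i ∈ Finset.range p, t i = 0 ∧ a = ((List.range p).reverse.map g).prod}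

end Shift

/-! ### Irreducible unitary representations and the twisted transfer operators -/

/-- An irreducible unitary representation of `G`, in coordinates: a strongly continuous
homomorphism into the unitary operators of `ℂ^d`, `d ≥ 1`, without nontrivial invariant subspace. -/
structure UnitaryIrrep (G : Type*) [Group G] [TopologicalSpace G] where
  /-- the dimension -/
  dim : ℕ
  dim_pos : 0 < dim
  /-- the homomorphism -/
  toHom : G →* unitary (EuclideanSpace ℂ (Fin dim) →L[ℂ] EuclideanSpace ℂ (Fin dim))
  continuous_apply : ∀ v : EuclideanSpace ℂ (Fin dim),
    Continuous fun g => (toHom g : EuclideanSpace ℂ (Fin dim) →L[ℂ] EuclideanSpace ℂ (Fin dim)) v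
  irreducible : ∀ W : Submodule ℂ (EuclideanSpace ℂ (Fin dim)),
    (∀ g, ∀ v ∈ W,
      (toHom g : EuclideanSpace ℂ (Fin dim) →L[ℂ] EuclideanSpace ℂ (Fin dim)) v ∈ W) →
    W = ⊥ ∨ W = ⊤

namespace UnitaryIrrep

variable {G : Type*} [Group G] [TopologicalSpace G]

/-- The representation space `H_π`. -/
abbrev Space (π : UnitaryIrrep G) : Type := EuclideanSpace ℂ (Fin π.dim)

/-- The operator `π(g)` on `H_π`. -/
noncomputable def op (π : UnitaryIrrep G) (g : G) : π.Space →L[ℂ] π.Space := (π.toHom g).1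

/-- `π ≠ 1`. -/
def Nontrivial (π : UnitaryIrrep G) : Prop := ∃ g, π.op g ≠ 1

/-- The twisted transfer operator
`(𝓛_{s,π} h)(x) = ∑_{σ y = x} e^{φ(y) - s r(y)} π(Θ(y)) h(y)`. -/
noncomputable def transfer {N : ℕ} {A : Matrix (Fin N) (Fin N) ℕ} (π : UnitaryIrrep G)
    (φ r : OneSided A → ℝ) (Θ : OneSided A → G) (s : ℂ) (h : OneSided A → π.Space) :
    OneSided A → π.Space :=
  fun x => ∑ᶠ (y : OneSided A) (_ : y.shift = x),
    Complex.exp ((φ y : ℂ) - s * (r y : ℂ)) • π.op (Θ y) (h y)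

end UnitaryIrrep

/-! ### Compact Lie groups: invariant distance, roots, highest weights -/

section LieGroup

variable {E : Type*} [NormedAddCommGroup E] [NormedSpace ℝ E]
  {G : Type*} [TopologicalSpace G] [ChartedSpace E G] [Group G]

/-- `B` is an inner product on the Lie algebra of `G`. -/
def IsInnerProduct (B : LinearMap.BilinForm ℝ (GroupLieAlgebra 𝓘(ℝ, E) G)) : Prop :=
  (∀ X Y, B X Y = B Y X) ∧ ∀ X, X ≠ 0 → 0 < B X X

/-- The velocity of the curve `γ` at time `t`, moved to the Lie algebra by left translation. -/
noncomputable def leftVelocity (γ : ℝ → G) (t : ℝ) : GroupLieAlgebra 𝓘(ℝ, E) G :=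
  (mfderiv 𝓘(ℝ, ℝ) 𝓘(ℝ, E) (fun s => (γ t)⁻¹ * γ s) t (1 : ℝ) : E)

/-- The distance `d_G` of the left-invariant Riemannian metric given by the inner product `B`: the
infimum of `∫₀¹ |γ(t)⁻¹ γ'(t)| dt` over the `C¹` curves `γ` from `g` to `g'`. -/
noncomputable def lieDist (B : LinearMap.BilinForm ℝ (GroupLieAlgebra 𝓘(ℝ, E) G)) (g g' : G) :
    ENNReal :=
  ⨅ (γ : ℝ → G) (_ : ContMDiff 𝓘(ℝ, ℝ) 𝓘(ℝ, E) 1 γ) (_ : γ 0 = g) (_ : γ 1 = g'),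
    ∫⁻ t in Set.Icc (0 : ℝ) 1,
      ENNReal.ofReal (Real.sqrt (B (leftVelocity γ t) (leftVelocity γ t)))

/-- `F_λ(X⁺, G)`: the maps `X⁺ → G` that are Lipschitz for `d_λ` and `d_G`. -/
def MemLipGroup {N : ℕ} {A : Matrix (Fin N) (Fin N) ℕ}
    (B : LinearMap.BilinForm ℝ (GroupLieAlgebra 𝓘(ℝ, E) G)) (lam : ℝ) (Θ : OneSided A → G) :
    Prop :=
  ∃ K : ℝ, ∀ x y, lieDist B (Θ x) (Θ y) ≤ ENNReal.ofReal (K * OneSided.dist lam x y)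

/-- `𝔱` is a maximal abelian subalgebra (the Lie algebra of a maximal torus). -/
def IsMaximalAbelian (𝔱 : Submodule ℝ (GroupLieAlgebra 𝓘(ℝ, E) G)) : Prop :=
  (∀ X ∈ 𝔱, ∀ Y ∈ 𝔱, ⁅X, Y⁆ = 0) ∧ ∀ Z, (∀ X ∈ 𝔱, ⁅X, Z⁆ = 0) → Z ∈ 𝔱

/-- `α` is a (real) root: `α ≠ 0` and there is `Z = X + iY ≠ 0` in the complexified Lie algebra
with `⁅H, Z⁆ = i α(H) Z` for every `H ∈ 𝔱`, written out in real and imaginary parts. -/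
def IsRoot (𝔱 : Submodule ℝ (GroupLieAlgebra 𝓘(ℝ, E) G)) (α : Module.Dual ℝ 𝔱) : Prop :=
  α ≠ 0 ∧ ∃ X Y : GroupLieAlgebra 𝓘(ℝ, E) G, (X ≠ 0 ∨ Y ≠ 0) ∧
    ∀ H : 𝔱, ⁅(H : GroupLieAlgebra 𝓘(ℝ, E) G), X⁆ = -(α H • Y) ∧
      ⁅(H : GroupLieAlgebra 𝓘(ℝ, E) G), Y⁆ = α H • X

/-- `H₀ ∈ 𝔱` is regular: no root vanishes on it. Such an element fixes a Weyl chamber, and the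
positive roots are those with `0 < α H₀`. -/
def IsRegularElement (𝔱 : Submodule ℝ (GroupLieAlgebra 𝓘(ℝ, E) G)) (H₀ : 𝔱) : Prop :=
  ∀ α, IsRoot 𝔱 α → α H₀ ≠ 0

/-- The derived representation `dπ(X)` (a continuous finite-dimensional representation of a Lie
group is smooth). -/
noncomputable def UnitaryIrrep.deriv (π : UnitaryIrrep G) (X : GroupLieAlgebra 𝓘(ℝ, E) G) :
    π.Space →L[ℂ] π.Space :=
  mfderiv 𝓘(ℝ, E) 𝓘(ℝ, π.Space →L[ℂ] π.Space) π.op (1 : G) X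

/-- `μ` is a (real) weight of `π`: there is `v ≠ 0` with `dπ(X) v = i μ(X) v` for all `X ∈ 𝔱`. -/
def IsWeight (𝔱 : Submodule ℝ (GroupLieAlgebra 𝓘(ℝ, E) G)) (π : UnitaryIrrep G)
    (μ : Module.Dual ℝ 𝔱) : Prop :=
  ∃ v : π.Space, v ≠ 0 ∧
    ∀ X : 𝔱, π.deriv (X : GroupLieAlgebra 𝓘(ℝ, E) G) v = (Complex.I * (μ X : ℂ)) • v

/-- `ℓ` is the highest weight of `π` for the positive system of `H₀`: it is a weight, and every
weight is obtained from it by subtracting a sum of positive roots. -/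
def IsHighestWeight (𝔱 : Submodule ℝ (GroupLieAlgebra 𝓘(ℝ, E) G)) (H₀ : 𝔱)
    (π : UnitaryIrrep G) (ℓ : Module.Dual ℝ 𝔱) : Prop :=
  IsWeight 𝔱 π ℓ ∧ ∀ μ, IsWeight 𝔱 π μ →
    ℓ - μ ∈ AddSubmonoid.closure {α : Module.Dual ℝ 𝔱 | IsRoot 𝔱 α ∧ 0 < α H₀}

/-- The norm of a linear form on `𝔱` induced by the inner product `B`; it is the norm of the
element of `𝔱` that represents the form. -/
noncomputable def weightNorm (B : LinearMap.BilinForm ℝ (GroupLieAlgebra 𝓘(ℝ, E) G))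
    (𝔱 : Submodule ℝ (GroupLieAlgebra 𝓘(ℝ, E) G)) (μ : Module.Dual ℝ 𝔱) : ℝ :=
  sSup {c : ℝ | ∃ X : 𝔱, B X X ≤ 1 ∧ c = |μ X|}

/-- `m_G = (dim G - rank G) / 2`, the rank being the dimension of `𝔱`. -/
noncomputable def halfRootNumber (𝔱 : Submodule ℝ (GroupLieAlgebra 𝓘(ℝ, E) G)) : ℝ :=
  ((Module.finrank ℝ (GroupLieAlgebra 𝓘(ℝ, E) G) : ℝ) - (Module.finrank ℝ 𝔱 : ℝ)) / 2

/-- `Γ ⊆ G` is Diophantine: for some `C, δ > 0`, for every irreducible `π ≠ 1` with highest weight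
`ℓ` and every `v ∈ H_π` there is `g ∈ Γ` with `‖v - π(g) v‖ ≥ ‖v‖ δ / |ℓ|^C`. -/
def IsDiophantine (B : LinearMap.BilinForm ℝ (GroupLieAlgebra 𝓘(ℝ, E) G))
    (𝔱 : Submodule ℝ (GroupLieAlgebra 𝓘(ℝ, E) G)) (H₀ : 𝔱) (Γ : Set G) : Prop :=
  ∃ C > (0 : ℝ), ∃ δ > (0 : ℝ), ∀ π : UnitaryIrrep G, π.Nontrivial →
    ∀ ℓ, IsHighestWeight 𝔱 H₀ π ℓ → ∀ v : π.Space, ∃ g ∈ Γ,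
      ‖v‖ * (δ / weightNorm B 𝔱 ℓ ^ C) ≤ ‖v - π.op g v‖

/-- The frequency `b_π = |b| + C |ℓ|^{1 + m_G / 2}` for the highest weight `ℓ` of `π`. -/
noncomputable def frequency (B : LinearMap.BilinForm ℝ (GroupLieAlgebra 𝓘(ℝ, E) G))
    (𝔱 : Submodule ℝ (GroupLieAlgebra 𝓘(ℝ, E) G)) (C : ℝ) (ℓ : Module.Dual ℝ 𝔱) (b : ℝ) : ℝ :=
  |b| + C * weightNorm B 𝔱 ℓ ^ (1 + halfRootNumber 𝔱 / 2)

end LieGroup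

/-!
The twisted transfer operator is a weighted average of the isometries `U(y) = exp (-i b r(y))
π(Θ(y))` along the inverse branches of the shift, so it never increases the sup norm. Suppose that
`𝓛 ^ n`, with `n` a large multiple of `log b_π`, shrinks the sup norm of `h` by a factor no smaller
than `1 - b_π ^ (-C)`. By uniform convexity the vectors being averaged are then all nearly equal to
one vector, so the values of `h` are nearly invariant under the cocycle over every orbit. Comparing
two orbits which agree in the far past or in the far future transports a nearly invariant vector
along the legs of a chain: around a closed chain with displacement `0` the phases cancel and the
vector is nearly fixed by the product of the twists. As one vector serves all closed chains, this
contradicts the Diophantine condition. A Lasota–Yorke inequality takes care of the Lipschitz part of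
the norm.

Two facts about representations make this uniform in `π`. First, `‖dπ(X)‖ ≤ C √(|λ_π|² + |λ_π|)
|X|`: for an orthonormal basis `X_i` of an invariant inner product the Casimir operator `∑ dπ(X_i)²`
is scalar by Schur's lemma, and its value can be computed on a highest weight vector, where each
root vector contributes at most a multiple of `|λ_π|`. Second, `‖dπ‖` is bounded below over all
nontrivial `π`, because a compact connected group is covered by boundedly many translates of any
neighbourhood of `1` and some `π(g)` is at distance at least `1 / 2` from the identity. Together
they bound `|λ_π|` from below and the Lipschitz constant of `π ∘ Θ` by a multiple of `|λ_π|`.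
-/

/-! ### Symbolic dynamics -/

section Symbolic

variable {N : ℕ} {A : Matrix (Fin N) (Fin N) ℕ} {lam : ℝ}

/-- `K` is a Lipschitz constant of `f` for the metric `d_λ` on `X⁺`. Stated as a predicate, since
`d_λ` depends on `λ` and is not an instance. -/
def LipschitzBound {M : Type*} [PseudoMetricSpace M] (lam K : ℝ) (f : OneSided A → M) : Prop :=
  ∀ x y, dist (f x) (f y) ≤ K * OneSided.dist lam x y

namespace OneSided

@[ext] lemma ext {x y : OneSided A} (h : ∀ i, x.1 i = y.1 i) : x = y :=
  Subtype.ext (funext h)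

@[simp] lemma shift_apply (x : OneSided A) (i : ℕ) : x.shift.1 i = x.1 (i + 1) := rfl

lemma iterate_shift_apply (x : OneSided A) (n i : ℕ) : (shift^[n] x).1 i = x.1 (i + n) := by
  induction n generalizing x with
  | zero => rfl
  | succ n ih => rw [Function.iterate_succ_apply, ih, shift_apply, add_assoc]

lemma eq_of_apply_zero_of_shift {x y : OneSided A} (h : x.1 0 = y.1 0)
    (hs : x.shift = y.shift) : x = y := by
  ext i : 1
  cases i with
  | zero => rw [h]
  | succ j => rw [← shift_apply x, hs, shift_apply]

lemma dist_nonneg (h0 : 0 ≤ lam) (x y : OneSided A) : 0 ≤ dist lam x y := by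
  unfold dist
  split_ifs <;> positivity

@[simp] lemma dist_self (lam : ℝ) (x : OneSided A) : dist lam x x = 0 := by simp [dist]

lemma dist_le_pow (h0 : 0 ≤ lam) (h1 : lam ≤ 1) {x y : OneSided A} {k : ℕ}
    (h : ∀ i < k, x.1 i = y.1 i) : dist lam x y ≤ lam ^ k := by
  unfold dist
  split_ifs with hxy
  · positivity
  · have hne : {i : ℕ | x.1 i ≠ y.1 i}.Nonempty := by
      by_contra! hempty
      exact hxy (ext fun i => not_not.1 (Set.eq_empty_iff_forall_notMem.1 hempty i))
    refine pow_le_pow_of_le_one h0 h1 ?_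
    by_contra! hlt
    exact Nat.sInf_mem hne (h _ hlt)

lemma dist_le_one (h0 : 0 ≤ lam) (h1 : lam ≤ 1) (x y : OneSided A) : dist lam x y ≤ 1 := by
  simpa using dist_le_pow h0 h1 (x := x) (y := y) (k := 0) (by simp)

lemma dist_eq_one (lam : ℝ) {x y : OneSided A} (h : x.1 0 ≠ y.1 0) : dist lam x y = 1 := by
  have hxy : x ≠ y := fun e => h (by rw [e])
  have hinf : sInf {i : ℕ | x.1 i ≠ y.1 i} = 0 := Nat.sInf_eq_zero.2 (Or.inl h)
  simp [dist, hxy, hinf]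

lemma dist_le_mul_dist_shift (h0 : 0 ≤ lam) (h1 : lam ≤ 1) {x y : OneSided A}
    (h : x.1 0 = y.1 0) : dist lam x y ≤ lam * dist lam x.shift y.shift := by
  by_cases hs : x.shift = y.shift
  · rw [eq_of_apply_zero_of_shift h hs, dist_self, dist_self, mul_zero]
  · have hdist : dist lam x.shift y.shift = lam ^ sInf {i : ℕ | x.shift.1 i ≠ y.shift.1 i} := by
      simp [dist, hs]
    rw [hdist, ← pow_succ']
    refine dist_le_pow h0 h1 fun i hi => ?_
    cases i with
    | zero => exact h
    | succ j => exact not_not.1 (Nat.notMem_of_lt_sInf (Nat.lt_of_succ_lt_succ hi))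

open Classical in
/-- The sequence `i x₀ x₁ …` if it is admissible, and `x` otherwise. -/
noncomputable def cons (i : Fin N) (x : OneSided A) : OneSided A :=
  if h : A i (x.1 0) = 1 then
    ⟨fun k => Nat.casesOn k i x.1, fun k => by
      cases k with
      | zero => exact h
      | succ k => exact x.2 k⟩
  else x

lemma cons_zero {i : Fin N} {x : OneSided A} (h : A i (x.1 0) = 1) : (cons i x).1 0 = i := by
  simp [cons, h]

lemma shift_cons {i : Fin N} {x : OneSided A} (h : A i (x.1 0) = 1) : (cons i x).shift = x := by
  ext k : 1
  simp [cons, h, shift]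

lemma cons_shift (y : OneSided A) : cons (y.1 0) y.shift = y :=
  have h : A (y.1 0) (y.shift.1 0) = 1 := y.2 0
  eq_of_apply_zero_of_shift (cons_zero h) (shift_cons h)

open Classical in
/-- The letters that may precede `x`; they index the preimages of `x` under the shift. -/
noncomputable def letters (x : OneSided A) : Finset (Fin N) :=
  Finset.univ.filter fun i => A i (x.1 0) = 1

lemma mem_letters {x : OneSided A} {i : Fin N} : i ∈ letters x ↔ A i (x.1 0) = 1 := by
  simp [letters]

lemma apply_zero_mem_letters_shift (y : OneSided A) : y.1 0 ∈ letters y.shift :=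
  mem_letters.2 (y.2 0)

lemma letters_congr {x y : OneSided A} (h : x.1 0 = y.1 0) : letters x = letters y := by
  simp only [letters, h]

lemma card_letters_le (x : OneSided A) : (letters x).card ≤ N :=
  (Finset.card_le_univ _).trans_eq (Fintype.card_fin N)

lemma finsum_preimages {M : Type*} [AddCommMonoid M] (f : OneSided A → M) (x : OneSided A) :
    ∑ᶠ (y : OneSided A) (_ : y.shift = x), f y = ∑ i ∈ letters x, f (cons i x) := by
  classical
  have hinj : Set.InjOn (fun i => cons i x) (letters x : Set (Fin N)) := by
    intro i hi j hj hij
    have hfirst := congrArg (fun z : OneSided A => z.1 0) hij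
    simpa only [cons_zero (mem_letters.1 hi), cons_zero (mem_letters.1 hj)] using hfirst
  have hpreimages : {y : OneSided A | y.shift = x} = ↑((letters x).image fun i => cons i x) := by
    ext y
    simp only [Set.mem_ofPred_eq, Finset.coe_image, Set.mem_image, Finset.mem_coe]
    constructor
    · rintro rfl
      exact ⟨y.1 0, apply_zero_mem_letters_shift y, cons_shift y⟩
    · rintro ⟨i, hi, rfl⟩
      exact shift_cons (mem_letters.1 hi)
  rw [← Finset.sum_image (f := f) hinj, ← finsum_mem_coe_finset, ← hpreimages]
  rfl

lemma dist_cons_le (h0 : 0 ≤ lam) (h1 : lam ≤ 1) {x y : OneSided A} (h : x.1 0 = y.1 0)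
    {i : Fin N} (hi : i ∈ letters x) :
    dist lam (cons i x) (cons i y) ≤ lam * dist lam x y := by
  have hx : A i (x.1 0) = 1 := mem_letters.1 hi
  have hy : A i (y.1 0) = 1 := h ▸ hx
  have hdist := dist_le_mul_dist_shift h0 h1 (x := cons i x) (y := cons i y)
    (by rw [cons_zero hx, cons_zero hy])
  rwa [shift_cons hx, shift_cons hy] at hdist

lemma exists_iterate_shift_eq_of_pow_pos (hA01 : IsZeroOne A) (M : ℕ) (i : Fin N) (x : OneSided A)
    (h : 0 < (A ^ M) i (x.1 0)) : ∃ y : OneSided A, y.1 0 = i ∧ shift^[M] y = x := by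
  induction M generalizing i with
  | zero =>
    refine ⟨x, ?_, rfl⟩
    by_contra hne
    simp [Matrix.one_apply_ne' hne] at h
  | succ M ih =>
    rw [pow_succ', Matrix.mul_apply] at h
    obtain ⟨k, -, hk⟩ := Finset.exists_ne_zero_of_sum_ne_zero h.ne'
    obtain ⟨y, rfl, hyx⟩ := ih k (Nat.pos_of_ne_zero (right_ne_zero_of_mul hk))
    have hiy : A i (y.1 0) = 1 := (hA01 i _).resolve_left (left_ne_zero_of_mul hk)
    exact ⟨cons i y, cons_zero hiy, by rw [Function.iterate_succ_apply, shift_cons hiy, hyx]⟩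

/-- The sequence `x₀ ⋯ x_{k-1} y₀ y₁ ⋯`, which is admissible when `x_k = y₀`. -/
def splice (k : ℕ) (x y : OneSided A) (h : x.1 k = y.1 0) : OneSided A :=
  ⟨fun j => if j < k then x.1 j else y.1 (j - k), fun j => by
    rcases lt_trichotomy (j + 1) k with hlt | rfl | hgt
    · simpa only [if_pos hlt, if_pos (show j < k by omega)] using x.2 j
    · simpa only [if_pos (Nat.lt_succ_self j), lt_irrefl, if_false, Nat.sub_self, ← h] using x.2 j
    · simpa only [if_neg (show ¬ j < k by omega), if_neg (show ¬ j + 1 < k by omega),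
        show j + 1 - k = j - k + 1 by omega] using y.2 (j - k)⟩

lemma splice_apply_of_le {k j : ℕ} {x y : OneSided A} (h : x.1 k = y.1 0) (hj : j ≤ k) :
    (splice k x y h).1 j = x.1 j := by
  rcases hj.lt_or_eq with hlt | rfl
  · exact if_pos hlt
  · change (if j < j then x.1 j else y.1 (j - j)) = x.1 j
    rw [if_neg (lt_irrefl j), Nat.sub_self, h]

lemma iterate_shift_splice {k : ℕ} {x y : OneSided A} (h : x.1 k = y.1 0) :
    shift^[k] (splice k x y h) = y := by
  ext j : 1
  rw [iterate_shift_apply]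
  change (if j + k < k then x.1 (j + k) else y.1 (j + k - k)) = _
  rw [if_neg (by omega), Nat.add_sub_cancel]

end OneSided

namespace TwoSided

lemma future_apply (z : TwoSided A) (i : ℕ) : z.future.1 i = z.1 (i : ℤ) := rfl

lemma future_shiftBack_apply (z : TwoSided A) (n i : ℕ) :
    (z.shiftBack n).future.1 i = z.1 ((i : ℤ) - n) := rfl

lemma shift_future_shiftBack_succ (z : TwoSided A) (n : ℕ) :
    (z.shiftBack (n + 1)).future.shift = (z.shiftBack n).future := by
  ext i : 1
  rw [OneSided.shift_apply, future_shiftBack_apply, future_shiftBack_apply,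
    show ((i + 1 : ℕ) : ℤ) - (n + 1 : ℕ) = i - n by push_cast; ring]

/-- The sequence `z_{-q} ⋯ z_{q-1}` followed by the point `T z_q`, where `T i` starts with the
letter `i`. -/
def glue (q : ℕ) {T : Fin N → OneSided A} (hT : ∀ i, (T i).1 0 = i) (z : TwoSided A) :
    OneSided A :=
  OneSided.splice (2 * q) (z.shiftBack q).future (T (z.1 q)) <| by
    rw [hT, future_shiftBack_apply, show ((2 * q : ℕ) : ℤ) - q = q by push_cast; ring]

variable {q : ℕ} {T : Fin N → OneSided A}

lemma glue_apply (hT : ∀ i, (T i).1 0 = i) (z : TwoSided A) {j : ℕ} (hj : j ≤ 2 * q) :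
    (glue q hT z).1 j = z.1 ((j : ℤ) - q) :=
  OneSided.splice_apply_of_le _ hj

lemma iterate_shift_glue (hT : ∀ i, (T i).1 0 = i) (z : TwoSided A) :
    OneSided.shift^[2 * q] (glue q hT z) = T (z.1 q) :=
  OneSided.iterate_shift_splice _

lemma iterate_shift_glue_apply (hT : ∀ i, (T i).1 0 = i) (z : TwoSided A) {j : ℕ} (hj : j ≤ q) :
    (OneSided.shift^[q] (glue q hT z)).1 j = z.future.1 j := by
  rw [OneSided.iterate_shift_apply, glue_apply hT z (by omega), future_apply,
    show ((j + q : ℕ) : ℤ) - q = j by push_cast; ring]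

lemma iterate_shift_glue_congr (hT : ∀ i, (T i).1 0 = i) {n : ℕ} (hn : n ≤ q) {z z' : TwoSided A}
    (hz : ∀ i : ℤ, (n : ℤ) ≤ i → z'.1 i = z.1 i) :
    OneSided.shift^[n] (OneSided.shift^[q] (glue q hT z')) =
      OneSided.shift^[n] (OneSided.shift^[q] (glue q hT z)) := by
  have hpast : ∀ j : ℕ, n + q ≤ j → (glue q hT z').1 j = (glue q hT z).1 j := by
    intro j hj
    by_cases hjq : j ≤ 2 * q
    · rw [glue_apply hT _ hjq, glue_apply hT _ hjq, hz _ (by omega)]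
    · obtain ⟨l, rfl⟩ := Nat.exists_eq_add_of_le' (not_le.1 hjq).le
      rw [← OneSided.iterate_shift_apply, ← OneSided.iterate_shift_apply, iterate_shift_glue,
        iterate_shift_glue, hz q (by exact_mod_cast hn)]
  ext j : 1
  simp only [OneSided.iterate_shift_apply]
  rw [hpast _ (by omega)]

end TwoSided

section Cocycle

variable {G : Type*} [Group G]

lemma cocycle_succ_shift (Θ : OneSided A → G) (n : ℕ) (x : OneSided A) :
    cocycle Θ (n + 1) x = cocycle Θ n x.shift * Θ x := by
  induction n with
  | zero => simp [cocycle]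
  | succ n ih => rw [cocycle, ih, cocycle, ← mul_assoc, Function.iterate_succ_apply]

lemma cocycle_add (Θ : OneSided A → G) (m n : ℕ) (x : OneSided A) :
    cocycle Θ (m + n) x = cocycle Θ m (OneSided.shift^[n] x) * cocycle Θ n x := by
  induction m with
  | zero => simp [cocycle]
  | succ m ih =>
    rw [show m + 1 + n = (m + n) + 1 by ring, cocycle, ih, cocycle, ← mul_assoc,
      Function.iterate_add_apply]

lemma stable_twist_eq [TopologicalSpace G] [T2Space G] {Θ : OneSided A → G} {n₀ : ℕ}
    {z z' : TwoSided A} (hz : ∀ i : ℤ, (n₀ : ℤ) ≤ i → z'.1 i = z.1 i) {g : G}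
    (hg : Tendsto (fun n => (cocycle Θ n z'.future)⁻¹ * cocycle Θ n z.future) atTop (𝓝 g)) :
    g = (cocycle Θ n₀ z'.future)⁻¹ * cocycle Θ n₀ z.future := by
  have hfuture : OneSided.shift^[n₀] z'.future = OneSided.shift^[n₀] z.future := by
    ext i : 1
    rw [OneSided.iterate_shift_apply, OneSided.iterate_shift_apply, TwoSided.future_apply,
      TwoSided.future_apply, hz _ (by push_cast; omega)]
  refine tendsto_nhds_unique hg (tendsto_const_nhds.congr' ?_)
  filter_upwards [eventually_ge_atTop n₀] with n hn
  obtain ⟨m, rfl⟩ := Nat.exists_eq_add_of_le' hn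
  rw [cocycle_add, cocycle_add, hfuture]
  group

end Cocycle

/-! ### Cocycles with values in a group with a bi-invariant metric -/

section BiinvariantMetric

variable {Γ : Type*} [Group Γ] [PseudoMetricSpace Γ] [IsIsometricSMul Γ Γ]
  [IsIsometricSMul Γᵐᵒᵖ Γ]

lemma dist_mul_mul_le_dist_add_dist (a b a' b' : Γ) :
    dist (a * b) (a' * b') ≤ dist a a' + dist b b' :=
  calc dist (a * b) (a' * b') ≤ dist (a * b) (a' * b) + dist (a' * b) (a' * b') :=
        dist_triangle _ _ _
    _ = dist a a' + dist b b' := by rw [dist_mul_right, dist_mul_left]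

variable {K : ℝ} {Θ : OneSided A → Γ}

lemma dist_cocycle_le (h0 : 0 ≤ lam) (h1 : lam < 1) (hK : 0 ≤ K) (hΘ : LipschitzBound lam K Θ)
    (k n : ℕ) {x y : OneSided A} (hxy : ∀ i < n + k, x.1 i = y.1 i) :
    dist (cocycle Θ n x) (cocycle Θ n y) ≤ K * lam ^ k / (1 - lam) := by
  have hgap : 0 < 1 - lam := by linarith
  have hgeom : dist (cocycle Θ n x) (cocycle Θ n y) ≤
      K * lam ^ k * ((1 - lam ^ n) / (1 - lam)) := by
    induction n generalizing x y with
    | zero => simp [cocycle]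
    | succ n ih =>
      have htail := ih (x := x.shift) (y := y.shift) (fun i hi => hxy (i + 1) (by omega))
      have hhead : dist (Θ x) (Θ y) ≤ K * (lam ^ k * lam ^ n) := by
        refine (hΘ x y).trans (mul_le_mul_of_nonneg_left ?_ hK)
        rw [← pow_add]
        exact OneSided.dist_le_pow h0 h1.le fun i hi => hxy i (by omega)
      rw [cocycle_succ_shift, cocycle_succ_shift]
      refine (dist_mul_mul_le_dist_add_dist _ _ _ _).trans
        ((add_le_add htail hhead).trans_eq ?_)
      field_simp
      ring
  refine hgeom.trans ?_
  rw [mul_div_assoc']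
  exact div_le_div_of_nonneg_right (mul_le_of_le_one_right (by positivity)
    (sub_le_self 1 (pow_nonneg h0 n))) hgap.le

/-- The factor by which an unstable twist changes at the next step is conjugate to
`Θ(a') Θ(a)⁻¹`, where `a` and `a'` share a long past and hence are close. -/
lemma dist_unstable_twist_succ (Θ : OneSided A → Γ) (z z' : TwoSided A) (n : ℕ) :
    dist (cocycle Θ n (z'.shiftBack n).future * (cocycle Θ n (z.shiftBack n).future)⁻¹)
      (cocycle Θ (n + 1) (z'.shiftBack (n + 1)).future *
        (cocycle Θ (n + 1) (z.shiftBack (n + 1)).future)⁻¹) =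
      dist (Θ (z.shiftBack (n + 1)).future) (Θ (z'.shiftBack (n + 1)).future) := by
  set a := (z.shiftBack (n + 1)).future
  set a' := (z'.shiftBack (n + 1)).future
  have hsucc : cocycle Θ (n + 1) a' * (cocycle Θ (n + 1) a)⁻¹ =
      cocycle Θ n (z'.shiftBack n).future * (Θ a' * (Θ a)⁻¹) *
        (cocycle Θ n (z.shiftBack n).future)⁻¹ := by
    rw [cocycle_succ_shift, cocycle_succ_shift, TwoSided.shift_future_shiftBack_succ,
      TwoSided.shift_future_shiftBack_succ]
    group
  have hself (c d : Γ) : c * d = c * (Θ a * (Θ a)⁻¹) * d := by group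
  rw [hsucc, hself, dist_mul_right, dist_mul_left, dist_mul_right]

lemma dist_unstable_twist_le (h0 : 0 ≤ lam) (h1 : lam < 1) (hK : 0 ≤ K)
    (hΘ : LipschitzBound lam K Θ) {n₀ q : ℕ} (hq : n₀ ≤ q) {z z' : TwoSided A}
    (hz : ∀ i : ℤ, i ≤ -(n₀ : ℤ) → z'.1 i = z.1 i) {g : Γ}
    (hg : Tendsto (fun n => cocycle Θ n (z'.shiftBack n).future *
      (cocycle Θ n (z.shiftBack n).future)⁻¹) atTop (𝓝 g)) :
    dist (cocycle Θ q (z'.shiftBack q).future * (cocycle Θ q (z.shiftBack q).future)⁻¹) g ≤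
      K * lam ^ (q - n₀) / (1 - lam) := by
  set twist : ℕ → Γ := fun n => cocycle Θ n (z'.shiftBack n).future *
    (cocycle Θ n (z.shiftBack n).future)⁻¹
  have hstep : ∀ n, dist (twist (n + q)) (twist (n + 1 + q)) ≤ K * lam ^ (q - n₀) * lam ^ n := by
    intro n
    rw [show n + 1 + q = (n + q) + 1 by ring, mul_assoc, ← pow_add]
    refine (dist_unstable_twist_succ Θ z z' (n + q)).le.trans ((hΘ _ _).trans ?_)
    refine mul_le_mul_of_nonneg_left (OneSided.dist_le_pow h0 h1.le fun i hi => ?_) hK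
    rw [TwoSided.future_shiftBack_apply, TwoSided.future_shiftBack_apply,
      hz _ (by push_cast; omega)]
  have hlim : Tendsto (fun n => twist (n + q)) atTop (𝓝 g) := (tendsto_add_atTop_iff_nat q).2 hg
  simpa only [zero_add] using dist_le_of_le_geometric_of_tendsto₀ lam _ h1 hstep hlim

end BiinvariantMetric

lemma dist_smul_chainTwists_le {Γ V : Type*} [Group Γ] [TopologicalSpace Γ] [PseudoMetricSpace V]
    [MulAction Γ V] [IsIsometricSMul Γ V] {r : OneSided A → ℝ} {Θ : OneSided A → Γ} {n₀ p₀ : ℕ}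
    {f : TwoSided A → V} {ε : ℝ} (hε : 0 ≤ ε)
    (hf : ∀ z z' t g, IsLeg r Θ n₀ z z' t g → dist (f z') (g • f z) ≤ ε) {w : TwoSided A} {a : Γ}
    (ha : a ∈ chainTwists r Θ w n₀ p₀) : dist (f w) (a • f w) ≤ p₀ * ε := by
  obtain ⟨p, chain, t, g, hp, rfl, hclosed, hlegs, -, rfl⟩ := ha
  have hpartial : ∀ i ≤ p, dist (f (chain i)) (((List.range i).reverse.map g).prod • f (chain 0)) ≤
      i * ε := by
    intro i
    induction i with
    | zero => simp
    | succ i ih =>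
      intro hi
      have hprev := ih (by omega)
      have hleg := hf _ _ _ _ (hlegs i (by omega))
      rw [List.range_succ, List.reverse_append, List.reverse_singleton, List.singleton_append,
        List.map_cons, List.prod_cons, mul_smul]
      refine (dist_triangle _ (g i • f (chain i)) _).trans ?_
      rw [dist_smul, Nat.cast_succ]
      linarith
  calc dist (f (chain 0)) _ = dist (f (chain p)) _ := by rw [hclosed]
    _ ≤ p * ε := hpartial p le_rfl
    _ ≤ p₀ * ε := by gcongr

end Symbolic

/-! ### Transfer operators twisted by a unitary cocycle -/

section UnitaryGroup

variable {R : Type*} [NormedRing R] [StarRing R] [CStarRing R]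

instance unitary_isIsometricSMul_left : IsIsometricSMul (unitary R) (unitary R) :=
  ⟨fun u => Isometry.of_dist_eq fun a b => by
    rw [Subtype.dist_eq, Subtype.dist_eq, dist_eq_norm, dist_eq_norm, smul_eq_mul, smul_eq_mul,
      Submonoid.coe_mul, Submonoid.coe_mul, ← mul_sub, CStarRing.norm_coe_unitary_mul]⟩

instance unitary_isIsometricSMul_right : IsIsometricSMul (unitary R)ᵐᵒᵖ (unitary R) :=
  ⟨fun u => Isometry.of_dist_eq fun a b => by
    rw [Subtype.dist_eq, Subtype.dist_eq, dist_eq_norm, dist_eq_norm, MulOpposite.smul_eq_mul_unop,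
      MulOpposite.smul_eq_mul_unop, Submonoid.coe_mul, Submonoid.coe_mul, ← sub_mul,
      CStarRing.norm_mul_coe_unitary]⟩

variable {V : Type*} [NormedAddCommGroup V] [InnerProductSpace ℂ V] [CompleteSpace V]

instance unitary_isIsometricSMul : IsIsometricSMul (unitary (V →L[ℂ] V)) V :=
  ⟨fun u => Isometry.of_dist_eq fun v w => by
    rw [dist_eq_norm, dist_eq_norm, ← smul_sub]
    exact Unitary.norm_map u _⟩

lemma norm_unitary_smul (u : unitary (V →L[ℂ] V)) (v : V) : ‖u • v‖ = ‖v‖ :=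
  Unitary.norm_map u v

lemma inner_unitary_inv_smul_left (u : unitary (V →L[ℂ] V)) (v w : V) :
    inner ℂ (u⁻¹ • v) w = inner ℂ v (u • w) := by
  conv_rhs => rw [← smul_inv_smul u v]
  exact (Unitary.inner_map_map u (u⁻¹ • v) w).symm

lemma norm_unitary_smul_sub_smul_le (u u' : unitary (V →L[ℂ] V)) (v : V) :
    ‖u • v - u' • v‖ ≤ dist u u' * ‖v‖ := by
  rw [Subtype.dist_eq, dist_eq_norm]
  exact ((u : V →L[ℂ] V) - u').le_opNorm v

end UnitaryGroup

section UnitaryTransfer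

variable {N : ℕ} {A : Matrix (Fin N) (Fin N) ℕ}
variable {V : Type*} [NormedAddCommGroup V] [InnerProductSpace ℂ V] [CompleteSpace V]

/-- The operator `h ↦ ∑_{σ y = x} p(y) U(y) h(y)`, of which the twisted transfer operators
`𝓛_{ib,π}` are instances with `p = e^φ` and `U = e^{-ibr} π(Θ)`. -/
noncomputable def unitaryTransfer (p : OneSided A → ℝ) (U : OneSided A → unitary (V →L[ℂ] V))
    (h : OneSided A → V) : OneSided A → V :=
  fun x => ∑ᶠ (y : OneSided A) (_ : y.shift = x), (p y : ℂ) • U y • h y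

lemma unitaryTransfer_apply (p : OneSided A → ℝ) (U : OneSided A → unitary (V →L[ℂ] V))
    (h : OneSided A → V) (x : OneSided A) :
    unitaryTransfer p U h x = ∑ i ∈ OneSided.letters x,
      (p (OneSided.cons i x) : ℂ) • U (OneSided.cons i x) • h (OneSided.cons i x) :=
  OneSided.finsum_preimages _ x

lemma unitaryTransfer_smul (p : OneSided A → ℝ) (U : OneSided A → unitary (V →L[ℂ] V)) (c : ℂ)
    (h : OneSided A → V) : unitaryTransfer p U (c • h) = c • unitaryTransfer p U h := by
  funext x
  simp only [unitaryTransfer_apply, Pi.smul_apply, Finset.smul_sum]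
  exact Finset.sum_congr rfl fun i _ => by rw [smul_comm _ c, smul_comm _ c]

lemma iterate_unitaryTransfer_smul (p : OneSided A → ℝ) (U : OneSided A → unitary (V →L[ℂ] V))
    (c : ℂ) (n : ℕ) (h : OneSided A → V) :
    (unitaryTransfer p U)^[n] (c • h) = c • (unitaryTransfer p U)^[n] h :=
  (Function.Commute.iterate_left (unitaryTransfer_smul p U c) n) h

/-- The weights `p` are positive and sum to one over the preimages of each point. -/
def IsNormalizedWeight (p : OneSided A → ℝ) : Prop :=
  (∀ y, 0 < p y) ∧ ∀ x, ∑ i ∈ OneSided.letters x, p (OneSided.cons i x) = 1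

variable {p : OneSided A → ℝ} {U : OneSided A → unitary (V →L[ℂ] V)} {h : OneSided A → V}

lemma norm_unitaryTransfer_le (hp : IsNormalizedWeight p) {R : ℝ} (hR : ∀ x, ‖h x‖ ≤ R)
    (x : OneSided A) : ‖unitaryTransfer p U h x‖ ≤ R := by
  rw [unitaryTransfer_apply]
  calc _ ≤ ∑ i ∈ OneSided.letters x, p (OneSided.cons i x) * R := by
        refine (norm_sum_le _ _).trans (Finset.sum_le_sum fun i _ => ?_)
        rw [norm_smul, norm_unitary_smul, Complex.norm_of_nonneg (hp.1 _).le]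
        exact mul_le_mul_of_nonneg_left (hR _) (hp.1 _).le
    _ = R := by rw [← Finset.sum_mul, hp.2, one_mul]

lemma norm_iterate_unitaryTransfer_le (hp : IsNormalizedWeight p) {R : ℝ} (hR : ∀ x, ‖h x‖ ≤ R)
    (n : ℕ) (x : OneSided A) : ‖(unitaryTransfer p U)^[n] h x‖ ≤ R := by
  induction n generalizing x with
  | zero => exact hR x
  | succ n ih =>
    rw [Function.iterate_succ_apply']
    exact norm_unitaryTransfer_le hp ih x

section LasotaYorke

variable {lam Kp K R L : ℝ}

lemma norm_smul_unitary_smul_sub_le (a a' : ℝ) (u u' : unitary (V →L[ℂ] V)) (v v' : V) :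
    ‖(a : ℂ) • u • v - (a' : ℂ) • u' • v'‖ ≤
      |a - a'| * ‖v'‖ + |a| * (dist u u' * ‖v'‖ + ‖v - v'‖) := by
  have hsplit : (a : ℂ) • u • v - (a' : ℂ) • u' • v' =
      ((a - a' : ℝ) : ℂ) • u' • v' + (a : ℂ) • ((u • v' - u' • v') + u • (v - v')) := by
    rw [smul_sub, smul_add, smul_sub, smul_sub, Complex.ofReal_sub, sub_smul]
    abel
  rw [hsplit]
  refine (norm_add_le _ _).trans (add_le_add ?_ ?_)
  · rw [norm_smul, norm_unitary_smul, Complex.norm_real, Real.norm_eq_abs]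
  · rw [norm_smul, Complex.norm_real, Real.norm_eq_abs]
    gcongr
    refine (norm_add_le _ _).trans ?_
    rw [norm_unitary_smul u]
    gcongr
    exact norm_unitary_smul_sub_smul_le u u' v'

lemma norm_unitaryTransfer_sub_le_of_apply_zero_eq (h0 : 0 ≤ lam) (h1 : lam ≤ 1)
    (hp : IsNormalizedWeight p) (hKp : 0 ≤ Kp) (hK : 0 ≤ K) (hR0 : 0 ≤ R) (hL0 : 0 ≤ L)
    (hpL : LipschitzBound lam Kp p) (hU : LipschitzBound lam K U) (hR : ∀ x, ‖h x‖ ≤ R)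
    (hL : LipschitzBound lam L h) {x y : OneSided A} (hxy : x.1 0 = y.1 0) :
    ‖unitaryTransfer p U h x - unitaryTransfer p U h y‖ ≤
      ((N * Kp + K) * R + lam * L) * OneSided.dist lam x y := by
  set d := OneSided.dist lam x y
  have hd : 0 ≤ d := OneSided.dist_nonneg h0 x y
  have hterm : ∀ i ∈ OneSided.letters x,
      ‖(p (OneSided.cons i x) : ℂ) • U (OneSided.cons i x) • h (OneSided.cons i x)
        - (p (OneSided.cons i y) : ℂ) • U (OneSided.cons i y) • h (OneSided.cons i y)‖ ≤
        Kp * d * R + p (OneSided.cons i x) * (K * d * R + L * (lam * d)) := by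
    intro i hi
    have hcontract := OneSided.dist_cons_le h0 h1 hxy hi
    have hle := hcontract.trans (mul_le_of_le_one_left hd h1)
    refine (norm_smul_unitary_smul_sub_le _ _ _ _ _ _).trans ?_
    rw [abs_of_pos (hp.1 (OneSided.cons i x)), ← Real.dist_eq, ← dist_eq_norm (h _)]
    have hp0 := (hp.1 (OneSided.cons i x)).le
    gcongr
    · exact (hpL _ _).trans (by gcongr)
    · exact hR _
    · exact (hU _ _).trans (by gcongr)
    · exact hR _
    · exact (hL _ _).trans (by gcongr)
  rw [unitaryTransfer_apply, unitaryTransfer_apply, ← OneSided.letters_congr hxy,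
    ← Finset.sum_sub_distrib]
  calc _ ≤ ∑ i ∈ OneSided.letters x,
        (Kp * d * R + p (OneSided.cons i x) * (K * d * R + L * (lam * d))) :=
        (norm_sum_le _ _).trans (Finset.sum_le_sum hterm)
    _ = (OneSided.letters x).card * (Kp * d * R) + (K * d * R + L * (lam * d)) := by
        rw [Finset.sum_add_distrib, Finset.sum_const, nsmul_eq_mul, ← Finset.sum_mul, hp.2,
          one_mul]
    _ ≤ N * (Kp * d * R) + (K * d * R + L * (lam * d)) := by
        gcongr
        exact OneSided.card_letters_le x
    _ = ((N * Kp + K) * R + lam * L) * d := by ring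

lemma lipschitzBound_unitaryTransfer (h0 : 0 ≤ lam) (h1 : lam ≤ 1) (hp : IsNormalizedWeight p)
    (hKp : 0 ≤ Kp) (hK : 0 ≤ K) (hR0 : 0 ≤ R) (hL0 : 0 ≤ L) (hpL : LipschitzBound lam Kp p)
    (hU : LipschitzBound lam K U) (hR : ∀ x, ‖h x‖ ≤ R) (hL : LipschitzBound lam L h) :
    LipschitzBound lam ((N * Kp + K + 2) * R + lam * L) (unitaryTransfer p U h) := by
  intro x y
  rw [dist_eq_norm]
  by_cases hxy : x.1 0 = y.1 0
  · refine (norm_unitaryTransfer_sub_le_of_apply_zero_eq h0 h1 hp hKp hK hR0 hL0 hpL hU hR hL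
      hxy).trans (mul_le_mul_of_nonneg_right ?_ (OneSided.dist_nonneg h0 x y))
    linarith
  · rw [OneSided.dist_eq_one lam hxy, mul_one]
    have htail : 0 ≤ (N * Kp + K) * R + lam * L := by positivity
    linarith [norm_sub_le (unitaryTransfer p U h x) (unitaryTransfer p U h y),
      norm_unitaryTransfer_le (U := U) hp hR x, norm_unitaryTransfer_le (U := U) hp hR y]

lemma lipschitzBound_iterate_unitaryTransfer (h0 : 0 ≤ lam) (h1 : lam < 1)
    (hp : IsNormalizedWeight p) (hKp : 0 ≤ Kp) (hK : 0 ≤ K) (hR0 : 0 ≤ R) (hL0 : 0 ≤ L)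
    (hpL : LipschitzBound lam Kp p) (hU : LipschitzBound lam K U) (hR : ∀ x, ‖h x‖ ≤ R)
    (hL : LipschitzBound lam L h) (n : ℕ) :
    LipschitzBound lam ((N * Kp + K + 2) * R / (1 - lam) + lam ^ n * L)
      ((unitaryTransfer p U)^[n] h) := by
  have hgap : 0 < 1 - lam := by linarith
  induction n with
  | zero =>
    intro x y
    refine (hL x y).trans (mul_le_mul_of_nonneg_right ?_ (OneSided.dist_nonneg h0 _ _))
    rw [pow_zero, one_mul]
    exact le_add_of_nonneg_left (by positivity)
  | succ n ih =>
    rw [Function.iterate_succ_apply']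
    convert lipschitzBound_unitaryTransfer h0 h1.le hp hKp hK hR0 (by positivity) hpL hU
      (norm_iterate_unitaryTransfer_le hp hR n) ih using 1
    field_simp
    ring

end LasotaYorke

section NearMaximal

variable {c ε : ℝ} {e : V}

lemma le_re_inner_of_le_re_inner_unitaryTransfer (hp : IsNormalizedWeight p)
    (hc : ∀ y, 1 ≤ c * p y) (hh : ∀ x, ‖h x‖ ≤ 1) (he : ‖e‖ = 1) (y : OneSided A)
    (hε : 1 - ε ≤ (inner ℂ e (unitaryTransfer p U h y.shift)).re) :
    1 - c * ε ≤ (inner ℂ e (U y • h y)).re := by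
  set a : OneSided A → ℝ := fun z => (inner ℂ e (U z • h z)).re
  have ha : ∀ z, a z ≤ 1 := fun z =>
    calc a z ≤ ‖e‖ * ‖U z • h z‖ := (Complex.re_le_norm _).trans (norm_inner_le_norm _ _)
      _ ≤ 1 := by rw [he, one_mul, norm_unitary_smul]; exact hh z
  have havg : ∑ i ∈ OneSided.letters y.shift, p (OneSided.cons i y.shift) *
      (1 - a (OneSided.cons i y.shift)) ≤ ε := by
    rw [unitaryTransfer_apply, inner_sum, Complex.re_sum] at hε
    simp only [inner_smul_right, Complex.re_ofReal_mul] at hε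
    simp only [mul_sub, mul_one, Finset.sum_sub_distrib, hp.2]
    linarith
  have hy : p y * (1 - a y) ≤ ε := by
    have hsingle := (Finset.single_le_sum
      (fun i _ => mul_nonneg (hp.1 (OneSided.cons i y.shift)).le (sub_nonneg.2 (ha _)))
      (OneSided.apply_zero_mem_letters_shift y)).trans havg
    rwa [OneSided.cons_shift] at hsingle
  have hc0 : 0 ≤ c := (pos_of_mul_pos_left (one_pos.trans_le (hc y)) (hp.1 y).le).le
  suffices 1 - a y ≤ c * ε by change 1 - c * ε ≤ a y; linarith
  calc 1 - a y ≤ c * p y * (1 - a y) :=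
        le_mul_of_one_le_left (sub_nonneg.2 (ha y)) (hc y)
    _ = c * (p y * (1 - a y)) := mul_assoc _ _ _
    _ ≤ c * ε := mul_le_mul_of_nonneg_left hy hc0

lemma le_re_inner_cocycle (hp : IsNormalizedWeight p) (hc : ∀ y, 1 ≤ c * p y)
    (hh : ∀ x, ‖h x‖ ≤ 1) (n : ℕ) (he : ‖e‖ = 1) (y : OneSided A)
    (hε : 1 - ε ≤ (inner ℂ e ((unitaryTransfer p U)^[n] h (OneSided.shift^[n] y))).re) :
    1 - c ^ n * ε ≤ (inner ℂ e (cocycle U n y • h y)).re := by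
  induction n generalizing e ε with
  | zero => simpa [cocycle] using hε
  | succ n ih =>
    rw [Function.iterate_succ_apply', Function.iterate_succ_apply'] at hε
    have hlast := le_re_inner_of_le_re_inner_unitaryTransfer hp hc
      (norm_iterate_unitaryTransfer_le hp hh n) he _ hε
    rw [← inner_unitary_inv_smul_left] at hlast
    have hfirst := ih (by rw [norm_unitary_smul, he]) hlast
    rwa [inner_unitary_inv_smul_left, ← mul_smul, ← mul_assoc, ← pow_succ] at hfirst

lemma norm_cocycle_smul_sub_le (hp : IsNormalizedWeight p) (hc : ∀ y, 1 ≤ c * p y)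
    (hh : ∀ x, ‖h x‖ ≤ 1) (n : ℕ) (he : ‖e‖ = 1) (y : OneSided A)
    (hε : 1 - ε ≤ (inner ℂ e ((unitaryTransfer p U)^[n] h (OneSided.shift^[n] y))).re) :
    ‖cocycle U n y • h y - e‖ ≤ Real.sqrt (2 * (c ^ n * ε)) := by
  apply Real.le_sqrt_of_sq_le
  have hinner := le_re_inner_cocycle hp hc hh n he y hε
  have hsq : ‖h y‖ ^ 2 ≤ 1 := pow_le_one₀ (norm_nonneg _) (hh y)
  rw [norm_sub_rev, @norm_sub_sq ℂ, he, norm_unitary_smul]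
  simp only [RCLike.re_to_complex]
  linarith

end NearMaximal

end UnitaryTransfer

/-! ### Approximate eigenvectors along closed chains -/

section Chains

variable {N : ℕ} {A : Matrix (Fin N) (Fin N) ℕ} {lam K : ℝ} {n₀ q M : ℕ}

section BiinvariantMetric

variable {Γ : Type*} [Group Γ] [PseudoMetricSpace Γ] [IsIsometricSMul Γ Γ]
  [IsIsometricSMul Γᵐᵒᵖ Γ] {Θ : OneSided A → Γ} {z z' : TwoSided A} {g : Γ}

lemma dist_inv_cocycle_stable_twist_mul_le [T2Space Γ] (h0 : 0 ≤ lam) (h1 : lam < 1) (hK : 0 ≤ K)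
    (hΘ : LipschitzBound lam K Θ) (hz : ∀ i : ℤ, (n₀ : ℤ) ≤ i → z'.1 i = z.1 i)
    (hg : Tendsto (fun n => (cocycle Θ n z'.future)⁻¹ * cocycle Θ n z.future) atTop (𝓝 g))
    {x x' : OneSided A} {k n : ℕ} (hn : n₀ ≤ n) (hx : ∀ i < n₀ + k, x.1 i = z.future.1 i)
    (hx' : ∀ i < n₀ + k, x'.1 i = z'.future.1 i)
    (hxx' : OneSided.shift^[n₀] x' = OneSided.shift^[n₀] x) :
    dist (cocycle Θ n x')⁻¹ (g * (cocycle Θ n x)⁻¹) ≤ 2 * (K * lam ^ k / (1 - lam)) := by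
  obtain ⟨m, rfl⟩ := Nat.exists_eq_add_of_le' hn
  have hcancel : (cocycle Θ n₀ x')⁻¹ =
      (cocycle Θ n₀ x')⁻¹ * cocycle Θ n₀ x * (cocycle Θ n₀ x)⁻¹ := by group
  rw [cocycle_add, cocycle_add, hxx', mul_inv_rev, mul_inv_rev, ← mul_assoc g, dist_mul_right,
    hcancel, dist_mul_right, stable_twist_eq hz hg, two_mul]
  refine (dist_mul_mul_le_dist_add_dist _ _ _ _).trans (add_le_add ?_ ?_)
  · rw [dist_inv_inv]
    exact dist_cocycle_le h0 h1 hK hΘ _ _ hx'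
  · exact dist_cocycle_le h0 h1 hK hΘ _ _ hx

lemma dist_cocycle_mul_inv_unstable_twist_le (h0 : 0 ≤ lam) (h1 : lam < 1) (hK : 0 ≤ K)
    (hΘ : LipschitzBound lam K Θ) (hq : n₀ ≤ q)
    (hz : ∀ i : ℤ, i ≤ -(n₀ : ℤ) → z'.1 i = z.1 i)
    (hg : Tendsto (fun n => cocycle Θ n (z'.shiftBack n).future *
      (cocycle Θ n (z.shiftBack n).future)⁻¹) atTop (𝓝 g)) {y y' : OneSided A}
    (hy : ∀ i < q + (q - n₀), y.1 i = (z.shiftBack q).future.1 i)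
    (hy' : ∀ i < q + (q - n₀), y'.1 i = (z'.shiftBack q).future.1 i) :
    dist (cocycle Θ q y' * (cocycle Θ q y)⁻¹) g ≤ 3 * (K * lam ^ (q - n₀) / (1 - lam)) := by
  have htwist := dist_unstable_twist_le h0 h1 hK hΘ hq hz hg
  have hquot := dist_mul_mul_le_dist_add_dist (cocycle Θ q y') (cocycle Θ q y)⁻¹
    (cocycle Θ q (z'.shiftBack q).future) (cocycle Θ q (z.shiftBack q).future)⁻¹
  rw [dist_inv_inv] at hquot
  linarith [dist_triangle (cocycle Θ q y' * (cocycle Θ q y)⁻¹)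
    (cocycle Θ q (z'.shiftBack q).future * (cocycle Θ q (z.shiftBack q).future)⁻¹) g,
    dist_cocycle_le h0 h1 hK hΘ _ _ hy, dist_cocycle_le h0 h1 hK hΘ _ _ hy']

end BiinvariantMetric

lemma exists_unit_re_inner_eq_norm {V : Type*} [NormedAddCommGroup V] [InnerProductSpace ℂ V]
    {v : V} (hv : v ≠ 0) :
    ∃ e : V, ‖e‖ = 1 ∧ (inner ℂ e v).re = ‖v‖ := by
  have hnorm : ‖v‖ ≠ 0 := norm_ne_zero_iff.2 hv
  refine ⟨((‖v‖⁻¹ : ℝ) : ℂ) • v, ?_, ?_⟩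
  · rw [norm_smul, Complex.norm_real, norm_inv, norm_norm, inv_mul_cancel₀ hnorm]
  · rw [inner_smul_left, Complex.conj_ofReal, inner_self_eq_norm_sq_to_K, Complex.re_ofReal_mul,
      RCLike.ofReal_eq_complex_ofReal, ← Complex.ofReal_pow, Complex.ofReal_re]
    field_simp

variable {V : Type*} [NormedAddCommGroup V] [InnerProductSpace ℂ V] [CompleteSpace V]
  {U : OneSided A → unitary (V →L[ℂ] V)} {T : Fin N → OneSided A} {e : V}

/-- The vector `e`, thought of as sitting at time `q + M` on the orbit of the point glued from `z`,
transported back to time `0` of `z`. -/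
noncomputable def gluedSection (U : OneSided A → unitary (V →L[ℂ] V)) (q M : ℕ)
    (hT : ∀ i, (T i).1 0 = i) (e : V) (z : TwoSided A) : V :=
  (cocycle U (q + M) (OneSided.shift^[q] (z.glue q hT)))⁻¹ • e

lemma norm_gluedSection (hT : ∀ i, (T i).1 0 = i) (he : ‖e‖ = 1) (z : TwoSided A) :
    ‖gluedSection U q M hT e z‖ = 1 := by
  rw [gluedSection, norm_unitary_smul, he]

lemma norm_gluedSection_sub_stable_twist_smul_le (h0 : 0 ≤ lam) (h1 : lam < 1) (hK : 0 ≤ K)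
    (hU : LipschitzBound lam K U) (hq : n₀ ≤ q) (hT : ∀ i, (T i).1 0 = i) (he : ‖e‖ = 1)
    {z z' : TwoSided A} (hz : ∀ i : ℤ, (n₀ : ℤ) ≤ i → z'.1 i = z.1 i) {g : unitary (V →L[ℂ] V)}
    (hg : Tendsto (fun n => (cocycle U n z'.future)⁻¹ * cocycle U n z.future) atTop (𝓝 g)) :
    ‖gluedSection U q M hT e z' - g • gluedSection U q M hT e z‖ ≤
      2 * (K * lam ^ (q - n₀) / (1 - lam)) := by
  rw [gluedSection, gluedSection, ← mul_smul]
  refine (norm_unitary_smul_sub_smul_le _ _ _).trans ?_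
  rw [he, mul_one]
  exact dist_inv_cocycle_stable_twist_mul_le h0 h1 hK hU hz hg (by omega)
    (fun i hi => TwoSided.iterate_shift_glue_apply hT z (by omega))
    (fun i hi => TwoSided.iterate_shift_glue_apply hT z' (by omega))
    (TwoSided.iterate_shift_glue_congr hT hq hz)

lemma norm_gluedSection_sub_cocycle_smul (hT : ∀ i, (T i).1 0 = i) (z : TwoSided A) (v : V) :
    ‖gluedSection U q M hT e z - cocycle U q (z.glue q hT) • v‖ =
      ‖cocycle U (q + M + q) (z.glue q hT) • v - e‖ := by
  set u := cocycle U (q + M) (OneSided.shift^[q] (z.glue q hT))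
  rw [cocycle_add U (q + M) q, mul_smul, norm_sub_rev, gluedSection, ← norm_unitary_smul u,
    smul_sub, smul_inv_smul]

lemma norm_sub_unitary_smul_le (u u' g : unitary (V →L[ℂ] V)) (v v' f f' : V) :
    ‖f' - g • f‖ ≤
      ‖f' - u' • v'‖ + ‖v' - v‖ + ‖f - u • v‖ + dist (u' * u⁻¹) g * ‖f‖ := by
  have hsplit : f' - g • f = (f' - u' • v') + u' • (v' - v) + -((u' * u⁻¹) • (f - u • v)) +
      ((u' * u⁻¹) • f - g • f) := by
    rw [smul_sub, smul_sub, mul_smul _ _ (u • v), inv_smul_smul]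
    abel
  rw [hsplit]
  refine norm_add_le_of_le (norm_add₃_le.trans_eq ?_) (norm_unitary_smul_sub_smul_le _ _ _)
  rw [norm_neg, norm_unitary_smul, norm_unitary_smul]

variable {L η : ℝ} {h : OneSided A → V}

lemma norm_gluedSection_sub_unstable_twist_smul_le (h0 : 0 ≤ lam) (h1 : lam < 1) (hK : 0 ≤ K)
    (hU : LipschitzBound lam K U) (hq : n₀ ≤ q) (hT : ∀ i, (T i).1 0 = i) (he : ‖e‖ = 1)
    (hL0 : 0 ≤ L) (hL : LipschitzBound lam L h)
    (hη : ∀ z : TwoSided A,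
      ‖cocycle U (q + M + q) (z.glue q hT) • h (z.glue q hT) - e‖ ≤ η)
    {z z' : TwoSided A} (hz : ∀ i : ℤ, i ≤ -(n₀ : ℤ) → z'.1 i = z.1 i) {g : unitary (V →L[ℂ] V)}
    (hg : Tendsto (fun n => cocycle U n (z'.shiftBack n).future *
      (cocycle U n (z.shiftBack n).future)⁻¹) atTop (𝓝 g)) :
    ‖gluedSection U q M hT e z' - g • gluedSection U q M hT e z‖ ≤
      2 * η + (L + 3 * (K / (1 - lam))) * lam ^ (q - n₀) := by
  have hpast : ‖h (z'.glue q hT) - h (z.glue q hT)‖ ≤ L * lam ^ (q - n₀) := by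
    rw [← dist_eq_norm]
    refine (hL _ _).trans (mul_le_mul_of_nonneg_left
      (OneSided.dist_le_pow h0 h1.le fun i hi => ?_) hL0)
    rw [TwoSided.glue_apply hT _ (by omega), TwoSided.glue_apply hT _ (by omega), hz _ (by omega)]
  have hquot : dist (cocycle U q (z'.glue q hT) * (cocycle U q (z.glue q hT))⁻¹) g ≤
      3 * (K * lam ^ (q - n₀) / (1 - lam)) :=
    dist_cocycle_mul_inv_unstable_twist_le h0 h1 hK hU hq hz hg
      (fun i hi => TwoSided.glue_apply hT z (by omega))
      (fun i hi => TwoSided.glue_apply hT z' (by omega))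
  have hsplit := norm_sub_unitary_smul_le (cocycle U q (z.glue q hT))
    (cocycle U q (z'.glue q hT)) g (h (z.glue q hT)) (h (z'.glue q hT))
    (gluedSection U q M hT e z) (gluedSection U q M hT e z')
  rw [norm_gluedSection_sub_cocycle_smul, norm_gluedSection_sub_cocycle_smul,
    norm_gluedSection hT he, mul_one] at hsplit
  calc _ ≤ η + L * lam ^ (q - n₀) + η + 3 * (K * lam ^ (q - n₀) / (1 - lam)) :=
        hsplit.trans (by gcongr; exacts [hη z', hη z])
    _ = _ := by ring

lemma dist_gluedSection_twist_smul_le (h0 : 0 ≤ lam) (h1 : lam < 1) (hK : 0 ≤ K)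
    (hU : LipschitzBound lam K U) (hq : n₀ ≤ q) (hT : ∀ i, (T i).1 0 = i) (he : ‖e‖ = 1)
    (hL0 : 0 ≤ L) (hL : LipschitzBound lam L h)
    (hη : ∀ z : TwoSided A,
      ‖cocycle U (q + M + q) (z.glue q hT) • h (z.glue q hT) - e‖ ≤ η)
    {r : OneSided A → ℝ} {z z' : TwoSided A} {t : ℝ} {g : unitary (V →L[ℂ] V)}
    (hleg : IsLeg r U n₀ z z' t g) :
    dist (gluedSection U q M hT e z') (g • gluedSection U q M hT e z) ≤
      2 * η + (L + 3 * (K / (1 - lam))) * lam ^ (q - n₀) := by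
  have : 0 < 1 - lam := sub_pos.2 h1
  rw [dist_eq_norm]
  rcases hleg with ⟨hz, -, hg⟩ | ⟨hz, -, hg⟩
  · have hη0 : 0 ≤ η := (norm_nonneg _).trans (hη z)
    have hslack : 0 ≤ 2 * η + (L + K / (1 - lam)) * lam ^ (q - n₀) := by positivity
    refine (norm_gluedSection_sub_stable_twist_smul_le h0 h1 hK hU hq hT he hz hg).trans ?_
    rw [mul_div_right_comm]
    linarith
  · exact norm_gluedSection_sub_unstable_twist_smul_le h0 h1 hK hU hq hT he hL0 hL hη hz hg

/-- `M` steps suffice to steer any orbit to the near-maximum point `x`, so the transported values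
of `h` along all orbits nearly agree. -/
theorem exists_unit_almost_fixed_of_le_norm_iterate {p : OneSided A → ℝ} (hA01 : IsZeroOne A)
    (hM : ∀ i j, 0 < (A ^ M) i j) (h0 : 0 ≤ lam) (h1 : lam < 1) (hp : IsNormalizedWeight p)
    {c : ℝ} (hc : ∀ y, 1 ≤ c * p y) (hK : 0 ≤ K) (hU : LipschitzBound lam K U)
    (hh : ∀ x, ‖h x‖ ≤ 1) (hL0 : 0 ≤ L) (hL : LipschitzBound lam L h) (hq : n₀ ≤ q)
    {x : OneSided A} {ε : ℝ} (hε1 : ε < 1)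
    (hx : 1 - ε ≤ ‖(unitaryTransfer p U)^[q + M + q] h x‖) (r : OneSided A → ℝ)
    (w : TwoSided A) (p₀ : ℕ) :
    ∃ v : V, ‖v‖ = 1 ∧ ∀ a ∈ chainTwists r U w n₀ p₀,
      ‖v - a • v‖ ≤ p₀ * (2 * Real.sqrt (2 * (c ^ (q + M + q) * ε)) +
        (L + 3 * (K / (1 - lam))) * lam ^ (q - n₀)) := by
  have : 0 < 1 - lam := sub_pos.2 h1
  choose T hT hTx using fun i =>
    OneSided.exists_iterate_shift_eq_of_pow_pos hA01 M i x (hM i (x.1 0))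
  obtain ⟨e, he, hre⟩ := exists_unit_re_inner_eq_norm
    (norm_pos_iff.1 (show 0 < ‖(unitaryTransfer p U)^[q + M + q] h x‖ by linarith))
  have hend : ∀ z : TwoSided A, OneSided.shift^[q + M + q] (z.glue q hT) = x := fun z => by
    rw [show q + M + q = M + 2 * q by ring, Function.iterate_add_apply,
      TwoSided.iterate_shift_glue, hTx]
  have hη : ∀ z : TwoSided A,
      ‖cocycle U (q + M + q) (z.glue q hT) • h (z.glue q hT) - e‖ ≤
        Real.sqrt (2 * (c ^ (q + M + q) * ε)) := fun z =>
    norm_cocycle_smul_sub_le hp hc hh _ he _ (by rwa [hend, hre])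
  refine ⟨gluedSection U q M hT e w, norm_gluedSection hT he w, fun a ha => ?_⟩
  rw [← dist_eq_norm]
  exact dist_smul_chainTwists_le (by positivity)
    (fun z z' t g hleg => dist_gluedSection_twist_smul_le h0 h1 hK hU hq hT he hL0 hL hη hleg) ha

end Chains

/-! ### The choice of the number of iterates -/

section Exponents

lemma pow_le_rpow_of_mul_log_le {lam E β : ℝ} {k : ℕ} (h0 : 0 < lam) (h1 : lam ≤ 1) (hβ : 0 < β)
    (hk : E * Real.log β ≤ k) : lam ^ k ≤ β ^ (E * Real.log lam) := by
  rw [← Real.rpow_natCast, Real.rpow_def_of_pos h0, Real.rpow_def_of_pos hβ, Real.exp_le_exp]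
  have := mul_le_mul_of_nonpos_left hk (Real.log_nonpos h0.le h1)
  linarith

lemma pow_le_rpow_of_le_mul_log {c E β : ℝ} {k : ℕ} (hc : 1 ≤ c) (hβ : 0 < β)
    (hk : k ≤ E * Real.log β) : c ^ k ≤ β ^ (E * Real.log c) := by
  rw [← Real.rpow_natCast, Real.rpow_def_of_pos (by linarith), Real.rpow_def_of_pos hβ,
    Real.exp_le_exp]
  have := mul_le_mul_of_nonneg_left hk (Real.log_nonneg hc)
  linarith

lemma exists_mul_rpow_neg_lt {a κ : ℝ} (ha : 0 ≤ a) (hκ : 0 < κ) :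
    ∃ s ≥ (0 : ℝ), ∀ β ≥ (2 : ℝ), a * β ^ (-s) < κ := by
  obtain ⟨s, hs⟩ := exists_pow_lt_of_lt_one (show 0 < κ / (a + 1) by positivity)
    (show (1 / 2 : ℝ) < 1 by norm_num)
  rw [lt_div_iff₀ (by positivity)] at hs
  refine ⟨s, s.cast_nonneg, fun β hβ => ?_⟩
  have hβs : β ^ (-(s : ℝ)) ≤ (1 / 2) ^ s := by
    rw [Real.rpow_neg (by linarith), Real.rpow_natCast, one_div, inv_pow]
    exact inv_anti₀ (by positivity) (pow_le_pow_left₀ two_pos.le hβ s)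
  have hpos : (0 : ℝ) < (1 / 2) ^ s := by positivity
  linarith [mul_le_mul_of_nonneg_left hβs ha]

lemma exists_pow_le_rpow_neg {lam s : ℝ} (h0 : 0 < lam) (h1 : lam < 1) (hs : 0 < s) :
    ∃ E > (0 : ℝ), ∀ β > (0 : ℝ), ∀ k : ℕ, E * Real.log β ≤ k → lam ^ k ≤ β ^ (-s) := by
  have hlog : Real.log lam < 0 := Real.log_neg h0 h1
  refine ⟨s / -Real.log lam, div_pos hs (neg_pos.2 hlog), fun β hβ k hk => ?_⟩
  calc lam ^ k ≤ β ^ (s / -Real.log lam * Real.log lam) :=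
        pow_le_rpow_of_mul_log_le h0 h1.le hβ hk
    _ = β ^ (-s) := by rw [div_neg, neg_mul, div_mul_cancel₀ s hlog.ne]

lemma exists_iterate_split {lam c D : ℝ} (h0 : 0 < lam) (h1 : lam < 1) (hc : 1 ≤ c)
    (hD : 0 ≤ D) (n₀ M : ℕ) :
    ∃ C ≥ (2 : ℝ), ∃ C' > (0 : ℝ), ∀ β ≥ (2 : ℝ),
      lam ^ ⌈C' * Real.log β⌉₊ ≤ 1 / 4 ∧ ∃ q ≥ n₀, q + M + q ≤ ⌈C' * Real.log β⌉₊ ∧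
        c ^ (q + M + q) * β ^ (-C) ≤ (β ^ (-D)) ^ 2 ∧ β * lam ^ (q - n₀) ≤ β ^ (-D) := by
  obtain ⟨E, hE, hElam⟩ := exists_pow_le_rpow_neg h0 h1 (s := 1 + D) (by positivity)
  obtain ⟨F, hF, hFlam⟩ := exists_pow_le_rpow_neg h0 h1 two_pos
  have hlog2 : 0 < Real.log 2 := Real.log_pos one_lt_two
  set C' := 2 * E + (2 * n₀ + M + 2) / Real.log 2 + F with hC'
  have hC'c : 0 ≤ C' * Real.log c := mul_nonneg (by positivity) (Real.log_nonneg hc)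
  refine ⟨2 + C' * Real.log c + 2 * D, by linarith, C', by positivity, fun β hβ => ?_⟩
  have hβ0 : 0 < β := two_pos.trans_le hβ
  have hβ1 : 1 ≤ β := one_le_two.trans hβ
  have hlogβ : Real.log 2 ≤ Real.log β := Real.log_le_log two_pos hβ
  have hlogβ0 : 0 < Real.log β := hlog2.trans_le hlogβ
  constructor
  · calc lam ^ ⌈C' * Real.log β⌉₊ ≤ β ^ (-2 : ℝ) := hFlam β hβ0 _ <|
          (mul_le_mul_of_nonneg_right (le_add_of_nonneg_left (by positivity)) hlogβ0.le).trans
            (Nat.le_ceil _)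
      _ ≤ 2 ^ (-2 : ℝ) := Real.rpow_le_rpow_of_nonpos two_pos hβ (by norm_num)
      _ = 1 / 4 := by norm_num [Real.rpow_neg]
  set k := ⌈E * Real.log β⌉₊
  have hkE : (k : ℝ) < E * Real.log β + 1 := Nat.ceil_lt_add_one (by positivity)
  have hq : ((n₀ + k + M + (n₀ + k) : ℕ) : ℝ) ≤ C' * Real.log β := by
    have hn₀ : (2 * n₀ + M + 2 : ℝ) ≤ (2 * n₀ + M + 2) / Real.log 2 * Real.log β := by
      rw [div_mul_eq_mul_div, le_div_iff₀ hlog2]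
      exact mul_le_mul_of_nonneg_left hlogβ (by positivity)
    have hFβ : 0 ≤ F * Real.log β := by positivity
    rw [hC', add_mul, add_mul]
    push_cast
    linarith
  refine ⟨n₀ + k, Nat.le_add_right _ _, by exact_mod_cast hq.trans (Nat.le_ceil _), ?_, ?_⟩
  · calc c ^ (n₀ + k + M + (n₀ + k)) * β ^ (-(2 + C' * Real.log c + 2 * D))
        ≤ β ^ (C' * Real.log c) * β ^ (-(2 + C' * Real.log c + 2 * D)) :=
          mul_le_mul_of_nonneg_right (pow_le_rpow_of_le_mul_log hc hβ0 hq) (by positivity)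
      _ = β ^ (-2 - 2 * D) := by rw [← Real.rpow_add hβ0]; ring_nf
      _ ≤ β ^ (-D * 2) := Real.rpow_le_rpow_of_exponent_le hβ1 (by linarith)
      _ = (β ^ (-D)) ^ 2 := by rw [Real.rpow_mul hβ0.le, Real.rpow_two]
  · calc β * lam ^ (n₀ + k - n₀) ≤ β * β ^ (-(1 + D)) := by
          rw [Nat.add_sub_cancel_left]
          exact mul_le_mul_of_nonneg_left (hElam β hβ0 k (Nat.le_ceil _)) hβ0.le
      _ = β ^ (-D) := by
        rw [neg_add, Real.rpow_add hβ0, Real.rpow_neg_one, mul_inv_cancel_left₀ hβ0.ne']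

lemma exists_iterate_constants {lam c P κ D : ℝ} (h0 : 0 < lam) (h1 : lam < 1) (hc : 1 ≤ c)
    (hP : 0 ≤ P) (hκ : 0 < κ) (hD : 0 ≤ D) (n₀ M p₀ : ℕ) :
    ∃ C ≥ (2 : ℝ), ∃ C' > (0 : ℝ), ∀ β ≥ (2 : ℝ),
      lam ^ ⌈C' * Real.log β⌉₊ ≤ 1 / 4 ∧ ∃ q ≥ n₀, q + M + q ≤ ⌈C' * Real.log β⌉₊ ∧
        p₀ * (2 * √(2 * (c ^ (q + M + q) * β ^ (-C))) + P * β * lam ^ (q - n₀)) <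
          κ * β ^ (-D) := by
  obtain ⟨s, hs0, hs⟩ := exists_mul_rpow_neg_lt (a := p₀ * (4 + P)) (by positivity) hκ
  obtain ⟨C, hC, C', hC', hβ⟩ := exists_iterate_split h0 h1 hc (add_nonneg hD hs0) n₀ M
  refine ⟨C, hC, C', hC', fun β h2β => ?_⟩
  obtain ⟨h4, q, hq, hqn, hcq, hlamq⟩ := hβ β h2β
  refine ⟨h4, q, hq, hqn, ?_⟩
  have hβ0 : 0 < β := by linarith
  have : 0 < β ^ (-(D + s)) := by positivity
  have hsqrt : √(2 * (c ^ (q + M + q) * β ^ (-C))) ≤ 2 * β ^ (-(D + s)) := by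
    rw [Real.sqrt_le_left (by positivity)]
    linarith [mul_pow 2 (β ^ (-(D + s))) 2, sq_nonneg (β ^ (-(D + s)))]
  calc p₀ * (2 * √(2 * (c ^ (q + M + q) * β ^ (-C))) + P * β * lam ^ (q - n₀))
      ≤ p₀ * (2 * (2 * β ^ (-(D + s))) + P * β ^ (-(D + s))) := by
        rw [mul_assoc P]
        gcongr
    _ = p₀ * (4 + P) * β ^ (-s) * β ^ (-D) := by
        rw [neg_add, Real.rpow_add hβ0]
        ring
    _ < κ * β ^ (-D) := mul_lt_mul_of_pos_right (hs β h2β) (by positivity)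

end Exponents

/-! ### The unitary cocycle of a representation -/

section Twist

/-- The scalar operator `e^{it}`, as a unitary operator of `V`. -/
noncomputable def phase (V : Type*) [NormedAddCommGroup V] [InnerProductSpace ℂ V]
    [CompleteSpace V] (t : ℝ) : unitary (V →L[ℂ] V) :=
  ⟨Complex.exp (Complex.I * t) • (1 : V →L[ℂ] V), by
    have hunit : (starRingEnd ℂ) (Complex.exp (Complex.I * t)) * Complex.exp (Complex.I * t) =
        1 := by
      rw [← Complex.exp_conj, ← Complex.exp_add]; simp
    rw [Unitary.mem_iff]
    simp only [star_smul, star_one, smul_mul_smul_comm, mul_one, RCLike.star_def]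
    rw [hunit, mul_comm, hunit, one_smul]
    exact ⟨rfl, rfl⟩⟩

variable {V : Type*} [NormedAddCommGroup V] [InnerProductSpace ℂ V] [CompleteSpace V]

lemma coe_phase (t : ℝ) : (phase V t : V →L[ℂ] V) = Complex.exp (Complex.I * t) • 1 := rfl

lemma phase_add (s t : ℝ) : phase V (s + t) = phase V s * phase V t := by
  apply Subtype.ext
  rw [Submonoid.coe_mul, coe_phase, coe_phase, coe_phase, smul_mul_smul_comm, ← Complex.exp_add,
    mul_one, Complex.ofReal_add, mul_add]

@[simp] lemma phase_zero : phase V 0 = 1 := by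
  apply Subtype.ext
  simp [coe_phase]

lemma phase_inv (t : ℝ) : (phase V t)⁻¹ = phase V (-t) := by
  rw [inv_eq_iff_mul_eq_one, ← phase_add, add_neg_cancel, phase_zero]

lemma phase_comm (t : ℝ) (u : unitary (V →L[ℂ] V)) : phase V t * u = u * phase V t := by
  apply Subtype.ext
  rw [Submonoid.coe_mul, Submonoid.coe_mul, coe_phase, smul_mul_assoc, one_mul, mul_smul_comm,
    mul_one]

lemma phase_mul_mul_phase_mul (s t : ℝ) (u v : unitary (V →L[ℂ] V)) :
    phase V s * u * (phase V t * v) = phase V (s + t) * (u * v) := by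
  rw [phase_add, mul_assoc, mul_assoc, ← mul_assoc u, ← phase_comm, mul_assoc]

lemma phase_mul_inv (t : ℝ) (u : unitary (V →L[ℂ] V)) :
    (phase V t * u)⁻¹ = phase V (-t) * u⁻¹ := by
  rw [mul_inv_rev, phase_inv, phase_comm]

lemma continuous_phase : Continuous (phase V) := by
  refine Continuous.subtype_mk (f := fun t : ℝ =>
    Complex.exp (Complex.I * t) • (1 : V →L[ℂ] V)) ?_ _
  fun_prop

lemma dist_phase_le (s t : ℝ) : dist (phase V s) (phase V t) ≤ |s - t| := by
  have hfactor : (phase V s : V →L[ℂ] V) - phase V t =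
      (phase V t : V →L[ℂ] V) * ((Complex.exp (Complex.I * (s - t : ℝ)) - 1) • 1) := by
    rw [coe_phase, coe_phase, smul_mul_smul_comm, mul_sub, ← Complex.exp_add, ← sub_smul, mul_one,
      mul_one]
    congr 3
    push_cast
    ring_nf
  rw [Subtype.dist_eq, dist_eq_norm, hfactor, CStarRing.norm_coe_unitary_mul, norm_smul]
  refine (mul_le_of_le_one_right (norm_nonneg _) ContinuousLinearMap.norm_id_le).trans ?_
  exact Real.norm_exp_I_mul_ofReal_sub_one_le

variable {N : ℕ} {A : Matrix (Fin N) (Fin N) ℕ} {G : Type*} [Group G]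

/-- The function `e^{-ibr} ρ(Θ)` with values in the unitary group. Its cocycle is the one that
drives the iterates of `𝓛_{ib,ρ}`. -/
noncomputable def twistedUnitary (ρ : G →* unitary (V →L[ℂ] V)) (r : OneSided A → ℝ)
    (Θ : OneSided A → G) (b : ℝ) (y : OneSided A) : unitary (V →L[ℂ] V) :=
  phase V (-(b * r y)) * ρ (Θ y)

lemma cocycle_twistedUnitary (ρ : G →* unitary (V →L[ℂ] V)) (r : OneSided A → ℝ)
    (Θ : OneSided A → G) (b : ℝ) (n : ℕ) (y : OneSided A) :
    cocycle (twistedUnitary ρ r Θ b) n y = phase V (-(b * roofSum r n y)) * ρ (cocycle Θ n y) := by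
  induction n with
  | zero => simp [cocycle, roofSum]
  | succ n ih =>
    rw [cocycle, ih, cocycle, twistedUnitary, phase_mul_mul_phase_mul, map_mul]
    congr 2
    rw [roofSum, roofSum, birkhoffSum_succ]
    ring

lemma LipschitzBound.twistedUnitary {lam Kr KΘ : ℝ} {ρ : G →* unitary (V →L[ℂ] V)}
    {r : OneSided A → ℝ} {Θ : OneSided A → G} (hr : LipschitzBound lam Kr r)
    (hΘ : LipschitzBound lam KΘ fun y => ρ (Θ y)) (b : ℝ) :
    LipschitzBound lam (|b| * Kr + KΘ) (twistedUnitary ρ r Θ b) := fun x y => by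
  have hphase : dist (phase V (-(b * r x))) (phase V (-(b * r y))) ≤
      |b| * (Kr * OneSided.dist lam x y) := by
    refine (dist_phase_le _ _).trans ?_
    rw [show -(b * r x) - -(b * r y) = -(b * (r x - r y)) by ring, abs_neg, abs_mul]
    exact mul_le_mul_of_nonneg_left (hr x y) (abs_nonneg b)
  calc dist (phase V (-(b * r x)) * ρ (Θ x)) (phase V (-(b * r y)) * ρ (Θ y))
      ≤ dist (phase V (-(b * r x))) (phase V (-(b * r y))) + dist (ρ (Θ x)) (ρ (Θ y)) :=
        dist_mul_mul_le_dist_add_dist _ _ _ _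
    _ ≤ |b| * (Kr * OneSided.dist lam x y) + KΘ * OneSided.dist lam x y :=
        add_le_add hphase (hΘ x y)
    _ = (|b| * Kr + KΘ) * OneSided.dist lam x y := by ring

variable [TopologicalSpace G]

lemma IsLeg.twistedUnitary {ρ : G →* unitary (V →L[ℂ] V)} (hρ : Continuous ρ)
    {r : OneSided A → ℝ} {Θ : OneSided A → G} (b : ℝ) {n₀ : ℕ} {x y : TwoSided A} {t : ℝ} {g : G}
    (h : IsLeg r Θ n₀ x y t g) :
    IsLeg r (twistedUnitary ρ r Θ b) n₀ x y t (phase V (b * t) * ρ g) := by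
  have htwist {f : ℕ → ℝ} {u : ℕ → G} (hf : Tendsto f atTop (𝓝 t)) (hu : Tendsto u atTop (𝓝 g)) :
      Tendsto (fun n => phase V (b * f n) * ρ (u n)) atTop (𝓝 (phase V (b * t) * ρ g)) :=
    ((continuous_phase.tendsto _).comp (hf.const_mul b)).mul ((hρ.tendsto _).comp hu)
  refine h.imp (fun ⟨hxy, ht, hg⟩ => ⟨hxy, ht, (htwist ht hg).congr fun n => ?_⟩)
    (fun ⟨hxy, ht, hg⟩ => ⟨hxy, ht, (htwist ht hg).congr fun n => ?_⟩)
  all_goals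
    rw [cocycle_twistedUnitary, cocycle_twistedUnitary, phase_mul_inv, phase_mul_mul_phase_mul,
      map_mul, map_inv]
    ring_nf

lemma map_mem_chainTwists_twistedUnitary {ρ : G →* unitary (V →L[ℂ] V)} (hρ : Continuous ρ)
    {r : OneSided A → ℝ} {Θ : OneSided A → G} (b : ℝ) {w : TwoSided A} {n₀ p₀ : ℕ} {a : G}
    (ha : a ∈ chainTwists r Θ w n₀ p₀) :
    ρ a ∈ chainTwists r (twistedUnitary ρ r Θ b) w n₀ p₀ := by
  obtain ⟨p, chain, t, g, hp, hstart, hend, hlegs, ht, rfl⟩ := ha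
  refine ⟨p, chain, t, fun i => phase V (b * t i) * ρ (g i), hp, hstart, hend,
    fun i hi => (hlegs i hi).twistedUnitary hρ b, ht, ?_⟩
  have hprod : ∀ k, ((List.range k).reverse.map fun i => phase V (b * t i) * ρ (g i)).prod =
      phase V (b * ∑ i ∈ Finset.range k, t i) * ρ ((List.range k).reverse.map g).prod := by
    intro k
    induction k with
    | zero => simp
    | succ k ih =>
      rw [List.range_succ, List.reverse_append, List.reverse_singleton, List.singleton_append,
        List.map_cons, List.prod_cons, ih, List.map_cons, List.prod_cons, map_mul,
        Finset.sum_range_succ, phase_mul_mul_phase_mul]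
      ring_nf
  rw [hprod, ht, mul_zero, phase_zero, one_mul]

end Twist

namespace UnitaryIrrep

variable {G : Type*} [Group G] [TopologicalSpace G]

lemma continuous_op (π : UnitaryIrrep G) : Continuous π.op :=
  continuous_clm_apply.2 π.continuous_apply

lemma continuous_toHom (π : UnitaryIrrep G) : Continuous π.toHom :=
  Continuous.subtype_mk π.continuous_op fun g => (π.toHom g).2

lemma op_mul (π : UnitaryIrrep G) (g h : G) : π.op (g * h) = π.op g * π.op h := by
  unfold op
  rw [map_mul]
  rfl

lemma op_one (π : UnitaryIrrep G) : π.op 1 = 1 := by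
  unfold op
  rw [map_one]
  rfl

lemma transfer_eq_unitaryTransfer {N : ℕ} {A : Matrix (Fin N) (Fin N) ℕ} (π : UnitaryIrrep G)
    (φ r : OneSided A → ℝ) (Θ : OneSided A → G) (b : ℝ) :
    π.transfer φ r Θ (Complex.I * b) =
      unitaryTransfer (fun y => Real.exp (φ y)) (twistedUnitary π.toHom r Θ b) := by
  funext h x
  unfold transfer unitaryTransfer
  refine finsum_congr fun y => finsum_congr fun _ => ?_
  change _ = _ • Complex.exp (Complex.I * (-(b * r y) : ℝ)) • π.op (Θ y) (h y)
  rw [smul_smul, Complex.ofReal_exp, ← Complex.exp_add]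
  congr 2
  push_cast
  ring

end UnitaryIrrep

/-! ### Contraction in the scaled norm -/

section Norms

variable {N : ℕ} {A : Matrix (Fin N) (Fin N) ℕ} {V : Type*} [NormedAddCommGroup V] {lam : ℝ}
  {h : OneSided A → V}

lemma OneSided.eq_of_dist_eq_zero (h0 : 0 < lam) {x y : OneSided A}
    (h : OneSided.dist lam x y = 0) : x = y := by
  by_contra hne
  unfold OneSided.dist at h
  rw [if_neg hne] at h
  exact (pow_pos h0 _).ne' h

lemma LipschitzBound.memLip {L : ℝ} (hL : LipschitzBound lam L h) : MemLip lam h :=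
  ⟨L, fun x y => (dist_eq_norm (h x) (h y)).symm.trans_le (hL x y)⟩

lemma MemLip.exists_lipschitzBound (h0 : 0 ≤ lam) (hh : MemLip lam h) :
    ∃ L, 0 ≤ L ∧ LipschitzBound lam L h := by
  obtain ⟨L, hL⟩ := hh
  exact ⟨max L 0, le_max_right _ _, fun x y => (dist_eq_norm (h x) (h y)).trans_le <| (hL x y).trans
    (mul_le_mul_of_nonneg_right (le_max_left _ _) (OneSided.dist_nonneg h0 x y))⟩

lemma MemLip.norm_le_supNorm (h0 : 0 ≤ lam) (h1 : lam ≤ 1) (hh : MemLip lam h) (x : OneSided A) :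
    ‖h x‖ ≤ supNorm h := by
  obtain ⟨L, hL0, hL⟩ := hh.exists_lipschitzBound h0
  refine le_ciSup (f := fun x => ‖h x‖) ⟨‖h x‖ + L, ?_⟩ x
  rintro _ ⟨y, rfl⟩
  have hyx := (hL y x).trans (mul_le_of_le_one_right hL0 (OneSided.dist_le_one h0 h1 y x))
  rw [dist_eq_norm] at hyx
  exact (norm_le_norm_add_norm_sub' _ _).trans (add_le_add_right hyx _)

lemma MemLip.lipschitzBound_lipNorm (h0 : 0 < lam) (hh : MemLip lam h) :
    LipschitzBound lam (lipNorm lam h) h := fun x y => by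
  obtain ⟨L, hL0, hL⟩ := hh.exists_lipschitzBound h0.le
  rcases (OneSided.dist_nonneg h0.le x y).eq_or_lt with hd | hd
  · rw [OneSided.eq_of_dist_eq_zero h0 hd.symm, dist_self, OneSided.dist_self, mul_zero]
  · rw [← div_le_iff₀ hd, dist_eq_norm]
    refine le_ciSup (f := fun p : OneSided A × OneSided A =>
      ‖h p.1 - h p.2‖ / OneSided.dist lam p.1 p.2) ⟨L, ?_⟩ (x, y)
    rintro _ ⟨p, rfl⟩
    refine div_le_of_le_mul₀ (OneSided.dist_nonneg h0.le _ _) hL0 ?_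
    rw [← dist_eq_norm]
    exact hL _ _

lemma lipNorm_le (h0 : 0 ≤ lam) {L : ℝ} (hL0 : 0 ≤ L) (hL : LipschitzBound lam L h) :
    lipNorm lam h ≤ L :=
  Real.iSup_le (fun p => div_le_of_le_mul₀ (OneSided.dist_nonneg h0 _ _) hL0
    ((dist_eq_norm (h p.1) (h p.2)).symm.trans_le (hL _ _))) hL0

lemma MemLip.norm_le_scaledNorm (h0 : 0 ≤ lam) (h1 : lam ≤ 1) (hh : MemLip lam h) (K β : ℝ)
    (x : OneSided A) : ‖h x‖ ≤ scaledNorm lam K β h :=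
  (hh.norm_le_supNorm h0 h1 x).trans (le_max_left _ _)

lemma MemLip.lipschitzBound_scaledNorm (h0 : 0 < lam) (hh : MemLip lam h) {K β : ℝ}
    (hKβ : 0 < K * β) : LipschitzBound lam (K * β * scaledNorm lam K β h) h := fun x y => by
  refine (hh.lipschitzBound_lipNorm h0 x y).trans
    (mul_le_mul_of_nonneg_right ?_ (OneSided.dist_nonneg h0.le x y))
  rw [mul_comm, ← div_le_iff₀ hKβ]
  exact le_max_right _ _

lemma scaledNorm_le (h0 : 0 ≤ lam) {K β R : ℝ} (hKβ : 0 < K * β) (hR0 : 0 ≤ R)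
    (hR : ∀ x, ‖h x‖ ≤ R) (hL : LipschitzBound lam (K * β * R) h) : scaledNorm lam K β h ≤ R :=
  max_le (Real.iSup_le hR hR0)
    ((div_le_iff₀ hKβ).2 (by rw [mul_comm]; exact lipNorm_le h0 (by positivity) hL))

end Norms

section Contraction

variable {N : ℕ} {A : Matrix (Fin N) (Fin N) ℕ}
variable {V : Type*} [NormedAddCommGroup V] [InnerProductSpace ℂ V] [CompleteSpace V]
variable {U : OneSided A → unitary (V →L[ℂ] V)} {p : OneSided A → ℝ} {h : OneSided A → V}
variable {lam : ℝ}

lemma LipschitzBound.mono (h0 : 0 ≤ lam) {M : Type*} [PseudoMetricSpace M] {f : OneSided A → M}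
    {K L : ℝ} (hf : LipschitzBound lam K f) (hKL : K ≤ L) : LipschitzBound lam L f := fun x y =>
  (hf x y).trans (mul_le_mul_of_nonneg_right hKL (OneSided.dist_nonneg h0 x y))

lemma lipschitzBound_iterate_of_scaledNorm_le (h0 : 0 ≤ lam) (h1 : lam < 1)
    (hp : IsNormalizedWeight p) {Kp K β C R : ℝ} (hKp : 0 ≤ Kp) (hK : 0 ≤ K) (hβ : 1 ≤ β)
    (hC : 2 * ((N * Kp + K + 2) / (1 - lam)) ≤ C) (hR0 : 0 ≤ R)
    (hpL : LipschitzBound lam Kp p) (hU : LipschitzBound lam (K * β) U) (hR : ∀ x, ‖h x‖ ≤ R)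
    (hL : LipschitzBound lam (C * β * R) h) (n : ℕ) :
    LipschitzBound lam ((1 / 2 + lam ^ n) * (C * β * R)) ((unitaryTransfer p U)^[n] h) := by
  have : 0 < 1 - lam := sub_pos.2 h1
  have hC0 : 0 ≤ C := le_trans (by positivity) hC
  refine (lipschitzBound_iterate_unitaryTransfer h0 h1 hp hKp (by positivity) hR0 (by positivity)
    hpL hU hR hL n).mono h0 ?_
  have hcoeff : N * Kp + K * β + 2 ≤ (N * Kp + K + 2) * β := by
    linarith [mul_nonneg (show 0 ≤ N * Kp + 2 by positivity) (sub_nonneg.2 hβ)]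
  calc (N * Kp + K * β + 2) * R / (1 - lam) + lam ^ n * (C * β * R)
      ≤ (N * Kp + K + 2) * β * R / (1 - lam) + lam ^ n * (C * β * R) := by gcongr
    _ = (N * Kp + K + 2) / (1 - lam) * (β * R) + lam ^ n * (C * β * R) := by ring
    _ ≤ C / 2 * (β * R) + lam ^ n * (C * β * R) :=
        add_le_add_left (mul_le_mul_of_nonneg_right (by linarith) (by positivity)) _
    _ = (1 / 2 + lam ^ n) * (C * β * R) := by ring

lemma norm_iterate_unitaryTransfer_le_of_chainTwists (h0 : 0 ≤ lam) (h1 : lam < 1)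
    (hA01 : IsZeroOne A) {M : ℕ} (hM : ∀ i j, 0 < (A ^ M) i j) (hp : IsNormalizedWeight p)
    {c K L R ε κ : ℝ} (hc : ∀ y, 1 ≤ c * p y) (hK : 0 ≤ K) (hU : LipschitzBound lam K U)
    (hε : ε < 1) {r : OneSided A → ℝ} {w : TwoSided A} {n₀ q p₀ : ℕ} (hq : n₀ ≤ q)
    (hlt : p₀ * (2 * √(2 * (c ^ (q + M + q) * ε)) +
      (L + 3 * (K / (1 - lam))) * lam ^ (q - n₀)) < κ)
    (hmove : ∀ v : V, ∃ a ∈ chainTwists r U w n₀ p₀, ‖v‖ * κ ≤ ‖v - a • v‖)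
    (hR : ∀ x, ‖h x‖ ≤ R) (hL0 : 0 ≤ L) (hL : LipschitzBound lam (L * R) h) (x : OneSided A) :
    ‖(unitaryTransfer p U)^[q + M + q] h x‖ ≤ (1 - ε) * R := by
  rcases ((norm_nonneg _).trans (hR x)).eq_or_lt with rfl | hR0
  · simpa using norm_iterate_unitaryTransfer_le (U := U) hp hR (q + M + q) x
  by_contra! hlarge
  have hnorm : ‖((R⁻¹ : ℝ) : ℂ)‖ = R⁻¹ := Complex.norm_of_nonneg (inv_nonneg.2 hR0.le)
  set f : OneSided A → V := ((R⁻¹ : ℝ) : ℂ) • h with hf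
  have hfsup : ∀ y, ‖f y‖ ≤ 1 := fun y => by
    rw [hf, Pi.smul_apply, norm_smul, hnorm, inv_mul_le_iff₀ hR0, mul_one]
    exact hR y
  have hflip : LipschitzBound lam L f := fun y z => by
    rw [hf, Pi.smul_apply, Pi.smul_apply, dist_smul₀, hnorm, inv_mul_le_iff₀ hR0]
    exact (hL y z).trans_eq (by ring)
  have hflarge : 1 - ε ≤ ‖(unitaryTransfer p U)^[q + M + q] f x‖ := by
    rw [hf, iterate_unitaryTransfer_smul, Pi.smul_apply, norm_smul, hnorm, le_inv_mul_iff₀ hR0,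
      mul_comm]
    exact hlarge.le
  obtain ⟨v, hv, hfixed⟩ := exists_unit_almost_fixed_of_le_norm_iterate hA01 hM h0 h1 hp hc hK hU
    hfsup hL0 hflip hq hε hflarge r w p₀
  obtain ⟨a, ha, hav⟩ := hmove v
  rw [hv, one_mul] at hav
  exact absurd (hav.trans (hfixed a ha)) hlt.not_ge

lemma scaledNorm_iterate_unitaryTransfer_le (h0 : 0 < lam) (h1 : lam < 1)
    (hA01 : IsZeroOne A) {M : ℕ} (hM : ∀ i j, 0 < (A ^ M) i j) (hp : IsNormalizedWeight p)
    {c Kp K β C ε κ : ℝ} (hc : ∀ y, 1 ≤ c * p y) (hKp : 0 ≤ Kp) (hK : 0 ≤ K)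
    (hpL : LipschitzBound lam Kp p) (hU : LipschitzBound lam (K * β) U)
    (hβ : 1 ≤ β) (hC : 2 * ((N * Kp + K + 2) / (1 - lam)) ≤ C)
    (hε : ε ≤ 1 / 4) {r : OneSided A → ℝ} {w : TwoSided A} {n n₀ q p₀ : ℕ}
    (hn : lam ^ n ≤ 1 / 4) (hq : n₀ ≤ q) (hqn : q + M + q ≤ n)
    (hlt : p₀ * (2 * √(2 * (c ^ (q + M + q) * ε)) +
      (2 * C + 3 * (K / (1 - lam))) * β * lam ^ (q - n₀)) < κ)
    (hmove : ∀ v : V, ∃ a ∈ chainTwists r U w n₀ p₀, ‖v‖ * κ ≤ ‖v - a • v‖)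
    (hh : MemLip lam h) :
    MemLip lam ((unitaryTransfer p U)^[n] h) ∧
      scaledNorm lam C β ((unitaryTransfer p U)^[n] h) ≤ (1 - ε) * scaledNorm lam C β h := by
  have : 0 < 1 - lam := sub_pos.2 h1
  have hCβ : 0 < C * β := mul_pos (lt_of_lt_of_le (by positivity) hC) (by linarith)
  set R := scaledNorm lam C β h
  have hR : ∀ x, ‖h x‖ ≤ R := hh.norm_le_scaledNorm h0.le h1.le C β
  have hR0 : 0 ≤ R := (norm_nonneg _).trans (hR w.future)
  have hLY := lipschitzBound_iterate_of_scaledNorm_le h0.le h1 hp hKp hK hβ hC hR0 hpL hU hR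
    (hh.lipschitzBound_scaledNorm h0 hCβ)
  refine ⟨(hLY n).memLip, scaledNorm_le h0.le hCβ (mul_nonneg (by linarith) hR0) (fun x => ?_)
    ((hLY n).mono h0.le ?_)⟩
  · obtain ⟨k, rfl⟩ := Nat.exists_eq_add_of_le hqn
    rw [Function.iterate_add_apply]
    refine norm_iterate_unitaryTransfer_le_of_chainTwists (L := 2 * (C * β)) h0.le h1 hA01 hM hp hc
      (by positivity) hU (by linarith) hq (lt_of_eq_of_lt ?_ hlt) hmove
      (norm_iterate_unitaryTransfer_le hp hR k) (by positivity) ((hLY k).mono h0.le ?_) x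
    · ring
    · have hk : lam ^ k ≤ 1 := pow_le_one₀ h0.le h1.le
      rw [mul_assoc 2]
      exact mul_le_mul_of_nonneg_right (by linarith) (mul_nonneg hCβ.le hR0)
  · rw [mul_left_comm (C * β) (1 - ε)]
    exact mul_le_mul_of_nonneg_right (by linarith) (mul_nonneg hCβ.le hR0)

end Contraction

section Uniform

variable {N : ℕ} {A : Matrix (Fin N) (Fin N) ℕ} {lam : ℝ}

lemma IsNormalizedWeight.le_one {p : OneSided A → ℝ} (hp : IsNormalizedWeight p) (y : OneSided A) :
    p y ≤ 1 := by
  rw [← hp.2 y.shift]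
  have hsingle := Finset.single_le_sum (f := fun i => p (OneSided.cons i y.shift))
    (fun i _ => (hp.1 _).le) (OneSided.apply_zero_mem_letters_shift y)
  simpa only [OneSided.cons_shift] using hsingle

lemma IsNormalizedPotential.isNormalizedWeight {φ : OneSided A → ℝ}
    (hφ : IsNormalizedPotential φ) : IsNormalizedWeight fun y => Real.exp (φ y) :=
  ⟨fun y => Real.exp_pos _, fun x => by
    rw [← OneSided.finsum_preimages (fun y => Real.exp (φ y))]
    exact hφ x⟩

lemma abs_exp_sub_exp_le_of_nonpos {s t : ℝ} (hs : s ≤ 0) (ht : t ≤ 0) :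
    |Real.exp s - Real.exp t| ≤ |s - t| := by
  wlog hts : t ≤ s generalizing s t
  · rw [abs_sub_comm, abs_sub_comm s]
    exact this ht hs (le_of_not_ge hts)
  rw [abs_of_nonneg (sub_nonneg.2 (Real.exp_le_exp.2 hts)), abs_of_nonneg (sub_nonneg.2 hts)]
  calc Real.exp s - Real.exp t = Real.exp s * (1 - Real.exp (t - s)) := by
        rw [mul_sub, mul_one, ← Real.exp_add, add_sub_cancel]
    _ ≤ 1 * (s - t) := mul_le_mul (Real.exp_le_one_iff.2 hs)
        (by linarith [Real.add_one_le_exp (t - s)])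
        (sub_nonneg.2 (Real.exp_le_one_iff.2 (by linarith))) zero_le_one
    _ = s - t := one_mul _

lemma LipschitzBound.exp {φ : OneSided A → ℝ} {K : ℝ} (hφ : LipschitzBound lam K φ)
    (hφ0 : ∀ y, φ y ≤ 0) : LipschitzBound lam K fun y => Real.exp (φ y) := fun x y =>
  (abs_exp_sub_exp_le_of_nonpos (hφ0 x) (hφ0 y)).trans (hφ x y)

lemma LipschitzBound.exists_one_le_mul_exp (h0 : 0 ≤ lam) (h1 : lam ≤ 1) {φ : OneSided A → ℝ}
    {K : ℝ} (hK : 0 ≤ K) (hφ : LipschitzBound lam K φ) :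
    ∃ c : ℝ, ∀ y, 1 ≤ c * Real.exp (φ y) := by
  rcases isEmpty_or_nonempty (OneSided A) with _ | ⟨⟨x⟩⟩
  · exact ⟨0, isEmptyElim⟩
  refine ⟨Real.exp (K - φ x), fun y => ?_⟩
  rw [← Real.exp_add]
  have hxy := (hφ x y).trans (mul_le_of_le_one_right hK (OneSided.dist_le_one h0 h1 x y))
  rw [Real.dist_eq] at hxy
  exact Real.one_le_exp (by linarith [le_abs_self (φ x - φ y)])

lemma rpow_neg_le_quarter {β C : ℝ} (hβ : 2 ≤ β) (hC : 2 ≤ C) : β ^ (-C) ≤ 1 / 4 := by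
  calc β ^ (-C) ≤ 2 ^ (-C) := Real.rpow_le_rpow_of_nonpos two_pos hβ (by linarith)
    _ ≤ 2 ^ (-(2 : ℝ)) := Real.rpow_le_rpow_of_exponent_le one_le_two (by linarith)
    _ = 1 / 4 := by rw [Real.rpow_neg zero_le_two, Real.rpow_two]; norm_num

universe u

/-- The constants depend on the unitary operators `U` only through the Lipschitz constant `K * β`
and through the exponent and constant of the Diophantine bound. -/
theorem exists_scaledNorm_iterate_unitaryTransfer_le (h0 : 0 < lam) (h1 : lam < 1)
    (hA01 : IsZeroOne A) (hA : IsAperiodic A) {φ : OneSided A → ℝ} (hφ : MemLip lam φ)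
    (hφ1 : IsNormalizedPotential φ) (r : OneSided A → ℝ) (w : TwoSided A) (n₀ p₀ : ℕ)
    {K κ D : ℝ} (hK : 0 ≤ K) (hκ : 0 < κ) (hD : 0 ≤ D) :
    ∃ K₀ ≥ (1 : ℝ), ∀ C ≥ K₀, ∃ C' > (0 : ℝ), ∃ C'' > (0 : ℝ),
      ∀ (V : Type u) [NormedAddCommGroup V] [InnerProductSpace ℂ V] [CompleteSpace V]
        (U : OneSided A → unitary (V →L[ℂ] V)), ∀ β ≥ (2 : ℝ), LipschitzBound lam (K * β) U →
        (∀ v : V, ∃ a ∈ chainTwists r U w n₀ p₀, ‖v‖ * (κ * β ^ (-D)) ≤ ‖v - a • v‖) →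
        ∀ h : OneSided A → V, MemLip lam h →
          MemLip lam ((unitaryTransfer (fun y => Real.exp (φ y)) U)^[⌈C'' * Real.log β⌉₊] h) ∧
          scaledNorm lam C β
              ((unitaryTransfer (fun y => Real.exp (φ y)) U)^[⌈C'' * Real.log β⌉₊] h) ≤
            (1 - β ^ (-C')) * scaledNorm lam C β h := by
  obtain ⟨M, -, hM⟩ := hA
  obtain ⟨Kφ, hKφ, hφL⟩ := hφ.exists_lipschitzBound h0.le
  obtain ⟨c, hc⟩ := hφL.exists_one_le_mul_exp h0.le h1.le hKφ
  have hp := hφ1.isNormalizedWeight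
  have hφ0 : ∀ y, φ y ≤ 0 := fun y => Real.exp_le_one_iff.1 (hp.le_one y)
  have hc1 : 1 ≤ c := by
    have hpw := hp.1 w.future
    exact le_of_mul_le_mul_right (by linarith [hp.le_one w.future, hc w.future]) hpw
  refine ⟨max 1 (2 * ((N * Kφ + K + 2) / (1 - lam))), le_max_left _ _, fun C hC => ?_⟩
  have hC1 : 1 ≤ C := (le_max_left _ _).trans hC
  have : 0 < 1 - lam := sub_pos.2 h1
  obtain ⟨C', hC', C'', hC'', hconst⟩ := exists_iterate_constants h0 h1 hc1
    (P := 2 * C + 3 * (K / (1 - lam))) (by positivity) hκ hD n₀ M p₀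
  refine ⟨C', by linarith, C'', hC'', fun V _ _ _ U β hβ hU hmove h hh => ?_⟩
  obtain ⟨hn, q, hq, hqn, hlt⟩ := hconst β hβ
  exact scaledNorm_iterate_unitaryTransfer_le h0 h1 hA01 hM hp hc hKφ hK (hφL.exp hφ0) hU
    (by linarith) ((le_max_right _ _).trans hC) (rpow_neg_le_quarter hβ hC') hn hq hqn hlt hmove hh

end Uniform

section Frequency

variable {E : Type*} [NormedAddCommGroup E] [NormedSpace ℝ E]
  {G : Type*} [TopologicalSpace G] [ChartedSpace E G] [Group G]
  {B : LinearMap.BilinForm ℝ (GroupLieAlgebra 𝓘(ℝ, E) G)}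
  {𝔱 : Submodule ℝ (GroupLieAlgebra 𝓘(ℝ, E) G)} {ℓ : Module.Dual ℝ 𝔱} {c C : ℝ}

lemma weightNorm_nonneg (B : LinearMap.BilinForm ℝ (GroupLieAlgebra 𝓘(ℝ, E) G))
    (𝔱 : Submodule ℝ (GroupLieAlgebra 𝓘(ℝ, E) G)) (ℓ : Module.Dual ℝ 𝔱) :
    0 ≤ weightNorm B 𝔱 ℓ :=
  Real.sSup_nonneg fun _ ⟨_, _, hc⟩ => hc ▸ abs_nonneg _

lemma halfRootNumber_nonneg [FiniteDimensional ℝ E]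
    (𝔱 : Submodule ℝ (GroupLieAlgebra 𝓘(ℝ, E) G)) : 0 ≤ halfRootNumber 𝔱 := by
  have : FiniteDimensional ℝ (GroupLieAlgebra 𝓘(ℝ, E) G) := inferInstanceAs (FiniteDimensional ℝ E)
  have hrank : (Module.finrank ℝ 𝔱 : ℝ) ≤ Module.finrank ℝ (GroupLieAlgebra 𝓘(ℝ, E) G) :=
    Nat.cast_le.2 (Submodule.finrank_le 𝔱)
  exact div_nonneg (sub_nonneg.2 hrank) zero_le_two

lemma abs_le_frequency (hC : 0 ≤ C) (b : ℝ) : |b| ≤ frequency B 𝔱 C ℓ b :=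
  le_add_of_nonneg_right (mul_nonneg hC (Real.rpow_nonneg (weightNorm_nonneg B 𝔱 ℓ) _))

lemma mul_mul_weightNorm_le_frequency [FiniteDimensional ℝ E] (hc : 0 < c)
    (hcℓ : c ≤ weightNorm B 𝔱 ℓ) (hC : 0 ≤ C) (b : ℝ) :
    C * (c ^ (halfRootNumber 𝔱 / 2) * weightNorm B 𝔱 ℓ) ≤ frequency B 𝔱 C ℓ b := by
  refine (mul_le_mul_of_nonneg_left ?_ hC).trans (le_add_of_nonneg_left (abs_nonneg b))
  have hℓ : 0 < weightNorm B 𝔱 ℓ := hc.trans_le hcℓ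
  rw [add_comm, Real.rpow_add hℓ, Real.rpow_one]
  have := halfRootNumber_nonneg 𝔱
  gcongr

lemma mul_weightNorm_le_frequency [FiniteDimensional ℝ E] (hc : 0 < c)
    (hcℓ : c ≤ weightNorm B 𝔱 ℓ) (hC : 1 ≤ C) (b : ℝ) :
    c ^ (halfRootNumber 𝔱 / 2) * weightNorm B 𝔱 ℓ ≤ frequency B 𝔱 C ℓ b := by
  have hℓ : 0 < weightNorm B 𝔱 ℓ := hc.trans_le hcℓ
  exact (le_mul_of_one_le_left (by positivity) hC).trans
    (mul_mul_weightNorm_le_frequency hc hcℓ (zero_le_one.trans hC) b)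

lemma two_le_frequency [FiniteDimensional ℝ E] (hc : 0 < c) (hcℓ : c ≤ weightNorm B 𝔱 ℓ)
    (hC : 2 / (c ^ (halfRootNumber 𝔱 / 2) * c) ≤ C) (b : ℝ) : 2 ≤ frequency B 𝔱 C ℓ b := by
  have hC0 : 0 ≤ C := le_trans (by positivity) hC
  refine le_trans ?_ (mul_mul_weightNorm_le_frequency hc hcℓ hC0 b)
  rw [div_le_iff₀ (by positivity)] at hC
  exact hC.trans (by gcongr)

variable {N : ℕ} {A : Matrix (Fin N) (Fin N) ℕ}

lemma lipschitzBound_twistedUnitary_of_mul_weightNorm_le {lam Kr K κ β b : ℝ} (h0 : 0 ≤ lam)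
    (hKr : 0 ≤ Kr) (hK : 0 ≤ K) (hκ : 0 < κ) {π : UnitaryIrrep G} {r : OneSided A → ℝ}
    {Θ : OneSided A → G} (hr : LipschitzBound lam Kr r)
    (hΘ : LipschitzBound lam (K * weightNorm B 𝔱 ℓ) fun y => π.toHom (Θ y))
    (hb : |b| ≤ β) (hβ : κ * weightNorm B 𝔱 ℓ ≤ β) :
    LipschitzBound lam ((Kr + K / κ) * β) (twistedUnitary π.toHom r Θ b) := by
  refine (hr.twistedUnitary hΘ b).mono h0 ?_
  calc |b| * Kr + K * weightNorm B 𝔱 ℓ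
      = |b| * Kr + K / κ * (κ * weightNorm B 𝔱 ℓ) := by field_simp
    _ ≤ β * Kr + K / κ * β := by gcongr
    _ = (Kr + K / κ) * β := by ring

lemma exists_chainTwists_twistedUnitary_of_mul_weightNorm_le {κ β δ D : ℝ} (hκ : 0 < κ)
    (hδ : 0 < δ) (hD : 0 ≤ D) (hℓ : 0 < weightNorm B 𝔱 ℓ) (hβ : κ * weightNorm B 𝔱 ℓ ≤ β)
    {π : UnitaryIrrep G} {r : OneSided A → ℝ} {Θ : OneSided A → G} (b : ℝ) {w : TwoSided A}
    {n₀ p₀ : ℕ} {v : π.Space}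
    (hv : ∃ g ∈ chainTwists r Θ w n₀ p₀,
      ‖v‖ * (δ / weightNorm B 𝔱 ℓ ^ D) ≤ ‖v - π.op g v‖) :
    ∃ a ∈ chainTwists r (twistedUnitary π.toHom r Θ b) w n₀ p₀,
      ‖v‖ * (δ * κ ^ D * β ^ (-D)) ≤ ‖v - a • v‖ := by
  obtain ⟨g, hg, hgv⟩ := hv
  refine ⟨π.toHom g, map_mem_chainTwists_twistedUnitary π.continuous_toHom b hg,
    (mul_le_mul_of_nonneg_left ?_ (norm_nonneg v)).trans hgv⟩
  have hβ0 : 0 < β := lt_of_lt_of_le (by positivity) hβ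
  have hpow : κ ^ D * weightNorm B 𝔱 ℓ ^ D ≤ β ^ D := by
    rw [← Real.mul_rpow hκ.le hℓ.le]
    exact Real.rpow_le_rpow (by positivity) hβ hD
  rw [Real.rpow_neg hβ0.le, ← div_eq_mul_inv, div_le_div_iff₀ (by positivity) (by positivity),
    mul_assoc]
  exact mul_le_mul_of_nonneg_left hpow hδ.le

end Frequency

/-! ### The chart at the identity of a Lie group -/

section Calculus

variable {E₁ E₂ F : Type*} [NormedAddCommGroup E₁] [NormedSpace ℝ E₁] [NormedAddCommGroup E₂]
  [NormedSpace ℝ E₂] [NormedAddCommGroup F] [NormedSpace ℝ F]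

lemma hasFDerivAt_comp_prodMk_right {f : E₁ × E₂ → F} {u : E₁} {v : E₂}
    (hf : DifferentiableAt ℝ f (u, v)) :
    HasFDerivAt (fun w => f (u, w)) (fderiv ℝ f (u, v) ∘L ContinuousLinearMap.inr ℝ E₁ E₂) v :=
  hf.hasFDerivAt.comp v (hasFDerivAt_prodMk_right u v)

lemma hasFDerivAt_comp_prodMk_left {f : E₁ × E₂ → F} {u : E₁} {v : E₂}
    (hf : DifferentiableAt ℝ f (u, v)) :
    HasFDerivAt (fun w => f (w, v)) (fderiv ℝ f (u, v) ∘L ContinuousLinearMap.inl ℝ E₁ E₂) u :=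
  hf.hasFDerivAt.comp u (hasFDerivAt_prodMk_left u v)

lemma hasFDerivAt_fderiv_comp {f : E₁ → F} {s : E₂ → E₁} {s' : E₂ →L[ℝ] E₁} {x : E₂}
    (hf : ContDiffAt ℝ 2 f (s x)) (hs : HasFDerivAt s s' x) :
    HasFDerivAt (fun u => fderiv ℝ f (s u)) (fderiv ℝ (fderiv ℝ f) (s x) ∘L s') x :=
  ((hf.fderiv_right (m := 1) (by norm_num)).differentiableAt (by norm_num)).hasFDerivAt.comp x hs

lemma two_le_infty : (2 : WithTop ℕ∞) ≤ ∞ :=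
  WithTop.coe_le_coe.2 (le_top : (2 : ℕ∞) ≤ ⊤)

end Calculus

section IdChart

variable (E : Type*) [NormedAddCommGroup E] [NormedSpace ℝ E]
  (G : Type*) [TopologicalSpace G] [ChartedSpace E G] [Group G]

/-- The preferred chart at the identity. -/
noncomputable abbrev idChart : PartialEquiv G E := extChartAt 𝓘(ℝ, E) (1 : G)

/-- The coordinates of the identity. -/
noncomputable abbrev idPoint : E := idChart E G 1

/-- The multiplication in the chart at the identity. -/
noncomputable def chartMul (p : E × E) : E :=
  idChart E G ((idChart E G).symm p.1 * (idChart E G).symm p.2)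

/-- The conjugation `g h g⁻¹` in the chart at the identity. -/
noncomputable def chartConj (p : E × E) : E :=
  idChart E G ((idChart E G).symm p.1 * (idChart E G).symm p.2 * ((idChart E G).symm p.1)⁻¹)

/-- The second derivative of the multiplication at the identity. Its antisymmetric part is the
Lie bracket. -/
noncomputable def chartMulSnd : E × E →L[ℝ] E × E →L[ℝ] E :=
  fderiv ℝ (fderiv ℝ (chartMul E G)) (idPoint E G, idPoint E G)

/-- The adjoint action of a Lie group on its Lie algebra, in the chart at the identity. -/
noncomputable def lieAd (g : G) : E →L[ℝ] E :=
  fderiv ℝ (fun v => idChart E G (g * (idChart E G).symm v * g⁻¹)) (idPoint E G)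

variable {E G}

@[simp] lemma idChart_symm_idPoint : (idChart E G).symm (idPoint E G) = 1 :=
  extChartAt_to_inv 1

lemma idPoint_mem_target : idPoint E G ∈ (idChart E G).target := mem_extChartAt_target 1

lemma idChart_source_mem_nhds : (idChart E G).source ∈ 𝓝 (1 : G) :=
  extChartAt_source_mem_nhds 1

lemma idChart_target_mem_nhds : (idChart E G).target ∈ 𝓝 (idPoint E G) :=
  (isOpen_extChartAt_target (1 : G)).mem_nhds idPoint_mem_target

lemma mfderiv_one_eq_fderiv {F : Type*} [NormedAddCommGroup F] [NormedSpace ℝ F] {f : G → F}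
    (hf : MDifferentiableAt 𝓘(ℝ, E) 𝓘(ℝ, F) f 1) :
    (mfderiv 𝓘(ℝ, E) 𝓘(ℝ, F) f 1 : E →L[ℝ] F) =
      fderiv ℝ (fun u => f ((idChart E G).symm u)) (idPoint E G) := by
  rw [hf.mfderiv]
  simp only [modelWithCornersSelf_coe, Set.range_id, fderivWithin_univ]
  rfl

lemma eventually_nhds_idPoint_left {P : E × E → Prop}
    (h : ∀ᶠ p in 𝓝 (idPoint E G, idPoint E G), P p) :
    ∀ᶠ u in 𝓝 (idPoint E G), P (u, idPoint E G) :=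
  (Continuous.tendsto (f := fun u : E => (u, idPoint E G)) (by fun_prop) _).eventually h

lemma eventually_nhds_idPoint_right {P : E × E → Prop}
    (h : ∀ᶠ p in 𝓝 (idPoint E G, idPoint E G), P p) :
    ∀ᶠ u in 𝓝 (idPoint E G), P (idPoint E G, u) :=
  (Continuous.tendsto (f := fun u : E => (idPoint E G, u)) (by fun_prop) _).eventually h

lemma chartConj_idPoint_right (u : E) : chartConj E G (u, idPoint E G) = idPoint E G := by
  rw [chartConj, idChart_symm_idPoint, mul_one, mul_inv_cancel]

lemma lieAd_one : lieAd E G 1 = ContinuousLinearMap.id ℝ E := by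
  refine HasFDerivAt.fderiv ((hasFDerivAt_id (idPoint E G)).congr_of_eventuallyEq ?_)
  filter_upwards [idChart_target_mem_nhds (E := E) (G := G)] with u hu
  rw [one_mul, inv_one, mul_one]
  exact (idChart E G).right_inv hu

variable [LieGroup 𝓘(ℝ, E) ∞ G]

instance instLieGroupMinSmoothness : LieGroup 𝓘(ℝ, E) (minSmoothness ℝ 3) G :=
  LieGroup.of_le (n := ∞) (by
    rw [minSmoothness_of_isRCLikeNormedField]
    exact WithTop.coe_le_coe.2 (le_top : (3 : ℕ∞) ≤ ⊤))

lemma contMDiffAt_idChart {g : G} (hg : g ∈ (idChart E G).source) :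
    ContMDiffAt 𝓘(ℝ, E) 𝓘(ℝ, E) ∞ (idChart E G) g :=
  contMDiffAt_extChartAt' (by simpa using hg)

lemma contMDiffAt_idChart_symm {u : E} (hu : u ∈ (idChart E G).target) :
    ContMDiffAt 𝓘(ℝ, E) 𝓘(ℝ, E) ∞ (idChart E G).symm u :=
  (contMDiffOn_extChartAt_symm (1 : G)).contMDiffAt
    ((isOpen_extChartAt_target (1 : G)).mem_nhds hu)

lemma contDiffAt_idChart_comp {F : Type*} [NormedAddCommGroup F] [NormedSpace ℝ F] {f : F → G}
    {x : F} (hf : ContMDiffAt 𝓘(ℝ, F) 𝓘(ℝ, E) ∞ f x) (hx : f x = 1) :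
    ContDiffAt ℝ ∞ (fun y => idChart E G (f y)) x := by
  rw [← contMDiffAt_iff_contDiffAt]
  exact ContMDiffAt.comp x (g := idChart E G)
    (contMDiffAt_idChart (hx ▸ mem_extChartAt_source 1)) hf

lemma contMDiffAt_idChart_symm_fst :
    ContMDiffAt 𝓘(ℝ, E × E) 𝓘(ℝ, E) ∞ (fun p : E × E => (idChart E G).symm p.1)
      (idPoint E G, idPoint E G) :=
  ContMDiffAt.comp (idPoint E G, idPoint E G) (g := (idChart E G).symm)
    (contMDiffAt_idChart_symm idPoint_mem_target) contDiff_fst.contMDiff.contMDiffAt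

lemma contMDiffAt_idChart_symm_snd :
    ContMDiffAt 𝓘(ℝ, E × E) 𝓘(ℝ, E) ∞ (fun p : E × E => (idChart E G).symm p.2)
      (idPoint E G, idPoint E G) :=
  ContMDiffAt.comp (idPoint E G, idPoint E G) (g := (idChart E G).symm)
    (contMDiffAt_idChart_symm idPoint_mem_target) contDiff_snd.contMDiff.contMDiffAt

lemma contMDiffAt_mul_idChart_symm :
    ContMDiffAt 𝓘(ℝ, E × E) 𝓘(ℝ, E) ∞
      (fun p : E × E => (idChart E G).symm p.1 * (idChart E G).symm p.2)
      (idPoint E G, idPoint E G) :=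
  contMDiffAt_idChart_symm_fst.mul contMDiffAt_idChart_symm_snd

lemma contMDiffAt_conj_idChart_symm :
    ContMDiffAt 𝓘(ℝ, E × E) 𝓘(ℝ, E) ∞ (fun p : E × E =>
      (idChart E G).symm p.1 * (idChart E G).symm p.2 * ((idChart E G).symm p.1)⁻¹)
      (idPoint E G, idPoint E G) :=
  contMDiffAt_mul_idChart_symm.mul contMDiffAt_idChart_symm_fst.inv

lemma contDiffAt_chartMul : ContDiffAt ℝ ∞ (chartMul E G) (idPoint E G, idPoint E G) :=
  contDiffAt_idChart_comp contMDiffAt_mul_idChart_symm (by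
    rw [idChart_symm_idPoint, mul_one])

lemma contDiffAt_chartConj : ContDiffAt ℝ ∞ (chartConj E G) (idPoint E G, idPoint E G) :=
  contDiffAt_idChart_comp contMDiffAt_conj_idChart_symm (by
    rw [idChart_symm_idPoint, mul_one, mul_inv_cancel])

lemma eventually_differentiableAt_chartMul :
    ∀ᶠ p in 𝓝 (idPoint E G, idPoint E G), DifferentiableAt ℝ (chartMul E G) p :=
  ((contDiffAt_chartMul.of_le two_le_infty).eventually (by decide)).mono fun _ h =>
    h.differentiableAt (by norm_num)

lemma eventually_differentiableAt_chartConj :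
    ∀ᶠ p in 𝓝 (idPoint E G, idPoint E G), DifferentiableAt ℝ (chartConj E G) p :=
  ((contDiffAt_chartConj.of_le two_le_infty).eventually (by decide)).mono fun _ h =>
    h.differentiableAt (by norm_num)

lemma fderiv_chartMul_inr :
    fderiv ℝ (chartMul E G) (idPoint E G, idPoint E G) ∘L ContinuousLinearMap.inr ℝ E E =
      ContinuousLinearMap.id ℝ E := by
  refine (hasFDerivAt_comp_prodMk_right eventually_differentiableAt_chartMul.self_of_nhds).unique
    ((hasFDerivAt_id (idPoint E G)).congr_of_eventuallyEq ?_)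
  filter_upwards [idChart_target_mem_nhds (E := E) (G := G)] with u hu
  rw [chartMul, idChart_symm_idPoint, one_mul]
  exact (idChart E G).right_inv hu

lemma fderiv_chartMul_inl :
    fderiv ℝ (chartMul E G) (idPoint E G, idPoint E G) ∘L ContinuousLinearMap.inl ℝ E E =
      ContinuousLinearMap.id ℝ E := by
  refine (hasFDerivAt_comp_prodMk_left eventually_differentiableAt_chartMul.self_of_nhds).unique
    ((hasFDerivAt_id (idPoint E G)).congr_of_eventuallyEq ?_)
  filter_upwards [idChart_target_mem_nhds (E := E) (G := G)] with u hu
  rw [chartMul, idChart_symm_idPoint, mul_one]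
  exact (idChart E G).right_inv hu

lemma chartMulSnd_symm (p q : E × E) : chartMulSnd E G p q = chartMulSnd E G q p :=
  contDiffAt_chartMul.isSymmSndFDerivAt (by
    rw [minSmoothness_of_isRCLikeNormedField]; exact two_le_infty) p q

lemma hasFDerivAt_fderiv_chartMul_left (X : E) :
    HasFDerivAt (fun u => fderiv ℝ (chartMul E G) (u, idPoint E G) (0, X))
      ((chartMulSnd E G ∘L ContinuousLinearMap.inl ℝ E E).flip (0, X)) (idPoint E G) := by
  refine ((hasFDerivAt_fderiv_comp (s := fun u : E => (u, idPoint E G))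
    (contDiffAt_chartMul.of_le two_le_infty) (hasFDerivAt_prodMk_left _ _)).clm_apply
      (hasFDerivAt_const ((0 : E), X) (idPoint E G))).congr_fderiv ?_
  rw [ContinuousLinearMap.comp_zero, zero_add, chartMulSnd]

/-! ### The Lie bracket in the chart at the identity -/

lemma mfderiv_mul_left_idChart (X : GroupLieAlgebra 𝓘(ℝ, E) G) {u : E}
    (hu : u ∈ (idChart E G).target)
    (hdiff : DifferentiableAt ℝ (chartMul E G) (u, idPoint E G)) :
    (mfderiv 𝓘(ℝ, E) 𝓘(ℝ, E) (idChart E G) ((idChart E G).symm u)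
      (mulInvariantVectorField X ((idChart E G).symm u)) : E) =
      fderiv ℝ (chartMul E G) (u, idPoint E G) ((0 : E), (X : E)) := by
  set g := (idChart E G).symm u
  have hchart : ContMDiffAt 𝓘(ℝ, E) 𝓘(ℝ, E) ∞ (idChart E G) (g * 1) :=
    contMDiffAt_idChart (by rw [mul_one]; exact (idChart E G).map_target hu)
  have hcomp : MDifferentiableAt 𝓘(ℝ, E) 𝓘(ℝ, E) (fun h : G => idChart E G (g * h)) 1 :=
    (ContMDiffAt.comp (1 : G) (g := idChart E G) hchart contMDiffAt_mul_left).mdifferentiableAt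
      (by simp)
  have hchain := mfderiv_comp_apply (I := 𝓘(ℝ, E)) (I' := 𝓘(ℝ, E)) (I'' := 𝓘(ℝ, E)) (1 : G)
    (g := idChart E G) (f := fun h : G => g * h) (hchart.mdifferentiableAt (by simp))
    ((contMDiffAt_mul_left (n := ∞)).mdifferentiableAt (by simp)) X
  have hcoord : (mfderiv 𝓘(ℝ, E) 𝓘(ℝ, E) (fun h : G => idChart E G (g * h)) 1 : E →L[ℝ] E) X =
      fderiv ℝ (chartMul E G) (u, idPoint E G) ((0 : E), (X : E)) := by
    rw [mfderiv_one_eq_fderiv hcomp]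
    exact congrArg (fun L : E →L[ℝ] E => L X) (hasFDerivAt_comp_prodMk_right hdiff).fderiv
  rw [← hcoord]
  refine Eq.trans ?_ hchain.symm
  rw [mul_one]
  rfl

lemma eventually_mpullbackWithin_mulInvariantVectorField (X : GroupLieAlgebra 𝓘(ℝ, E) G) :
    ∀ᶠ u in 𝓝 (idPoint E G),
      (VectorField.mpullbackWithin 𝓘(ℝ, E) 𝓘(ℝ, E) (idChart E G).symm
        (mulInvariantVectorField X) (Set.range 𝓘(ℝ, E)) u : E) =
      fderiv ℝ (chartMul E G) (u, idPoint E G) ((0 : E), (X : E)) := by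
  filter_upwards [idChart_target_mem_nhds (E := E) (G := G),
    eventually_nhds_idPoint_left eventually_differentiableAt_chartMul] with u hu hdiff
  rw [VectorField.mpullbackWithin_apply, ContinuousLinearMap.inverse_eq
    (mfderivWithin_extChartAt_symm_comp_mfderiv_extChartAt (I := 𝓘(ℝ, E)) hu)
    (mfderiv_extChartAt_comp_mfderivWithin_extChartAt_symm (I := 𝓘(ℝ, E)) hu)]
  exact mfderiv_mul_left_idChart X hu hdiff

lemma bracket_eq_lieBracket (X Y : GroupLieAlgebra 𝓘(ℝ, E) G) :
    (⁅X, Y⁆ : GroupLieAlgebra 𝓘(ℝ, E) G) =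
      VectorField.lieBracket ℝ
        (fun u => fderiv ℝ (chartMul E G) (u, idPoint E G) ((0 : E), (X : E)))
        (fun u => fderiv ℝ (chartMul E G) (u, idPoint E G) ((0 : E), (Y : E))) (idPoint E G) := by
  have hid : (mfderiv 𝓘(ℝ, E) 𝓘(ℝ, E) (extChartAt 𝓘(ℝ, E) (1 : G)) 1).inverse =
      ContinuousLinearMap.id ℝ E := by
    rw [mfderiv_extChartAt_self]
    exact ContinuousLinearMap.inverse_id
  have huniv : (extChartAt 𝓘(ℝ, E) (1 : G)).symm ⁻¹' Set.univ ∩ Set.range 𝓘(ℝ, E) = Set.univ := by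
    simp
  rw [GroupLieAlgebra.bracket_def, ← VectorField.mlieBracketWithin_univ,
    VectorField.mlieBracketWithin_apply, huniv]
  refine (congrArg (fun L : E →L[ℝ] E => L _) hid).trans ?_
  exact (congrFun VectorField.lieBracketWithin_univ _).trans
    (Filter.EventuallyEq.lieBracket_vectorField_eq
      (eventually_mpullbackWithin_mulInvariantVectorField X)
      (eventually_mpullbackWithin_mulInvariantVectorField Y))

lemma bracket_eq_chartMulSnd (X Y : GroupLieAlgebra 𝓘(ℝ, E) G) :
    (⁅X, Y⁆ : GroupLieAlgebra 𝓘(ℝ, E) G) =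
      (chartMulSnd E G ((X : E), (0 : E)) ((0 : E), (Y : E)) -
        chartMulSnd E G ((Y : E), (0 : E)) ((0 : E), (X : E)) : E) := by
  refine (bracket_eq_lieBracket X Y).trans ?_
  have hval (Z : E) : fderiv ℝ (chartMul E G) (idPoint E G, idPoint E G) (0, Z) = Z :=
    congrArg (fun L : E →L[ℝ] E => L Z) fderiv_chartMul_inr
  have hder (Z W : E) : fderiv ℝ (fun u => fderiv ℝ (chartMul E G) (u, idPoint E G) (0, Z))
      (idPoint E G) (fderiv ℝ (chartMul E G) (idPoint E G, idPoint E G) (0, W)) =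
        chartMulSnd E G (W, 0) (0, Z) := by
    rw [hval, (hasFDerivAt_fderiv_chartMul_left Z).fderiv]
    rfl
  exact congrArg₂ (· - ·) (hder Y X) (hder X Y)

/-! ### The adjoint action -/

lemma contMDiffAt_conj_idChart_symm_right (g : G) :
    ContMDiffAt 𝓘(ℝ, E) 𝓘(ℝ, E) ∞ (fun v : E => g * (idChart E G).symm v * g⁻¹) (idPoint E G) :=
  (contMDiffAt_const.mul (contMDiffAt_idChart_symm idPoint_mem_target)).mul contMDiffAt_const

lemma hasFDerivAt_conj (g : G) :
    HasFDerivAt (fun v => idChart E G (g * (idChart E G).symm v * g⁻¹)) (lieAd E G g)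
      (idPoint E G) :=
  ((contDiffAt_idChart_comp (contMDiffAt_conj_idChart_symm_right g) (by
    rw [idChart_symm_idPoint, mul_one, mul_inv_cancel])).differentiableAt (by simp)).hasFDerivAt

lemma eventually_conj_mem_source (g : G) :
    ∀ᶠ v in 𝓝 (idPoint E G), g * (idChart E G).symm v * g⁻¹ ∈ (idChart E G).source := by
  refine (contMDiffAt_conj_idChart_symm_right g).continuousAt.eventually_mem ?_
  rw [idChart_symm_idPoint, mul_one, mul_inv_cancel]
  exact idChart_source_mem_nhds

lemma lieAd_mul (g h : G) : lieAd E G (g * h) = lieAd E G g ∘L lieAd E G h := by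
  refine HasFDerivAt.fderiv ?_
  have hfix : idChart E G (h * (idChart E G).symm (idPoint E G) * h⁻¹) = idPoint E G := by
    rw [idChart_symm_idPoint, mul_one, mul_inv_cancel]
  have hg := hasFDerivAt_conj (E := E) g
  rw [← hfix] at hg
  refine (hg.comp (idPoint E G) (hasFDerivAt_conj h)).congr_of_eventuallyEq ?_
  filter_upwards [eventually_conj_mem_source h] with v hv
  simp only [Function.comp]
  rw [(idChart E G).left_inv hv]
  congr 1
  group

lemma eventually_lieAd_idChart_symm :
    ∀ᶠ u in 𝓝 (idPoint E G), lieAd E G ((idChart E G).symm u) =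
      fderiv ℝ (chartConj E G) (u, idPoint E G) ∘L ContinuousLinearMap.inr ℝ E E := by
  filter_upwards [eventually_nhds_idPoint_left eventually_differentiableAt_chartConj] with u hu
  exact (hasFDerivAt_comp_prodMk_right hu).fderiv

lemma differentiableAt_lieAd_idChart_symm :
    DifferentiableAt ℝ (fun u => lieAd E G ((idChart E G).symm u)) (idPoint E G) :=
  (((hasFDerivAt_fderiv_comp (s := fun u : E => (u, idPoint E G))
    (contDiffAt_chartConj.of_le two_le_infty) (hasFDerivAt_prodMk_left _ _)).clm_comp
      (hasFDerivAt_const (ContinuousLinearMap.inr ℝ E E) (idPoint E G))).congr_of_eventuallyEq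
        eventually_lieAd_idChart_symm).differentiableAt

lemma continuousAt_lieAd_one : ContinuousAt (lieAd E G) 1 := by
  have hcomp : ContinuousAt (fun g : G => lieAd E G ((idChart E G).symm (idChart E G g))) 1 :=
    ContinuousAt.comp (g := fun u => lieAd E G ((idChart E G).symm u))
      differentiableAt_lieAd_idChart_symm.continuousAt (continuousAt_extChartAt (1 : G))
  refine hcomp.congr ?_
  filter_upwards [idChart_source_mem_nhds (E := E) (G := G)] with g hg
  rw [(idChart E G).left_inv hg]

lemma continuous_lieAd : Continuous (lieAd E G) := by
  have : IsTopologicalGroup G := topologicalGroup_of_lieGroup 𝓘(ℝ, E) ∞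
  rw [continuous_iff_continuousAt]
  intro g
  have htranslate : ContinuousAt (fun x => lieAd E G g ∘L lieAd E G (g⁻¹ * x)) g := by
    refine ContinuousAt.clm_comp continuousAt_const (ContinuousAt.comp (g := lieAd E G) ?_ ?_)
    · rw [inv_mul_cancel]
      exact continuousAt_lieAd_one
    · fun_prop
  refine htranslate.congr (Eventually.of_forall fun x => ?_)
  change lieAd E G g ∘L lieAd E G (g⁻¹ * x) = lieAd E G x
  rw [← lieAd_mul, mul_inv_cancel_left]

lemma eventually_chartMul_eq_chartMul_chartConj :
    ∀ᶠ p in 𝓝 (idPoint E G, idPoint E G),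
      chartMul E G p = chartMul E G (chartConj E G p, p.1) := by
  have hmem : ∀ᶠ p in 𝓝 (idPoint E G, idPoint E G), (idChart E G).symm p.1 *
      (idChart E G).symm p.2 * ((idChart E G).symm p.1)⁻¹ ∈ (idChart E G).source := by
    refine contMDiffAt_conj_idChart_symm.continuousAt.eventually_mem ?_
    simp only [idChart_symm_idPoint, mul_one, inv_one]
    exact idChart_source_mem_nhds
  filter_upwards [hmem] with p hp
  rw [chartMul, chartMul, chartConj, (idChart E G).left_inv hp, inv_mul_cancel_right]

lemma eventually_fderiv_chartMul_eq_lieAd (Y : E) :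
    ∀ᶠ u in 𝓝 (idPoint E G), fderiv ℝ (chartMul E G) (u, idPoint E G) (0, Y) =
      fderiv ℝ (chartMul E G) (idPoint E G, u) (lieAd E G ((idChart E G).symm u) Y, 0) := by
  filter_upwards [(eventually_chartMul_eq_chartMul_chartConj (E := E) (G := G)).curry_nhds,
    eventually_lieAd_idChart_symm (E := E) (G := G),
    eventually_nhds_idPoint_left (eventually_differentiableAt_chartMul (E := E) (G := G)),
    eventually_nhds_idPoint_right (eventually_differentiableAt_chartMul (E := E) (G := G)),
    eventually_nhds_idPoint_left (eventually_differentiableAt_chartConj (E := E) (G := G))]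
    with u hmul hAd hdiff_left hdiff_right hdiff_conj
  have hconj := hasFDerivAt_comp_prodMk_right hdiff_conj
  rw [← hAd] at hconj
  have hmul_left : HasFDerivAt (fun w => chartMul E G (w, u))
      (fderiv ℝ (chartMul E G) (idPoint E G, u) ∘L ContinuousLinearMap.inl ℝ E E)
      (chartConj E G (u, idPoint E G)) := by
    rw [chartConj_idPoint_right]
    exact hasFDerivAt_comp_prodMk_left hdiff_right
  have hchain := (HasFDerivAt.comp (g := fun w => chartMul E G (w, u)) (idPoint E G) hmul_left
    hconj).congr_of_eventuallyEq (f₁ := fun w => chartMul E G (u, w)) hmul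
  exact congrArg (fun L : E →L[ℝ] E => L Y)
    ((hasFDerivAt_comp_prodMk_right hdiff_left).unique hchain)

/-- Differentiate `u w = (u w u⁻¹) u` first in `w` and then in `u`, at the identity. -/
lemma fderiv_lieAd_apply_eq_chartMulSnd (X Y : E) :
    fderiv ℝ (fun u => lieAd E G ((idChart E G).symm u)) (idPoint E G) X Y =
      chartMulSnd E G (X, 0) (0, Y) - chartMulSnd E G (Y, 0) (0, X) := by
  have hAd := (differentiableAt_lieAd_idChart_symm (E := E) (G := G)).hasFDerivAt.clm_apply
    (hasFDerivAt_const (Y : E) (idPoint E G))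
  have hright := (hasFDerivAt_fderiv_comp (f := chartMul E G)
    (s := fun u : E => (idPoint E G, u)) (contDiffAt_chartMul.of_le two_le_infty)
    (hasFDerivAt_prodMk_right (idPoint E G) (idPoint E G))).clm_apply
      (hAd.prodMk (hasFDerivAt_const (0 : E) (idPoint E G)))
  have hderiv := congrArg (fun L : E →L[ℝ] E => L X)
    ((hasFDerivAt_fderiv_chartMul_left Y).unique
      (hright.congr_of_eventuallyEq (eventually_fderiv_chartMul_eq_lieAd Y)))
  have hval (Z : E) : fderiv ℝ (chartMul E G) (idPoint E G, idPoint E G) (Z, 0) = Z :=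
    congrArg (fun L : E →L[ℝ] E => L Z) fderiv_chartMul_inl
  simp only [idChart_symm_idPoint, lieAd_one, ContinuousLinearMap.comp_zero, zero_add,
    ContinuousLinearMap.flip_apply, ContinuousLinearMap.comp_apply, ContinuousLinearMap.inl_apply,
    ContinuousLinearMap.inr_apply, ContinuousLinearMap.id_apply, add_apply,
    ContinuousLinearMap.prod_apply, zero_apply, hval] at hderiv
  rw [chartMulSnd_symm (Y, 0), hderiv, chartMulSnd, add_sub_cancel_right]

theorem fderiv_lieAd_apply (X Y : GroupLieAlgebra 𝓘(ℝ, E) G) :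
    (fderiv ℝ (fun u => lieAd E G ((idChart E G).symm u)) (idPoint E G) (X : E) (Y : E) : E) =
      (⁅X, Y⁆ : GroupLieAlgebra 𝓘(ℝ, E) G) :=
  (fderiv_lieAd_apply_eq_chartMulSnd (E := E) (G := G) X Y).trans (bracket_eq_chartMulSnd X Y).symm

end IdChart

/-! ### Continuous homomorphisms into Banach algebras are differentiable -/

lemma isUnit_of_norm_sub_smul_one_lt {𝔸 : Type*} [NormedRing 𝔸] [NormedAlgebra ℝ 𝔸]
    [CompleteSpace 𝔸] {s : ℝ} {T : 𝔸} (hT : ‖T - s • (1 : 𝔸)‖ < s) : IsUnit T := by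
  have hs : 0 < s := (norm_nonneg _).trans_lt hT
  have hnear : ‖1 - s⁻¹ • T‖ < 1 := by
    have hscale : 1 - s⁻¹ • T = -(s⁻¹ • (T - s • (1 : 𝔸))) := by
      rw [smul_sub, smul_smul, inv_mul_cancel₀ hs.ne', one_smul, neg_sub]
    rw [hscale, norm_neg, norm_smul, norm_inv, Real.norm_of_nonneg hs.le, inv_mul_lt_one₀ hs]
    exact hT
  have hunit : IsUnit (s⁻¹ • T) := by
    simpa using (Units.oneSub (1 - s⁻¹ • T) hnear).isUnit
  exact (isUnit_smul_iff (Units.mk0 s⁻¹ (inv_ne_zero hs.ne')) T).1 hunit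

lemma continuous_integrable_of_compactSpace {X F : Type*} [TopologicalSpace X] [CompactSpace X]
    [MeasurableSpace X] [OpensMeasurableSpace X] [NormedAddCommGroup F]
    {μ : MeasureTheory.Measure X} [MeasureTheory.IsFiniteMeasureOnCompacts μ] {f : X → F}
    (hf : Continuous f) : MeasureTheory.Integrable f μ :=
  hf.integrable_of_hasCompactSupport (HasCompactSupport.of_compactSpace _)

lemma integral_comp_inv_mul_smul_eq_mul {G 𝔸 : Type*} [Group G] [MeasurableSpace G]
    [MeasurableMul G] {μ : MeasureTheory.Measure G} [μ.IsMulLeftInvariant] [NormedRing 𝔸]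
    [NormedAlgebra ℝ 𝔸] {f : G → ℝ} {ρ : G → 𝔸}
    (hint : MeasureTheory.Integrable (fun g => f g • ρ g) μ)
    (hmul : ∀ g h, ρ (g * h) = ρ g * ρ h) (h : G) :
    ∫ g, f (h⁻¹ * g) • ρ g ∂μ = ρ h * ∫ g, f g • ρ g ∂μ := by
  rw [← MeasureTheory.integral_mul_left_eq_self _ h,
    ← integral_const_mul_of_integrable hint]
  simp only [inv_mul_cancel_left, hmul, mul_smul_comm]

section Smoothness

variable {E : Type*} [NormedAddCommGroup E] [NormedSpace ℝ E]
  {G : Type*} [TopologicalSpace G] [ChartedSpace E G] [Group G] [LieGroup 𝓘(ℝ, E) ∞ G]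

lemma contMDiffAt_comp_inv_mul {f : G → ℝ} (hf : ContMDiff 𝓘(ℝ, E) 𝓘(ℝ, ℝ) ∞ f) {u : E}
    (hu : u ∈ (idChart E G).target) (g : G) :
    ContMDiffAt (𝓘(ℝ, E).prod 𝓘(ℝ, E)) 𝓘(ℝ, ℝ) ∞
      (fun p : G × E => f (((idChart E G).symm p.2)⁻¹ * p.1)) (g, u) := by
  have hsymm : ContMDiffAt (𝓘(ℝ, E).prod 𝓘(ℝ, E)) 𝓘(ℝ, E) ∞
      (fun p : G × E => (idChart E G).symm p.2) (g, u) :=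
    ContMDiffAt.comp (g, u) (g := (idChart E G).symm) (contMDiffAt_idChart_symm hu)
      contMDiffAt_snd
  exact ContMDiffAt.comp (g, u) (g := f) hf.contMDiffAt (hsymm.inv.mul contMDiffAt_fst)

lemma differentiableAt_comp_inv_mul {f : G → ℝ} (hf : ContMDiff 𝓘(ℝ, E) 𝓘(ℝ, ℝ) ∞ f) {u : E}
    (hu : u ∈ (idChart E G).target) (g : G) :
    DifferentiableAt ℝ (fun v => f (((idChart E G).symm v)⁻¹ * g)) u := by
  have hslice := ContMDiffAt.comp u
    (g := fun p : G × E => f (((idChart E G).symm p.2)⁻¹ * p.1)) (f := fun v : E => (g, v))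
    (contMDiffAt_comp_inv_mul hf hu g) (contMDiffAt_const.prodMk contMDiffAt_id)
  exact (contMDiffAt_iff_contDiffAt.1 hslice).differentiableAt (by simp)

lemma continuousAt_fderiv_comp_inv_mul {f : G → ℝ} (hf : ContMDiff 𝓘(ℝ, E) 𝓘(ℝ, ℝ) ∞ f) {u : E}
    (hu : u ∈ (idChart E G).target) (g : G) :
    ContinuousAt (fun p : G × E => fderiv ℝ (fun v => f (((idChart E G).symm v)⁻¹ * p.1)) p.2)
      (g, u) := by
  have hsmooth : ContMDiffAt ((𝓘(ℝ, E).prod 𝓘(ℝ, E)).prod 𝓘(ℝ, E)) 𝓘(ℝ, ℝ) ∞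
      (Function.uncurry fun (p : G × E) (v : E) => f (((idChart E G).symm v)⁻¹ * p.1))
      ((g, u), u) :=
    ContMDiffAt.comp ((g, u), u) (g := fun p : G × E => f (((idChart E G).symm p.2)⁻¹ * p.1))
      (f := fun q : (G × E) × E => (q.1.1, q.2)) (contMDiffAt_comp_inv_mul hf hu g)
      ((contMDiffAt_fst.comp _ contMDiffAt_fst).prodMk contMDiffAt_snd)
  have : IsManifold 𝓘(ℝ, E) 1 G := IsManifold.of_le (n := ∞) (by simp)
  have hcont := (ContMDiffAt.mfderiv (m := 0) (x₀ := (g, u)) _ (fun p : G × E => p.2) hsmooth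
    contMDiffAt_snd (by simp)).continuousAt
  simp only [mfderiv_eq_fderiv] at hcont
  exact inTangentCoordinates_model_space (I := 𝓘(ℝ, E)) (I' := 𝓘(ℝ, ℝ))
    (fun p : G × E => p.2) (fun p : G × E => f (((idChart E G).symm p.2)⁻¹ * p.1))
    (fun p : G × E => fderiv ℝ (fun v => f (((idChart E G).symm v)⁻¹ * p.1)) p.2) (g, u) ▸ hcont

variable [CompactSpace G] [MeasurableSpace G] [BorelSpace G]

variable [FiniteDimensional ℝ E] in
lemma differentiableAt_integral_comp_inv_mul {F : Type*} [NormedAddCommGroup F] [NormedSpace ℝ F]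
    (μ : MeasureTheory.Measure G) [MeasureTheory.IsFiniteMeasureOnCompacts μ] {f : G → ℝ}
    (hf : ContMDiff 𝓘(ℝ, E) 𝓘(ℝ, ℝ) ∞ f) {ρ : G → F} (hρ : Continuous ρ) :
    DifferentiableAt ℝ (fun u => ∫ g, f (((idChart E G).symm u)⁻¹ * g) • ρ g ∂μ)
      (idPoint E G) := by
  have : IsTopologicalGroup G := topologicalGroup_of_lieGroup 𝓘(ℝ, E) ∞
  obtain ⟨ε, hε, hball⟩ := Metric.nhds_basis_closedBall.mem_iff.1
    (idChart_target_mem_nhds (E := E) (G := G))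
  let D : G × E → E →L[ℝ] ℝ := fun p =>
    fderiv ℝ (fun v => f (((idChart E G).symm v)⁻¹ * p.1)) p.2
  obtain ⟨K, hK⟩ := ((isCompact_univ (X := G)).prod
    (isCompact_closedBall (idPoint E G) ε)).exists_bound_of_continuousOn (f := D) fun p hp =>
      (continuousAt_fderiv_comp_inv_mul hf (hball hp.2) p.1).continuousWithinAt
  have hcont (u : E) : Continuous fun g => f (((idChart E G).symm u)⁻¹ * g) • ρ g :=
    (hf.continuous.comp (continuous_const.mul continuous_id)).smul hρ
  have hD : Continuous fun g => D (g, idPoint E G) := continuous_iff_continuousAt.2 fun g =>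
    ContinuousAt.comp (g := D) (f := fun g => (g, idPoint E G))
      (continuousAt_fderiv_comp_inv_mul hf idPoint_mem_target g) (by fun_prop)
  have hD_smul : Continuous fun g => (D (g, idPoint E G)).smulRight (ρ g) :=
    ((ContinuousLinearMap.smulRightL ℝ E F).continuous.comp hD).clm_apply hρ
  exact (hasFDerivAt_integral_of_dominated_of_fderiv_le (μ := μ) (𝕜 := ℝ)
    (F' := fun u g => (D (g, u)).smulRight (ρ g)) (bound := fun g => K * ‖ρ g‖)
    (Metric.closedBall_mem_nhds _ hε)
    (Eventually.of_forall fun u =>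
      (continuous_integrable_of_compactSpace (hcont u)).aestronglyMeasurable)
    (continuous_integrable_of_compactSpace (hcont _))
    (continuous_integrable_of_compactSpace hD_smul).aestronglyMeasurable
    (Eventually.of_forall fun g u hu => by
      rw [ContinuousLinearMap.norm_smulRight_apply]
      exact mul_le_mul_of_nonneg_right (hK (g, u) ⟨trivial, hu⟩) (norm_nonneg _))
    (continuous_integrable_of_compactSpace (continuous_const.mul hρ.norm))
    (Eventually.of_forall fun g u hu =>
      (differentiableAt_comp_inv_mul hf (hball hu) g).hasFDerivAt.smul_const
        (ρ g))).differentiableAt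

variable [FiniteDimensional ℝ E] [T2Space G] {𝔸 : Type*} [NormedRing 𝔸] [NormedAlgebra ℝ 𝔸]
  [CompleteSpace 𝔸] {ρ : G → 𝔸}

lemma exists_contMDiff_isUnit_integral_smul (μ : MeasureTheory.Measure G) [μ.IsOpenPosMeasure]
    [MeasureTheory.IsFiniteMeasureOnCompacts μ] (hρ : Continuous ρ) (hρ1 : ρ 1 = 1) :
    ∃ f : G → ℝ, ContMDiff 𝓘(ℝ, E) 𝓘(ℝ, ℝ) ∞ f ∧ IsUnit (∫ g, f g • ρ g ∂μ) := by
  have hnear : {g : G | ‖ρ g - 1‖ < 1 / 2} ∈ 𝓝 (1 : G) := by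
    refine ContinuousAt.eventually_lt (hρ.sub continuous_const).norm.continuousAt
      continuousAt_const ?_
    simp [hρ1]
  obtain ⟨f, -, hsupp⟩ :=
    (SmoothBumpFunction.nhds_basis_support (I := 𝓘(ℝ, E)) hnear).mem_iff.1 hnear
  have hf : ContMDiff 𝓘(ℝ, E) 𝓘(ℝ, ℝ) ∞ f := f.contMDiff
  have hpos : 0 < ∫ g, f g ∂μ :=
    hf.continuous.integral_pos_of_hasCompactSupport_nonneg_nonzero (x := 1)
      (HasCompactSupport.of_compactSpace _) (fun g => f.nonneg) (by simp)
  refine ⟨f, hf, isUnit_of_norm_sub_smul_one_lt (s := ∫ g, f g ∂μ) (lt_of_le_of_lt ?_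
    (half_lt_self hpos))⟩
  rw [← integral_smul_const, ← MeasureTheory.integral_sub (f := fun g => f g • ρ g)
    (g := fun g => f g • (1 : 𝔸)) (continuous_integrable_of_compactSpace (hf.continuous.smul hρ))
    (continuous_integrable_of_compactSpace (hf.continuous.smul continuous_const)),
    div_eq_mul_one_div, ← MeasureTheory.integral_mul_const]
  refine MeasureTheory.norm_integral_le_of_norm_le
    (continuous_integrable_of_compactSpace (hf.continuous.mul continuous_const))
    (Eventually.of_forall fun g => ?_)
  rw [← smul_sub, norm_smul, Real.norm_of_nonneg f.nonneg]
  by_cases hg : f g = 0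
  · rw [hg, zero_mul, zero_mul]
  · exact mul_le_mul_of_nonneg_left (hsupp hg).le f.nonneg

end Smoothness

/-- Averaging against a smooth bump function `f` gives `∫ f(h⁻¹ g) ρ(g) = ρ(h) ∫ f ρ`, whose left
side is differentiable in `h` and whose last factor is invertible. -/
theorem differentiableAt_comp_idChart_symm_of_continuous {E : Type*} [NormedAddCommGroup E]
    [NormedSpace ℝ E] [FiniteDimensional ℝ E] {G : Type*} [TopologicalSpace G] [ChartedSpace E G]
    [Group G] [LieGroup 𝓘(ℝ, E) ∞ G] [CompactSpace G] [T2Space G] {𝔸 : Type*} [NormedRing 𝔸]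
    [NormedAlgebra ℝ 𝔸] [CompleteSpace 𝔸] {ρ : G → 𝔸} (hρ : Continuous ρ) (hρ1 : ρ 1 = 1)
    (hmul : ∀ g h, ρ (g * h) = ρ g * ρ h) :
    DifferentiableAt ℝ (fun u => ρ ((idChart E G).symm u)) (idPoint E G) := by
  have : IsTopologicalGroup G := topologicalGroup_of_lieGroup 𝓘(ℝ, E) ∞
  let _ : MeasurableSpace G := borel G
  have : BorelSpace G := ⟨rfl⟩
  obtain ⟨f, hf, hunit⟩ := exists_contMDiff_isUnit_integral_smul (E := E)
    (MeasureTheory.Measure.haar (G := G)) hρ hρ1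
  obtain ⟨S, hS⟩ := hunit.exists_right_inv
  have hconv (u : E) : ρ ((idChart E G).symm u) =
      (∫ g, f (((idChart E G).symm u)⁻¹ * g) • ρ g ∂MeasureTheory.Measure.haar) * S := by
    rw [integral_comp_inv_mul_smul_eq_mul
      (continuous_integrable_of_compactSpace (hf.continuous.smul hρ)) hmul, mul_assoc, hS, mul_one]
  simp only [hconv]
  exact (differentiableAt_integral_comp_inv_mul _ hf hρ).mul_const S

/-! ### The derived representation -/

section DerivedRep

variable {E : Type*} [NormedAddCommGroup E] [NormedSpace ℝ E]
  {G : Type*} [TopologicalSpace G] [ChartedSpace E G] [Group G]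

lemma hasDerivAt_idChart_comp {κ : ℝ → G} {t : ℝ} (ht : κ t = 1)
    (hκ : MDifferentiableAt 𝓘(ℝ, ℝ) 𝓘(ℝ, E) κ t) :
    HasDerivAt (fun s => idChart E G (κ s)) (mfderiv 𝓘(ℝ, ℝ) 𝓘(ℝ, E) κ t (1 : ℝ) : E) t := by
  have hchart : ∀ g : G, κ t = g → HasDerivAt (fun s => extChartAt 𝓘(ℝ, E) g (κ s))
      (mfderiv 𝓘(ℝ, ℝ) 𝓘(ℝ, E) κ t (1 : ℝ) : E) t := by
    rintro g rfl
    let velocity : ℝ →L[ℝ] E := mfderiv 𝓘(ℝ, ℝ) 𝓘(ℝ, E) κ t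
    have hwithin : HasFDerivWithinAt (fun s => extChartAt 𝓘(ℝ, E) (κ t) (κ s)) velocity
        (Set.range 𝓘(ℝ, ℝ)) t := hκ.hasMFDerivAt.2
    rw [modelWithCornersSelf_coe, Set.range_id, hasFDerivWithinAt_univ] at hwithin
    exact hwithin.hasDerivAt
  exact hchart 1 ht

namespace UnitaryIrrep

/-- The derived representation in the chart at the identity, as a map on the model space `E` of
the group. -/
noncomputable def derivCLM (E : Type*) [NormedAddCommGroup E] [NormedSpace ℝ E] {G : Type*}
    [TopologicalSpace G] [ChartedSpace E G] [Group G] (π : UnitaryIrrep G) :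
    E →L[ℝ] (π.Space →L[ℂ] π.Space) :=
  fderiv ℝ (fun u => π.op ((idChart E G).symm u)) (idPoint E G)

section Unitary

variable {H : Type*} [Group H] [TopologicalSpace H] (π : UnitaryIrrep H)

lemma inner_op_op (g : H) (v w : π.Space) : inner ℂ (π.op g v) (π.op g w) = inner ℂ v w :=
  ContinuousLinearMap.inner_map_map_of_mem_unitary (π.toHom g).2 v w

lemma norm_op_mul (g : H) (T : π.Space →L[ℂ] π.Space) : ‖π.op g * T‖ = ‖T‖ :=
  CStarRing.norm_coe_unitary_mul (π.toHom g) T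

end Unitary

variable [LieGroup 𝓘(ℝ, E) ∞ G] [FiniteDimensional ℝ E] [T2Space G] [CompactSpace G]
  (π : UnitaryIrrep G)

lemma hasFDerivAt_op_idChart_symm :
    HasFDerivAt (fun u => π.op ((idChart E G).symm u)) (π.derivCLM E) (idPoint E G) :=
  (differentiableAt_comp_idChart_symm_of_continuous π.continuous_op π.op_one
    π.op_mul).hasFDerivAt

lemma deriv_eq_derivCLM (X : GroupLieAlgebra 𝓘(ℝ, E) G) : π.deriv X = π.derivCLM E (X : E) := by
  have hdiff : MDifferentiableAt 𝓘(ℝ, E) 𝓘(ℝ, π.Space →L[ℂ] π.Space) π.op (1 : G) := by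
    refine mdifferentiableAt_iff _ _ |>.2 ⟨π.continuous_op.continuousAt, ?_⟩
    have hchart := (π.hasFDerivAt_op_idChart_symm (E := E)).differentiableAt
    rw [modelWithCornersSelf_coe, Set.range_id, differentiableWithinAt_univ]
    exact hchart
  exact congrArg (fun L : E →L[ℝ] (π.Space →L[ℂ] π.Space) => L X) (mfderiv_one_eq_fderiv hdiff)

lemma op_mul_derivCLM (g : G) (X : E) :
    π.op g * π.derivCLM E X = π.derivCLM E (lieAd E G g X) * π.op g := by
  have hop := π.hasFDerivAt_op_idChart_symm (E := E)
  have hop_conj := hop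
  rw [← show idChart E G (g * (idChart E G).symm (idPoint E G) * g⁻¹) = idPoint E G by
    rw [idChart_symm_idPoint, mul_one, mul_inv_cancel]] at hop_conj
  have hmul := (hop.const_mul (π.op g)).mul_const' (π.op g⁻¹)
  have hconj := (hop_conj.comp (idPoint E G) (hasFDerivAt_conj (E := E) g)).congr_of_eventuallyEq
    (f₁ := fun v => π.op g * π.op ((idChart E G).symm v) * π.op g⁻¹) (by
      filter_upwards [eventually_conj_mem_source (E := E) g] with v hv
      simp only [Function.comp]
      rw [(idChart E G).left_inv hv, π.op_mul, π.op_mul])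
  have hderiv : π.op g * π.derivCLM E X * π.op g⁻¹ = π.derivCLM E (lieAd E G g X) :=
    congrArg (fun L : E →L[ℝ] (π.Space →L[ℂ] π.Space) => L X) (hmul.unique hconj)
  rw [← hderiv, mul_assoc, ← π.op_mul, inv_mul_cancel, π.op_one, mul_one]

lemma derivCLM_fderiv_lieAd (X Y : E) :
    π.derivCLM E (fderiv ℝ (fun u => lieAd E G ((idChart E G).symm u)) (idPoint E G) X Y) =
      π.derivCLM E X * π.derivCLM E Y - π.derivCLM E Y * π.derivCLM E X := by
  have hop := π.hasFDerivAt_op_idChart_symm (E := E)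
  have hAd := (differentiableAt_lieAd_idChart_symm (E := E) (G := G)).hasFDerivAt.clm_apply
    (hasFDerivAt_const (Y : E) (idPoint E G))
  have hright := (((π.derivCLM E).hasFDerivAt.comp (idPoint E G) hAd).mul'
    hop).congr_of_eventuallyEq (f₁ := fun u => π.op ((idChart E G).symm u) * π.derivCLM E Y)
    (Eventually.of_forall fun u => π.op_mul_derivCLM _ Y)
  have hderiv := congrArg (fun L : E →L[ℝ] (π.Space →L[ℂ] π.Space) => L X)
    ((hop.mul_const' (π.derivCLM E Y)).unique hright)
  simp only [Function.comp_apply, idChart_symm_idPoint, lieAd_one, π.op_one,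
    ContinuousLinearMap.comp_zero, zero_add, add_apply, smul_apply,
    ContinuousLinearMap.comp_apply, ContinuousLinearMap.flip_apply,
    ContinuousLinearMap.id_apply, smul_eq_mul, op_smul_eq_mul, mul_one] at hderiv
  rw [hderiv, add_sub_cancel_left]

lemma derivCLM_bracket (X Y : GroupLieAlgebra 𝓘(ℝ, E) G) :
    π.derivCLM E (⁅X, Y⁆ : GroupLieAlgebra 𝓘(ℝ, E) G) =
      π.derivCLM E X * π.derivCLM E Y - π.derivCLM E Y * π.derivCLM E X := by
  rw [← fderiv_lieAd_apply X Y]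
  exact π.derivCLM_fderiv_lieAd (E := E) X Y

lemma inner_derivCLM_left (X : E) (v w : π.Space) :
    inner ℂ (π.derivCLM E X v) w = -inner ℂ v (π.derivCLM E X w) := by
  have hop_apply (v : π.Space) : HasFDerivAt (fun u => π.op ((idChart E G).symm u) v)
      (((ContinuousLinearMap.apply ℂ π.Space v).restrictScalars ℝ).comp (π.derivCLM E))
      (idPoint E G) :=
    ((ContinuousLinearMap.apply ℂ π.Space v).restrictScalars ℝ).hasFDerivAt.comp
      (idPoint E G) π.hasFDerivAt_op_idChart_symm
  have hconst : HasFDerivAt (fun u : E => inner ℂ (π.op ((idChart E G).symm u) v)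
      (π.op ((idChart E G).symm u) w)) (0 : E →L[ℝ] ℂ) (idPoint E G) := by
    simp only [π.inner_op_op]
    exact hasFDerivAt_const _ _
  have hderiv := congrArg (fun L : E →L[ℝ] ℂ => L X)
    (((hop_apply v).inner ℂ (hop_apply w)).unique hconst)
  rw [idChart_symm_idPoint, π.op_one] at hderiv
  have hsum : inner ℂ v (π.derivCLM E X w) + inner ℂ (π.derivCLM E X v) w = 0 := by
    simpa [fderivInnerCLM_apply] using hderiv
  exact eq_neg_of_add_eq_zero_right hsum

lemma hasDerivAt_op_comp {γ : ℝ → G} (hγ : ContMDiff 𝓘(ℝ, ℝ) 𝓘(ℝ, E) 1 γ) (t : ℝ) :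
    HasDerivAt (fun s => π.op (γ s))
      (π.op (γ t) * π.derivCLM E (leftVelocity (E := E) γ t : GroupLieAlgebra 𝓘(ℝ, E) G)) t := by
  have : IsTopologicalGroup G := topologicalGroup_of_lieGroup 𝓘(ℝ, E) ∞
  have : LieGroup 𝓘(ℝ, E) 1 G := LieGroup.of_le (n := ∞) (by simp)
  have hquot : ContMDiff 𝓘(ℝ, ℝ) 𝓘(ℝ, E) 1 fun s => (γ t)⁻¹ * γ s := contMDiff_const.mul hγ
  have hchart := hasDerivAt_idChart_comp (E := E) (inv_mul_cancel (γ t))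
    (hquot.mdifferentiable (by simp) t)
  have hop := π.hasFDerivAt_op_idChart_symm (E := E)
  rw [show idPoint E G = (fun s => idChart E G ((γ t)⁻¹ * γ s)) t by
    simp only [inv_mul_cancel]] at hop
  refine ((hop.comp_hasDerivAt t hchart).const_mul (π.op (γ t))).congr_of_eventuallyEq ?_
  have hmem : ∀ᶠ s in 𝓝 t, (γ t)⁻¹ * γ s ∈ (idChart E G).source :=
    hquot.continuous.continuousAt.eventually_mem (by
      rw [inv_mul_cancel]; exact idChart_source_mem_nhds)
  filter_upwards [hmem] with s hs
  simp only [Function.comp]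
  rw [(idChart E G).left_inv hs, ← π.op_mul, mul_inv_cancel_left]

lemma enorm_op_sub_le_lintegral {γ : ℝ → G} (hγ : ContMDiff 𝓘(ℝ, ℝ) 𝓘(ℝ, E) 1 γ) :
    ‖π.op (γ 1) - π.op (γ 0)‖ₑ ≤ ∫⁻ t in Set.Icc (0 : ℝ) 1,
      ‖π.derivCLM E (leftVelocity (E := E) γ t : GroupLieAlgebra 𝓘(ℝ, E) G)‖ₑ := by
  let velocity : ℝ → π.Space →L[ℂ] π.Space := fun t =>
    π.op (γ t) * π.derivCLM E (leftVelocity (E := E) γ t : GroupLieAlgebra 𝓘(ℝ, E) G)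
  have hderiv (t : ℝ) : HasDerivAt (fun s => π.op (γ s)) (velocity t) t :=
    π.hasDerivAt_op_comp hγ t
  have hnorm (t : ℝ) : ‖velocity t‖ₑ =
      ‖π.derivCLM E (leftVelocity (E := E) γ t : GroupLieAlgebra 𝓘(ℝ, E) G)‖ₑ := by
    rw [← ofReal_norm, ← ofReal_norm, π.norm_op_mul]
  simp only [← hnorm]
  by_cases htop : ∫⁻ t in Set.Icc (0 : ℝ) 1, ‖velocity t‖ₑ = ⊤
  · exact htop ▸ le_top
  have hmeas : MeasureTheory.AEStronglyMeasurable velocity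
      (MeasureTheory.volume.restrict (Set.Icc (0 : ℝ) 1)) := by
    rw [show velocity = _root_.deriv (fun s => π.op (γ s)) from
      funext fun t => (hderiv t).deriv.symm]
    exact aestronglyMeasurable_deriv _ _
  have hint : MeasureTheory.IntegrableOn velocity (Set.Icc (0 : ℝ) 1) :=
    ⟨hmeas, lt_top_iff_ne_top.2 htop⟩
  rw [← intervalIntegral.integral_eq_sub_of_hasDerivAt (a := 0) (b := 1) (fun t _ => hderiv t)
    ((intervalIntegrable_iff_integrableOn_Icc_of_le zero_le_one).2 hint),
    intervalIntegral.integral_of_le zero_le_one, ← MeasureTheory.integral_Icc_eq_integral_Ioc]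
  exact MeasureTheory.enorm_integral_le_lintegral_enorm _

variable {B : LinearMap.BilinForm ℝ (GroupLieAlgebra 𝓘(ℝ, E) G)} {M : ℝ}

lemma enorm_op_sub_le_mul_lieDist (hM0 : 0 < M)
    (hM : ∀ X : GroupLieAlgebra 𝓘(ℝ, E) G, ‖π.derivCLM E (X : E)‖ ≤ M * Real.sqrt (B X X))
    (g g' : G) : ‖π.op g - π.op g'‖ₑ ≤ ENNReal.ofReal M * lieDist B g g' := by
  unfold lieDist
  simp only [ENNReal.mul_iInf_of_ne (ENNReal.ofReal_pos.2 hM0).ne' ENNReal.ofReal_ne_top]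
  refine le_iInf fun γ => le_iInf fun hγ => le_iInf fun hγ0 => le_iInf fun hγ1 => ?_
  rw [← hγ0, ← hγ1, ← MeasureTheory.lintegral_const_mul' _ _ ENNReal.ofReal_ne_top, enorm_sub_rev]
  refine (π.enorm_op_sub_le_lintegral hγ).trans (MeasureTheory.lintegral_mono fun t => ?_)
  rw [← ENNReal.ofReal_mul hM0.le, ← ofReal_norm]
  exact ENNReal.ofReal_le_ofReal (hM _)

lemma norm_op_sub_le_of_lieDist_le (hM0 : 0 < M)
    (hM : ∀ X : GroupLieAlgebra 𝓘(ℝ, E) G, ‖π.derivCLM E (X : E)‖ ≤ M * Real.sqrt (B X X))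
    {g g' : G} {d : ℝ} (hd : 0 ≤ d) (hdist : lieDist B g g' ≤ ENNReal.ofReal d) :
    ‖π.op g - π.op g'‖ ≤ M * d := by
  have hle := (π.enorm_op_sub_le_mul_lieDist hM0 hM g g').trans (mul_le_mul_right hdist _)
  rw [← ENNReal.ofReal_mul hM0.le, ← ofReal_norm] at hle
  exact (ENNReal.ofReal_le_ofReal_iff (mul_nonneg hM0.le hd)).1 hle

end UnitaryIrrep

end DerivedRep

/-! ### Representations with a small derivative are trivial -/

section Subadditive

variable {G : Type*} [TopologicalSpace G] [Group G] [IsTopologicalGroup G] [ConnectedSpace G]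

lemma subgroup_closure_eq_top_of_mem_nhds_one {U : Set G} (hU : U ∈ 𝓝 (1 : G)) :
    Subgroup.closure U = ⊤ := by
  have hopen : IsOpen (Subgroup.closure U : Set G) :=
    (Subgroup.closure U).isOpen_of_mem_nhds (g := 1) (mem_of_superset hU Subgroup.subset_closure)
  exact SetLike.coe_injective
    (IsClopen.eq_univ ⟨(Subgroup.closure U).isClosed_of_isOpen hopen, hopen⟩ ⟨1, one_mem _⟩)

variable {ι : Type*} {f : ι → G → ℝ} {a : ι → ℝ}

lemma exists_forall_le_nat_mul_of_subadditive (hone : ∀ i, f i 1 ≤ 0)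
    (hmul : ∀ i g h, f i (g * h) ≤ f i g + f i h) (hinv : ∀ i g, f i g⁻¹ ≤ f i g)
    (hU : ∀ᶠ g in 𝓝 (1 : G), ∀ i, f i g ≤ a i) (g : G) : ∃ n : ℕ, ∀ i, f i g ≤ n * a i := by
  have hg : g ∈ Subgroup.closure {g | ∀ i, f i g ≤ a i} := by
    rw [subgroup_closure_eq_top_of_mem_nhds_one hU]
    trivial
  induction hg using Subgroup.closure_induction with
  | mem g hg => exact ⟨1, fun i => by simpa using hg i⟩
  | one => exact ⟨0, fun i => by simpa using hone i⟩
  | mul g h _ _ hg hh =>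
    obtain ⟨m, hm⟩ := hg
    obtain ⟨n, hn⟩ := hh
    exact ⟨m + n, fun i => by push_cast; linarith [hmul i g h, hm i, hn i]⟩
  | inv g _ hg =>
    obtain ⟨n, hn⟩ := hg
    exact ⟨n, fun i => (hinv i g).trans (hn i)⟩

lemma exists_le_nat_mul_of_subadditive [CompactSpace G] (ha : ∀ i, 0 ≤ a i)
    (hone : ∀ i, f i 1 ≤ 0) (hmul : ∀ i g h, f i (g * h) ≤ f i g + f i h)
    (hinv : ∀ i g, f i g⁻¹ ≤ f i g) (hU : ∀ᶠ g in 𝓝 (1 : G), ∀ i, f i g ≤ a i) :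
    ∃ n : ℕ, ∀ g i, f i g ≤ n * a i := by
  choose n hn using exists_forall_le_nat_mul_of_subadditive hone hmul hinv hU
  have hnhds (g : G) : ∀ᶠ x in 𝓝 g, ∀ i, f i (g⁻¹ * x) ≤ a i :=
    (Continuous.tendsto' (by fun_prop) g 1 (inv_mul_cancel g)).eventually hU
  obtain ⟨t, -, hcover⟩ := isCompact_univ.elim_nhds_subcover
    (fun g => {x | ∀ i, f i (g⁻¹ * x) ≤ a i}) fun g _ => hnhds g
  refine ⟨t.sup n + 1, fun x i => ?_⟩
  obtain ⟨g, hg, hgx⟩ := Set.mem_iUnion₂.1 (hcover (Set.mem_univ x))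
  calc f i x ≤ f i g + f i (g⁻¹ * x) := by simpa using hmul i g (g⁻¹ * x)
    _ ≤ n g * a i + a i := add_le_add (hn g i) (hgx i)
    _ ≤ (t.sup n + 1 : ℕ) * a i := by
      have hle : (n g : ℝ) ≤ (t.sup n : ℕ) := Nat.cast_le.2 (Finset.le_sup hg)
      push_cast
      nlinarith [ha i]

end Subadditive

namespace UnitaryIrrep

variable {G : Type*} [TopologicalSpace G] [Group G] {π : UnitaryIrrep G}

lemma two_mul_norm_op_sub_one_le (π : UnitaryIrrep G) (g : G) :
    2 * ‖π.op g - 1‖ ≤ ‖π.op (g * g) - 1‖ + ‖π.op g - 1‖ ^ 2 := by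
  have hsq : (2 : ℝ) • (π.op g - 1) =
      (π.op (g * g) - 1) - (π.op g - 1) * (π.op g - 1) := by
    rw [π.op_mul, two_smul ℝ (π.op g - 1), mul_sub, sub_mul, one_mul, mul_one]
    abel
  calc 2 * ‖π.op g - 1‖ = ‖(2 : ℝ) • (π.op g - 1)‖ := by
        rw [norm_smul, Real.norm_of_nonneg zero_le_two]
    _ ≤ ‖π.op (g * g) - 1‖ + ‖π.op g - 1‖ ^ 2 := by
      rw [hsq, sq]
      exact (norm_sub_le _ _).trans (add_le_add_right (norm_mul_le _ _) _)

/-- If `‖π g - 1‖ ≤ 1 / 2` for all `g`, then squaring improves the bound by a factor `2 / 3`. -/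
lemma exists_half_lt_norm_op_sub_one (hπ : π.Nontrivial) : ∃ g, 1 / 2 < ‖π.op g - 1‖ := by
  by_contra! hall
  have hbdd : BddAbove (Set.range fun g => ‖π.op g - 1‖) := ⟨1 / 2, Set.forall_mem_range.2 hall⟩
  have hle (g : G) : ‖π.op g - 1‖ ≤ 2 / 3 * ⨆ g, ‖π.op g - 1‖ := by
    nlinarith [norm_nonneg (π.op g - 1), hall g, π.two_mul_norm_op_sub_one_le g,
      le_ciSup hbdd (g * g)]
  obtain ⟨g, hg⟩ := hπ
  have hpos : 0 < ‖π.op g - 1‖ := norm_pos_iff.2 (sub_ne_zero.2 hg)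
  linarith [hle g, ciSup_le hle]

lemma norm_op_mul_sub_one_le (π : UnitaryIrrep G) (g h : G) :
    ‖π.op (g * h) - 1‖ ≤ ‖π.op g - 1‖ + ‖π.op h - 1‖ := by
  have hsplit : π.op (g * h) - 1 = (π.op g - 1) + π.op g * (π.op h - 1) := by
    rw [π.op_mul, mul_sub, mul_one]
    abel
  rw [hsplit, ← π.norm_op_mul g (π.op h - 1)]
  exact norm_add_le _ _

lemma norm_op_inv_sub_one (π : UnitaryIrrep G) (g : G) : ‖π.op g⁻¹ - 1‖ = ‖π.op g - 1‖ := by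
  rw [← π.norm_op_mul g, mul_sub, mul_one, ← π.op_mul, mul_inv_cancel, π.op_one, norm_sub_rev]

end UnitaryIrrep

section SmallDerivative

variable {E : Type*} [NormedAddCommGroup E] [NormedSpace ℝ E]
  {G : Type*} [TopologicalSpace G] [ChartedSpace E G] [Group G]

/-- The left division `g⁻¹ h` in the chart at the identity. -/
noncomputable def chartDiv (E G : Type*) [NormedAddCommGroup E] [NormedSpace ℝ E]
    [TopologicalSpace G] [ChartedSpace E G] [Group G] (p : E × E) : E :=
  idChart E G (((idChart E G).symm p.1)⁻¹ * (idChart E G).symm p.2)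

lemma chartDiv_self (u : E) : chartDiv E G (u, u) = idPoint E G := by
  rw [chartDiv, inv_mul_cancel]

variable [LieGroup 𝓘(ℝ, E) ∞ G]

lemma contMDiffAt_div_idChart_symm : ContMDiffAt 𝓘(ℝ, E × E) 𝓘(ℝ, E) ∞
    (fun p : E × E => ((idChart E G).symm p.1)⁻¹ * (idChart E G).symm p.2)
    (idPoint E G, idPoint E G) :=
  contMDiffAt_idChart_symm_fst.inv.mul contMDiffAt_idChart_symm_snd

lemma contDiffAt_chartDiv : ContDiffAt ℝ ∞ (chartDiv E G) (idPoint E G, idPoint E G) :=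
  contDiffAt_idChart_comp contMDiffAt_div_idChart_symm (inv_mul_cancel _)

lemma eventually_differentiableAt_chartDiv :
    ∀ᶠ p in 𝓝 (idPoint E G, idPoint E G), DifferentiableAt ℝ (chartDiv E G) p :=
  ((contDiffAt_chartDiv.of_le two_le_infty).eventually (by decide)).mono fun _ h =>
    h.differentiableAt (by norm_num)

lemma eventually_div_mem_source : ∀ᶠ p in 𝓝 (idPoint E G, idPoint E G),
    ((idChart E G).symm p.1)⁻¹ * (idChart E G).symm p.2 ∈ (idChart E G).source :=
  contMDiffAt_div_idChart_symm.continuousAt.eventually_mem (by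
    simpa only [inv_mul_cancel] using idChart_source_mem_nhds)

/-- The derivative at `u` of `v ↦ u⁻¹ v` in the chart at the identity. It carries the derivative of
a representation at `u` to the derived representation. -/
noncomputable def chartDivDeriv (E G : Type*) [NormedAddCommGroup E] [NormedSpace ℝ E]
    [TopologicalSpace G] [ChartedSpace E G] [Group G] (u : E) : E →L[ℝ] E :=
  fderiv ℝ (chartDiv E G) (u, u) ∘L ContinuousLinearMap.inr ℝ E E

lemma continuousAt_chartDivDeriv : ContinuousAt (chartDivDeriv E G) (idPoint E G) := by
  have hfderiv : ContinuousAt (fderiv ℝ (chartDiv E G)) (idPoint E G, idPoint E G) :=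
    ((contDiffAt_chartDiv.of_le two_le_infty).fderiv_right (m := 1) (by norm_num)).continuousAt
  have hdiag : ContinuousAt (fun u : E => (u, u)) (idPoint E G) := by fun_prop
  exact (ContinuousAt.comp (g := fderiv ℝ (chartDiv E G)) (f := fun u : E => (u, u))
    hfderiv hdiag).clm_comp continuousAt_const

variable [FiniteDimensional ℝ E] [T2Space G] [CompactSpace G]

lemma UnitaryIrrep.eventually_hasFDerivAt_op : ∀ᶠ u in 𝓝 (idPoint E G), ∀ π : UnitaryIrrep G,
    HasFDerivAt (fun v => π.op ((idChart E G).symm v))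
      (π.op ((idChart E G).symm u) • (π.derivCLM E ∘L chartDivDeriv E G u)) u := by
  have hdiag : Tendsto (fun u : E => (u, u)) (𝓝 (idPoint E G)) (𝓝 (idPoint E G, idPoint E G)) :=
    Continuous.tendsto (f := fun u : E => (u, u)) (by fun_prop) _
  filter_upwards [hdiag.eventually eventually_differentiableAt_chartDiv,
    hdiag.eventually (eventually_div_mem_source (E := E) (G := G)).eventually_nhds]
    with u hdiff hsource π
  have hop := π.hasFDerivAt_op_idChart_symm (E := E)
  rw [← chartDiv_self u] at hop
  refine ((HasFDerivAt.comp (f := fun w => chartDiv E G (u, w)) u hop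
    (hasFDerivAt_comp_prodMk_right hdiff)).const_mul
      (π.op ((idChart E G).symm u))).congr_of_eventuallyEq ?_
  have hmem := (Continuous.tendsto (f := fun w : E => (u, w)) (by fun_prop) u).eventually hsource
  filter_upwards [hmem] with w hw
  simp only [Function.comp, chartDiv]
  rw [(idChart E G).left_inv hw, ← π.op_mul, mul_inv_cancel_left]

lemma exists_eventually_norm_op_sub_one_le : ∃ K > (0 : ℝ), ∀ᶠ g in 𝓝 (1 : G),
    ∀ π : UnitaryIrrep G, ‖π.op g - 1‖ ≤ K * ‖π.derivCLM E‖ := by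
  set L : ℝ := ‖chartDivDeriv E G (idPoint E G)‖ + 1
  have : 0 < L := by positivity
  obtain ⟨ε, hε, hball⟩ := Metric.eventually_nhds_iff_ball.1
    ((continuousAt_chartDivDeriv.norm.eventually_le_const (lt_add_one _)).and
      (UnitaryIrrep.eventually_hasFDerivAt_op (E := E) (G := G)))
  have hball_nhds : ∀ᶠ g in 𝓝 (1 : G), idChart E G g ∈ Metric.ball (idPoint E G) ε :=
    (continuousAt_extChartAt (I := 𝓘(ℝ, E)) (1 : G)).eventually_mem (Metric.ball_mem_nhds _ hε)
  refine ⟨L * ε, by positivity, ?_⟩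
  filter_upwards [hball_nhds, idChart_source_mem_nhds (E := E) (G := G)] with g hg hgs π
  have hbound : ∀ u ∈ Metric.ball (idPoint E G) ε,
      ‖π.op ((idChart E G).symm u) • (π.derivCLM E ∘L chartDivDeriv E G u)‖ ≤
        ‖π.derivCLM E‖ * L := fun u hu =>
    ContinuousLinearMap.opNorm_le_bound _ (by positivity) fun X => by
      rw [mul_assoc]
      exact (π.norm_op_mul _ _).trans_le ((π.derivCLM E).le_opNorm_of_le
        ((chartDivDeriv E G u).le_of_opNorm_le (hball u hu).1 X))
  have hmvt := (convex_ball (idPoint E G) ε).norm_image_sub_le_of_norm_hasFDerivWithin_le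
    (fun u hu => ((hball u hu).2 π).hasFDerivWithinAt) hbound (Metric.mem_ball_self hε) hg
  simp only [(idChart E G).left_inv hgs, idChart_symm_idPoint, π.op_one] at hmvt
  calc ‖π.op g - 1‖ ≤ ‖π.derivCLM E‖ * L * ‖idChart E G g - idPoint E G‖ := hmvt
    _ ≤ ‖π.derivCLM E‖ * L * ε := by gcongr; exact (mem_ball_iff_norm.1 hg).le
    _ = L * ε * ‖π.derivCLM E‖ := by ring

variable [ConnectedSpace G]

lemma exists_norm_op_sub_one_le : ∃ K > (0 : ℝ), ∀ (g : G) (π : UnitaryIrrep G),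
    ‖π.op g - 1‖ ≤ K * ‖π.derivCLM E‖ := by
  have : IsTopologicalGroup G := topologicalGroup_of_lieGroup 𝓘(ℝ, E) ∞
  obtain ⟨K, hK, hU⟩ := exists_eventually_norm_op_sub_one_le (E := E) (G := G)
  obtain ⟨n, hn⟩ := exists_le_nat_mul_of_subadditive
    (f := fun (π : UnitaryIrrep G) g => ‖π.op g - 1‖) (fun π => by positivity)
    (fun π => by rw [π.op_one, sub_self, norm_zero]) (fun π => π.norm_op_mul_sub_one_le)
    (fun π g => (π.norm_op_inv_sub_one g).le) hU
  refine ⟨(n + 1) * K, by positivity, fun g π => (hn g π).trans ?_⟩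
  rw [mul_assoc]
  gcongr
  linarith

theorem exists_le_norm_derivCLM : ∃ c > (0 : ℝ), ∀ π : UnitaryIrrep G,
    π.Nontrivial → c ≤ ‖π.derivCLM E‖ := by
  obtain ⟨K, hK, hle⟩ := exists_norm_op_sub_one_le (E := E) (G := G)
  refine ⟨1 / 2 / K, by positivity, fun π hπ => ?_⟩
  obtain ⟨g, hg⟩ := UnitaryIrrep.exists_half_lt_norm_op_sub_one hπ
  rw [div_le_iff₀' hK]
  exact hg.le.trans (hle g π)

end SmallDerivative

/-! ### Positive definite forms -/

section PositiveDefinite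

variable {V : Type*} [AddCommGroup V] [Module ℝ V]

/-- Positive definite symmetric forms on a vector space without a chosen topology; on the Lie
algebra of a Lie group this is `IsInnerProduct`. -/
def IsPosDefForm (b : LinearMap.BilinForm ℝ V) : Prop :=
  (∀ X Y, b X Y = b Y X) ∧ ∀ X, X ≠ 0 → 0 < b X X

variable {b : LinearMap.BilinForm ℝ V}

lemma IsPosDefForm.nonneg (hb : IsPosDefForm b) (X : V) : 0 ≤ b X X := by
  rcases eq_or_ne X 0 with rfl | hX
  · simp
  · exact (hb.2 X hX).le

/-- The inner product structure given by a positive definite form. -/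
abbrev IsPosDefForm.innerCore (hb : IsPosDefForm b) : InnerProductSpace.Core ℝ V where
  inner X Y := b X Y
  conj_inner_symm X Y := hb.1 Y X
  re_inner_nonneg X := hb.nonneg X
  add_left X Y Z := by simp
  smul_left X Y c := by simp
  definite X hX := not_imp_comm.1 (hb.2 X) hX.not_gt

section OrthonormalBasis

variable {ι F : Type*} [Fintype ι] [DecidableEq ι] [AddCommGroup F] [Module ℝ F]
  {e f : Module.Basis ι ℝ V}

lemma sum_bilin_smul_basis (he : ∀ i j, b (e i) (e j) = if i = j then 1 else 0) (X : V) :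
    ∑ i, b (e i) X • e i = X := by
  have hcoord (i : ι) : b (e i) X = e.repr X i := by
    conv_lhs => rw [← e.sum_repr X]
    simp only [map_sum, map_smul, he, smul_eq_mul, mul_ite, mul_one, mul_zero,
      Finset.sum_ite_eq, Finset.mem_univ, if_true]
  simp only [hcoord, e.sum_repr]

lemma sum_apply_apply_basis_eq (hsymm : ∀ X Y, b X Y = b Y X)
    (he : ∀ i j, b (e i) (e j) = if i = j then 1 else 0)
    (hf : ∀ i j, b (f i) (f j) = if i = j then 1 else 0) (q : V →ₗ[ℝ] V →ₗ[ℝ] F) :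
    ∑ i, q (e i) (e i) = ∑ i, q (f i) (f i) := by
  calc ∑ i, q (e i) (e i) = ∑ i, ∑ j, b (f j) (e i) • q (f j) (e i) := by
        refine Finset.sum_congr rfl fun i _ => ?_
        conv_lhs => enter [1]; rw [← sum_bilin_smul_basis hf (e i)]
        simp only [map_sum, map_smul, LinearMap.sum_apply, LinearMap.smul_apply]
    _ = ∑ j, ∑ i, b (e i) (f j) • q (f j) (e i) := by
        rw [Finset.sum_comm]
        simp only [hsymm]
    _ = ∑ j, q (f j) (f j) := by
        refine Finset.sum_congr rfl fun j _ => ?_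
        conv_rhs => enter [2]; rw [← sum_bilin_smul_basis he (f j)]
        simp only [map_sum, map_smul]

end OrthonormalBasis

section FiniteDimensional

variable [FiniteDimensional ℝ V]

lemma IsPosDefForm.exists_norm_le_mul_sqrt (hb : IsPosDefForm b) {F : Type*}
    [NormedAddCommGroup F] [NormedSpace ℝ F] (f : V →ₗ[ℝ] F) :
    ∃ C > (0 : ℝ), ∀ X, ‖f X‖ ≤ C * Real.sqrt (b X X) := by
  let _ : NormedAddCommGroup V := hb.innerCore.toNormedAddCommGroup
  let _ : InnerProductSpace ℝ V := InnerProductSpace.ofCore hb.innerCore.toCore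
  obtain ⟨C, hC, hle⟩ := (LinearMap.toContinuousLinearMap f).bound
  exact ⟨C, hC, fun X => (hle X).trans_eq (congrArg (C * ·) (@norm_eq_sqrt_re_inner ℝ V _ _ _ X))⟩

lemma IsPosDefForm.exists_orthonormal_basis (hb : IsPosDefForm b) :
    ∃ e : Module.Basis (Fin (Module.finrank ℝ V)) ℝ V,
      ∀ i j, b (e i) (e j) = if i = j then 1 else 0 := by
  let _ : NormedAddCommGroup V := hb.innerCore.toNormedAddCommGroup
  let _ : InnerProductSpace ℝ V := InnerProductSpace.ofCore hb.innerCore.toCore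
  refine ⟨(stdOrthonormalBasis ℝ V).toBasis, fun i j => ?_⟩
  rw [OrthonormalBasis.coe_toBasis]
  exact orthonormal_iff_ite.1 (stdOrthonormalBasis ℝ V).orthonormal i j

lemma IsPosDefForm.iSup_iInf_eigenspace_eq_top (hb : IsPosDefForm b) {ι : Type*}
    {T : ι → Module.End ℝ V} (hT : ∀ i X Y, b (T i X) Y = b X (T i Y))
    (hcomm : ∀ i j, Commute (T i) (T j)) :
    ⨆ χ : ι → ℝ, ⨅ i, Module.End.eigenspace (T i) (χ i) = ⊤ := by
  let _ : NormedAddCommGroup V := hb.innerCore.toNormedAddCommGroup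
  let _ : InnerProductSpace ℝ V := InnerProductSpace.ofCore hb.innerCore.toCore
  exact LinearMap.IsSymmetric.iSup_iInf_eq_top_of_commute hT fun i j _ => hcomm i j

end FiniteDimensional

/-! ### Root decomposition -/

variable {T : Type*} [AddCommGroup T] [Module ℝ T]

/-- `X + iY` is a root vector for `iα`, in real and imaginary parts. -/
def IsRootVectorPair (ad : T →ₗ[ℝ] Module.End ℝ V) (α : Module.Dual ℝ T) (X Y : V) : Prop :=
  ∀ H, ad H X = -(α H • Y) ∧ ad H Y = α H • X

variable {ad : T →ₗ[ℝ] Module.End ℝ V} {X Y : V}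

lemma IsRootVectorPair.neg {α : Module.Dual ℝ T} (h : IsRootVectorPair ad α X Y) :
    IsRootVectorPair ad (-α) X (-Y) := fun H => by
  rw [map_neg, (h H).1, (h H).2, LinearMap.neg_apply, neg_smul, neg_smul, smul_neg, neg_neg]
  exact ⟨rfl, rfl⟩

/-- Skewness makes the eigenvalue `χ H₁ H₁` negative, say `-a²`; the root vector is
`X - i a⁻¹ ad H₁ X`, with `α H = -a⁻¹ χ H H₁`. -/
lemma exists_isRootVectorPair_of_apply_apply_eq_smul (hb : IsPosDefForm b)
    (hcomm : ∀ H H' Z, ad H (ad H' Z) = ad H' (ad H Z))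
    (hskew : ∀ H Z W, b (ad H Z) W = -b Z (ad H W)) {χ : T → T → ℝ}
    (hχ : ∀ H H', ad H (ad H' X) = χ H H' • X) {H₁ : T} (hH₁ : ad H₁ X ≠ 0) :
    ∃ (Y : V) (α : Module.Dual ℝ T), α ≠ 0 ∧ IsRootVectorPair ad α X Y := by
  have hX : 0 < b X X := hb.2 X fun h => hH₁ (by rw [h, map_zero])
  have hneg : 0 < -χ H₁ H₁ := by
    have hpos := hb.2 _ hH₁
    rw [hskew, hχ, map_smul, smul_eq_mul] at hpos
    nlinarith
  obtain ⟨a, ha, ha_sq⟩ : ∃ a > 0, -χ H₁ H₁ = a * a :=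
    ⟨_, Real.sqrt_pos.2 hneg, (Real.mul_self_sqrt hneg.le).symm⟩
  let α : Module.Dual ℝ T := -(a⁻¹ * (b X X)⁻¹) • (b X ∘ₗ LinearMap.applyₗ (ad H₁ X) ∘ₗ ad)
  have hα (H : T) : α H = -(a⁻¹ * χ H H₁) := by
    simp only [α, LinearMap.smul_apply, LinearMap.comp_apply, LinearMap.applyₗ_apply_apply, hχ,
      map_smul, smul_eq_mul]
    field_simp
  have hχ_smul (H : T) : χ H H₁ • ad H₁ X = -(a * a) • ad H X := by
    rw [← ha_sq, neg_neg, ← map_smul, ← map_smul, ← hχ, ← hχ, hcomm H₁ H]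
  refine ⟨-(a⁻¹ • ad H₁ X), α, fun h => ?_, fun H => ⟨?_, ?_⟩⟩
  · have hα_zero := hα H₁
    rw [h, LinearMap.zero_apply, ← mul_neg, ha_sq, inv_mul_cancel_left₀ ha.ne'] at hα_zero
    exact ha.ne hα_zero
  · rw [hα, smul_neg, neg_neg, smul_comm, neg_smul, mul_smul, hχ_smul]
    match_scalars
    field_simp
  · rw [hα, map_neg, map_smul, hχ]
    module

lemma span_isRootVectorPair_eq_top [FiniteDimensional ℝ V] (hb : IsPosDefForm b)
    (hcomm : ∀ H H' Z, ad H (ad H' Z) = ad H' (ad H Z))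
    (hskew : ∀ H Z W, b (ad H Z) W = -b Z (ad H W)) :
    Submodule.span ℝ {X : V | (∀ H, ad H X = 0) ∨
      ∃ (Y : V) (α : Module.Dual ℝ T), X ≠ 0 ∧ α ≠ 0 ∧ IsRootVectorPair ad α X Y} = ⊤ := by
  rw [eq_top_iff, ← hb.iSup_iInf_eigenspace_eq_top (T := fun p : T × T => ad p.1 * ad p.2)
    (fun p Z W => by simp [hskew, hcomm]) fun p q => LinearMap.ext fun Z => by
      simp only [Module.End.mul_apply]
      rw [hcomm p.2, hcomm p.2 q.2, hcomm p.1 q.1, hcomm p.1 q.2]]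
  refine iSup_le fun χ X hX => Submodule.subset_span ?_
  have hχ (H H' : T) : ad H (ad H' X) = χ (H, H') • X :=
    Module.End.mem_eigenspace_iff.1 ((Submodule.mem_iInf _).1 hX (H, H'))
  by_cases hzero : ∀ H, ad H X = 0
  · exact Or.inl hzero
  · obtain ⟨H₁, hH₁⟩ := not_forall.1 hzero
    obtain ⟨Y, α, hα, hXY⟩ := exists_isRootVectorPair_of_apply_apply_eq_smul hb hcomm hskew
      (χ := fun H H' => χ (H, H')) hχ hH₁
    exact Or.inr ⟨Y, α, fun h => hH₁ (by rw [h, map_zero]), hα, hXY⟩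

end PositiveDefinite

section LieAlgebra

variable {L : Type*} [LieRing L] [LieAlgebra ℝ L]

/-- The adjoint action of a subspace of a Lie algebra. -/
noncomputable def adRestrict (𝔱 : Submodule ℝ L) : 𝔱 →ₗ[ℝ] Module.End ℝ L :=
  (LieAlgebra.ad ℝ L : L →ₗ[ℝ] Module.End ℝ L) ∘ₗ 𝔱.subtype

variable {𝔱 : Submodule ℝ L}

lemma adRestrict_apply_apply (H : 𝔱) (X : L) : adRestrict 𝔱 H X = ⁅(H : L), X⁆ := rfl

lemma IsRootVectorPair.lie_lie_eq_zero {α : Module.Dual ℝ 𝔱} {X Y : L}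
    (h : IsRootVectorPair (adRestrict 𝔱) α X Y) (H : 𝔱) : ⁅(H : L), ⁅X, Y⁆⁆ = 0 := by
  rw [leibniz_lie, ← adRestrict_apply_apply, ← adRestrict_apply_apply, (h H).1, (h H).2, neg_lie,
    smul_lie, lie_smul, lie_self, lie_self, smul_zero, neg_zero, add_zero]

end LieAlgebra

/-! ### The invariant inner product -/

section InvariantForm

variable {E : Type*} [NormedAddCommGroup E] [NormedSpace ℝ E]

section Average

variable {G : Type*} [TopologicalSpace G] [ChartedSpace E G] [Group G]

/-- The average of a bilinear form over the adjoint action of the group. -/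
noncomputable def averagedForm [MeasurableSpace G] (μ : MeasureTheory.Measure G)
    (β : E →L[ℝ] E →L[ℝ] ℝ) : E →L[ℝ] E →L[ℝ] ℝ :=
  ∫ g, β.bilinearComp (lieAd E G g⁻¹) (lieAd E G g⁻¹) ∂μ

variable [LieGroup 𝓘(ℝ, E) ∞ G]

lemma continuous_bilinearComp_lieAd_inv (β : E →L[ℝ] E →L[ℝ] ℝ) :
    Continuous fun g : G => β.bilinearComp (lieAd E G g⁻¹) (lieAd E G g⁻¹) := by
  have : IsTopologicalGroup G := topologicalGroup_of_lieGroup 𝓘(ℝ, E) ∞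
  have hAd : Continuous fun g : G => lieAd E G g⁻¹ := continuous_lieAd.comp continuous_inv
  have hcomp : Continuous fun g : G => (β ∘L lieAd E G g⁻¹).flip :=
    (ContinuousLinearMap.flipₗᵢ ℝ E E ℝ).continuous.comp (continuous_const.clm_comp hAd)
  exact (ContinuousLinearMap.flipₗᵢ ℝ E E ℝ).continuous.comp (hcomp.clm_comp hAd)

variable [CompactSpace G] [MeasurableSpace G] [BorelSpace G] {μ : MeasureTheory.Measure G}
  {β : E →L[ℝ] E →L[ℝ] ℝ}

lemma averagedForm_apply_apply [MeasureTheory.IsFiniteMeasureOnCompacts μ] (X Y : E) :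
    averagedForm μ β X Y = ∫ g, β (lieAd E G g⁻¹ X) (lieAd E G g⁻¹ Y) ∂μ := by
  have hcont := continuous_bilinearComp_lieAd_inv (G := G) β
  rw [averagedForm, ContinuousLinearMap.integral_apply
      (continuous_integrable_of_compactSpace hcont),
    ContinuousLinearMap.integral_apply
      (continuous_integrable_of_compactSpace (hcont.clm_apply continuous_const))]
  rfl

lemma averagedForm_self_pos [MeasureTheory.IsFiniteMeasureOnCompacts μ] [μ.IsOpenPosMeasure]
    (hβ : ∀ X, 0 ≤ β X X) {X : E} (hX : 0 < β X X) : 0 < averagedForm μ β X X := by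
  rw [averagedForm_apply_apply]
  refine Continuous.integral_pos_of_hasCompactSupport_nonneg_nonzero (x := 1)
    (((continuous_bilinearComp_lieAd_inv β).clm_apply continuous_const).clm_apply
      continuous_const)
    (HasCompactSupport.of_compactSpace _) (fun g => hβ _) ?_
  simpa only [inv_one, lieAd_one, ContinuousLinearMap.id_apply] using hX.ne'

lemma averagedForm_lieAd_apply [MeasureTheory.IsFiniteMeasureOnCompacts μ]
    [μ.IsMulLeftInvariant] (g : G) (X Y : E) :
    averagedForm μ β (lieAd E G g X) (lieAd E G g Y) = averagedForm μ β X Y := by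
  have : IsTopologicalGroup G := topologicalGroup_of_lieGroup 𝓘(ℝ, E) ∞
  have hcancel (h : G) (Z : E) : lieAd E G (g * h)⁻¹ (lieAd E G g Z) = lieAd E G h⁻¹ Z := by
    rw [← ContinuousLinearMap.comp_apply, ← lieAd_mul, mul_inv_rev, inv_mul_cancel_right]
  rw [averagedForm_apply_apply, averagedForm_apply_apply,
    ← MeasureTheory.integral_mul_left_eq_self _ g]
  simp only [hcancel]

end Average

lemma exists_isPosDefForm_lieAd_invariant [FiniteDimensional ℝ E] (G : Type*)
    [TopologicalSpace G] [ChartedSpace E G] [Group G] [LieGroup 𝓘(ℝ, E) ∞ G] [CompactSpace G]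
    {B : LinearMap.BilinForm ℝ E} (hB : IsPosDefForm B) :
    ∃ B' : LinearMap.BilinForm ℝ E, IsPosDefForm B' ∧
      ∀ (g : G) X Y, B' (lieAd E G g X) (lieAd E G g Y) = B' X Y := by
  have : IsTopologicalGroup G := topologicalGroup_of_lieGroup 𝓘(ℝ, E) ∞
  let _ : MeasurableSpace G := borel G
  have : BorelSpace G := ⟨rfl⟩
  let μ : MeasureTheory.Measure G := MeasureTheory.Measure.haar
  let β : E →L[ℝ] E →L[ℝ] ℝ := LinearMap.toContinuousBilinearMap B
  refine ⟨(averagedForm μ β).toBilinForm, ⟨fun X Y => ?_, fun X hX => ?_⟩, fun g X Y => ?_⟩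
  · change averagedForm μ β X Y = averagedForm μ β Y X
    simp only [averagedForm_apply_apply]
    exact congrArg (MeasureTheory.integral μ) (funext fun g => hB.1 _ _)
  · exact averagedForm_self_pos (μ := μ) (β := β) hB.nonneg (hB.2 X hX)
  · exact averagedForm_lieAd_apply (μ := μ) (β := β) g X Y

variable {G : Type*} [TopologicalSpace G] [ChartedSpace E G] [Group G] [LieGroup 𝓘(ℝ, E) ∞ G]

lemma apply_fderiv_lieAd_eq_neg {β : E →L[ℝ] E →L[ℝ] ℝ}
    (hinv : ∀ (g : G) X Y, β (lieAd E G g X) (lieAd E G g Y) = β X Y) (H X Y : E) :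
    β (fderiv ℝ (fun u => lieAd E G ((idChart E G).symm u)) (idPoint E G) H X) Y =
      -β X (fderiv ℝ (fun u => lieAd E G ((idChart E G).symm u)) (idPoint E G) H Y) := by
  have hAd (Z : E) := (differentiableAt_lieAd_idChart_symm (E := E) (G := G)).hasFDerivAt.clm_apply
    (hasFDerivAt_const Z (idPoint E G))
  have hprod := (β.hasFDerivAt.comp (idPoint E G) (hAd X)).clm_apply (hAd Y)
  have hconst : HasFDerivAt (fun u : E => β (lieAd E G ((idChart E G).symm u) X)
      (lieAd E G ((idChart E G).symm u) Y)) (0 : E →L[ℝ] ℝ) (idPoint E G) := by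
    simp only [hinv]
    exact hasFDerivAt_const _ _
  have hzero := congrArg (fun L : E →L[ℝ] ℝ => L H) (hprod.unique hconst)
  simp only [Function.comp_apply, idChart_symm_idPoint, lieAd_one, add_apply, zero_apply,
    ContinuousLinearMap.comp_apply, ContinuousLinearMap.flip_apply,
    ContinuousLinearMap.id_apply, map_zero, zero_add] at hzero
  linarith

lemma IsInnerProduct.exists_lie_skew [FiniteDimensional ℝ E] [CompactSpace G]
    {B : LinearMap.BilinForm ℝ (GroupLieAlgebra 𝓘(ℝ, E) G)} (hB : IsInnerProduct B) :
    ∃ B' : LinearMap.BilinForm ℝ (GroupLieAlgebra 𝓘(ℝ, E) G), IsInnerProduct B' ∧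
      ∀ H X Y : GroupLieAlgebra 𝓘(ℝ, E) G, B' ⁅H, X⁆ Y = -B' X ⁅H, Y⁆ := by
  let B₁ : LinearMap.BilinForm ℝ E := B
  obtain ⟨B', hB', hinv⟩ := exists_isPosDefForm_lieAd_invariant G (B := B₁) hB
  refine ⟨B', hB', fun H X Y => ?_⟩
  rw [← fderiv_lieAd_apply H X, ← fderiv_lieAd_apply H Y]
  exact apply_fderiv_lieAd_eq_neg (β := LinearMap.toContinuousBilinearMap B') hinv H X Y

lemma span_positive_isRootVectorPair_eq_top [FiniteDimensional ℝ E] [CompactSpace G]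
    {B : LinearMap.BilinForm ℝ (GroupLieAlgebra 𝓘(ℝ, E) G)} (hB : IsInnerProduct B)
    {𝔱 : Submodule ℝ (GroupLieAlgebra 𝓘(ℝ, E) G)} (h𝔱 : IsMaximalAbelian 𝔱)
    {H₀ : 𝔱} (hH₀ : IsRegularElement 𝔱 H₀) :
    Submodule.span ℝ {X : GroupLieAlgebra 𝓘(ℝ, E) G | X ∈ 𝔱 ∨
      ∃ (Y : GroupLieAlgebra 𝓘(ℝ, E) G) (α : Module.Dual ℝ 𝔱),
        ⁅X, Y⁆ ∈ 𝔱 ∧ 0 < α H₀ ∧ IsRootVectorPair (adRestrict 𝔱) α X Y} = ⊤ := by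
  have : CompleteSpace E := FiniteDimensional.complete ℝ E
  have : FiniteDimensional ℝ (GroupLieAlgebra 𝓘(ℝ, E) G) := inferInstanceAs (FiniteDimensional ℝ E)
  obtain ⟨B', hB', hskew⟩ := hB.exists_lie_skew
  have hcomm (H H' : 𝔱) (Z : GroupLieAlgebra 𝓘(ℝ, E) G) :
      adRestrict 𝔱 H (adRestrict 𝔱 H' Z) = adRestrict 𝔱 H' (adRestrict 𝔱 H Z) := by
    simp only [adRestrict_apply_apply]
    rw [leibniz_lie, h𝔱.1 H H.2 H' H'.2, zero_lie, zero_add]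
  rw [eq_top_iff, ← span_isRootVectorPair_eq_top (b := B') hB' hcomm fun H X Y => hskew H X Y]
  refine Submodule.span_mono ?_
  rintro X (hX | ⟨Y, α, hX, hα, hXY⟩)
  · exact Or.inl (h𝔱.2 X fun H hH => hX ⟨H, hH⟩)
  have hlie : ⁅X, Y⁆ ∈ 𝔱 := h𝔱.2 _ fun H hH => hXY.lie_lie_eq_zero ⟨H, hH⟩
  rcases lt_or_gt_of_ne (hH₀ α ⟨hα, X, Y, Or.inl hX, hXY⟩) with hneg | hpos
  · refine Or.inr ⟨-Y, -α, ?_, neg_pos.2 hneg, hXY.neg⟩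
    rw [lie_neg]
    exact 𝔱.neg_mem hlie
  · exact Or.inr ⟨Y, α, hlie, hpos, hXY⟩

end InvariantForm

/-! ### Highest weight vectors and the Casimir operator -/

section HighestWeight

lemma opNorm_le_of_sum_norm_sq_eq {𝕜 V W ι : Type*} [RCLike 𝕜] [NormedAddCommGroup V]
    [NormedSpace 𝕜 V] [NormedAddCommGroup W] [NormedSpace 𝕜 W] [Fintype ι] {T : ι → V →L[𝕜] W}
    {z : ℝ} (hz : ∀ w, ∑ i, ‖T i w‖ ^ 2 = z * ‖w‖ ^ 2) {v : V} (hv : v ≠ 0) {C : ι → ℝ} {ρ : ℝ}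
    (hρ : 0 ≤ ρ) (hC : ∀ i, ‖T i v‖ ≤ C i * ρ * ‖v‖) (i : ι) :
    ‖T i‖ ≤ Real.sqrt (∑ i, C i ^ 2) * ρ := by
  have hz_le : z ≤ (∑ i, C i ^ 2) * ρ ^ 2 := by
    refine le_of_mul_le_mul_right ?_ (pow_pos (norm_pos_iff.2 hv) 2)
    rw [← hz v, Finset.sum_mul, Finset.sum_mul]
    refine Finset.sum_le_sum fun i _ => ?_
    simpa only [mul_pow] using pow_le_pow_left₀ (norm_nonneg _) (hC i) 2
  refine ContinuousLinearMap.opNorm_le_bound _ (by positivity) fun w => ?_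
  refine (sq_le_sq₀ (norm_nonneg _) (by positivity)).1 ?_
  calc ‖T i w‖ ^ 2 ≤ ∑ i, ‖T i w‖ ^ 2 :=
        Finset.single_le_sum (f := fun i => ‖T i w‖ ^ 2) (fun i _ => sq_nonneg _)
          (Finset.mem_univ i)
    _ ≤ (∑ i, C i ^ 2) * ρ ^ 2 * ‖w‖ ^ 2 := by rw [hz w]; gcongr
    _ = (Real.sqrt (∑ i, C i ^ 2) * ρ * ‖w‖) ^ 2 := by
        rw [mul_pow, mul_pow, Real.sq_sqrt (Finset.sum_nonneg fun i _ => sq_nonneg _)]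

variable {E : Type*} [NormedAddCommGroup E] [NormedSpace ℝ E]
  {G : Type*} [TopologicalSpace G] [ChartedSpace E G] [Group G]
  {B : LinearMap.BilinForm ℝ (GroupLieAlgebra 𝓘(ℝ, E) G)}
  {𝔱 : Submodule ℝ (GroupLieAlgebra 𝓘(ℝ, E) G)} {H₀ : 𝔱}

/-- The weight vectors of weight `μ`, the zero vector included. -/
def IsWeightVector (𝔱 : Submodule ℝ (GroupLieAlgebra 𝓘(ℝ, E) G)) (π : UnitaryIrrep G)
    (μ : Module.Dual ℝ 𝔱) (v : π.Space) : Prop :=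
  ∀ X : 𝔱, π.deriv (X : GroupLieAlgebra 𝓘(ℝ, E) G) v = (Complex.I * (μ X : ℂ)) • v

lemma apply_nonneg_of_mem_closure_positive {μ : Module.Dual ℝ 𝔱}
    (h : μ ∈ AddSubmonoid.closure {α : Module.Dual ℝ 𝔱 | IsRoot 𝔱 α ∧ 0 < α H₀}) : 0 ≤ μ H₀ := by
  induction h using AddSubmonoid.closure_induction with
  | mem α h => exact h.2.le
  | zero => simp
  | add α β _ _ hα hβ => simpa using add_nonneg hα hβ

lemma IsHighestWeight.not_isWeight_add {π : UnitaryIrrep G} {ℓ α : Module.Dual ℝ 𝔱}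
    (hℓ : IsHighestWeight 𝔱 H₀ π ℓ) (hα : 0 < α H₀) : ¬IsWeight 𝔱 π (ℓ + α) := fun hweight => by
  have hnonneg := apply_nonneg_of_mem_closure_positive (hℓ.2 _ hweight)
  rw [sub_add_cancel_left, LinearMap.neg_apply] at hnonneg
  linarith

variable [FiniteDimensional ℝ E]

lemma abs_le_weightNorm_mul_sqrt (hB : IsInnerProduct B) (μ : Module.Dual ℝ 𝔱) (X : 𝔱) :
    |μ X| ≤ weightNorm B 𝔱 μ * Real.sqrt (B X X) := by
  have : FiniteDimensional ℝ (GroupLieAlgebra 𝓘(ℝ, E) G) := inferInstanceAs (FiniteDimensional ℝ E)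
  let b : LinearMap.BilinForm ℝ 𝔱 := B.compl₁₂ 𝔱.subtype 𝔱.subtype
  have hb : IsPosDefForm b :=
    ⟨fun X Y => hB.1 X Y, fun X hX => hB.2 X fun h => hX (Subtype.ext h)⟩
  obtain ⟨C, hC, hle⟩ := hb.exists_norm_le_mul_sqrt μ
  have hbdd : BddAbove {c : ℝ | ∃ X : 𝔱, B X X ≤ 1 ∧ c = |μ X|} := by
    refine ⟨C, ?_⟩
    rintro _ ⟨Y, hY, rfl⟩
    exact (hle Y).trans (mul_le_of_le_one_right hC.le (Real.sqrt_le_one.2 hY))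
  rcases eq_or_ne X 0 with rfl | hX
  · simp
  set s := Real.sqrt (B X X)
  have hs : 0 < s := Real.sqrt_pos.2 (hb.2 X hX)
  have hs_sq : B X X = s * s := (Real.mul_self_sqrt (hb.2 X hX).le).symm
  have hunit : |μ (s⁻¹ • X)| ≤ weightNorm B 𝔱 μ := by
    refine le_csSup hbdd ⟨s⁻¹ • X, le_of_eq ?_, rfl⟩
    rw [Submodule.coe_smul, map_smul, map_smul, LinearMap.smul_apply, hs_sq, smul_eq_mul,
      smul_eq_mul]
    field_simp
  rwa [map_smul, smul_eq_mul, abs_mul, abs_of_pos (inv_pos.2 hs), inv_mul_le_iff₀' hs] at hunit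

lemma IsWeightVector.norm_deriv_apply_le (hB : IsInnerProduct B) {π : UnitaryIrrep G}
    {μ : Module.Dual ℝ 𝔱} {v : π.Space} (hv : IsWeightVector 𝔱 π μ v)
    {X : GroupLieAlgebra 𝓘(ℝ, E) G} (hX : X ∈ 𝔱) :
    ‖π.deriv X v‖ ≤
      Real.sqrt (B X X) * Real.sqrt (weightNorm B 𝔱 μ ^ 2 + weightNorm B 𝔱 μ) * ‖v‖ := by
  have hnorm : ‖π.deriv X v‖ = |μ ⟨X, hX⟩| * ‖v‖ := by
    rw [hv ⟨X, hX⟩, norm_smul, norm_mul, Complex.norm_I, one_mul, Complex.norm_real,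
      Real.norm_eq_abs]
  have hsqrt : weightNorm B 𝔱 μ ≤ Real.sqrt (weightNorm B 𝔱 μ ^ 2 + weightNorm B 𝔱 μ) :=
    Real.le_sqrt_of_sq_le (le_add_of_nonneg_right (weightNorm_nonneg B 𝔱 μ))
  rw [hnorm]
  gcongr
  refine (abs_le_weightNorm_mul_sqrt hB μ ⟨X, hX⟩).trans ?_
  rw [mul_comm]
  gcongr

variable [LieGroup 𝓘(ℝ, E) ∞ G] [T2Space G] [CompactSpace G]

namespace UnitaryIrrep

variable (π : UnitaryIrrep G)

lemma deriv_lie_apply (X Y : GroupLieAlgebra 𝓘(ℝ, E) G) (v : π.Space) :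
    π.deriv ⁅X, Y⁆ v = π.deriv X (π.deriv Y v) - π.deriv Y (π.deriv X v) := by
  rw [π.deriv_eq_derivCLM, π.deriv_eq_derivCLM, π.deriv_eq_derivCLM, π.derivCLM_bracket]
  rfl

lemma inner_deriv_left (X : GroupLieAlgebra 𝓘(ℝ, E) G) (v w : π.Space) :
    inner ℂ (π.deriv X v) w = -inner ℂ v (π.deriv X w) := by
  rw [π.deriv_eq_derivCLM]
  exact π.inner_derivCLM_left _ v w

lemma deriv_smul_apply (c : ℝ) (X : GroupLieAlgebra 𝓘(ℝ, E) G) (v : π.Space) :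
    π.deriv (c • X) v = (c : ℂ) • π.deriv X v := by
  rw [π.deriv_eq_derivCLM, π.deriv_eq_derivCLM]
  exact congrArg (fun L : π.Space →L[ℂ] π.Space => L v) ((π.derivCLM E).map_smul c X)

lemma deriv_add_apply (X Y : GroupLieAlgebra 𝓘(ℝ, E) G) (v : π.Space) :
    π.deriv (X + Y) v = π.deriv X v + π.deriv Y v := by
  rw [π.deriv_eq_derivCLM, π.deriv_eq_derivCLM, π.deriv_eq_derivCLM]
  exact congrArg (fun L : π.Space →L[ℂ] π.Space => L v) ((π.derivCLM E).map_add X Y)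

lemma deriv_zero_apply (v : π.Space) : π.deriv (0 : GroupLieAlgebra 𝓘(ℝ, E) G) v = 0 := by
  rw [π.deriv_eq_derivCLM]
  exact congrArg (fun L : π.Space →L[ℂ] π.Space => L v) (π.derivCLM E).map_zero

variable {π} {v : π.Space} {X Y : GroupLieAlgebra 𝓘(ℝ, E) G}

lemma isWeightVector_deriv_add_I_smul_deriv {μ α : Module.Dual ℝ 𝔱}
    (hv : IsWeightVector 𝔱 π μ v) (hXY : IsRootVectorPair (adRestrict 𝔱) α X Y) :
    IsWeightVector 𝔱 π (μ + α) (π.deriv X v + Complex.I • π.deriv Y v) := fun H => by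
  have hX := π.deriv_lie_apply (H : GroupLieAlgebra 𝓘(ℝ, E) G) X v
  have hY := π.deriv_lie_apply (H : GroupLieAlgebra 𝓘(ℝ, E) G) Y v
  rw [← adRestrict_apply_apply, (hXY H).1, ← neg_smul, π.deriv_smul_apply, hv, map_smul] at hX
  rw [← adRestrict_apply_apply, (hXY H).2, π.deriv_smul_apply, hv, map_smul] at hY
  rw [map_add, map_smul, sub_eq_iff_eq_add.1 hX.symm, sub_eq_iff_eq_add.1 hY.symm,
    LinearMap.add_apply]
  push_cast
  match_scalars
  · linear_combination (-(α H : ℂ)) * Complex.I_mul_I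
  · ring

lemma deriv_add_I_smul_deriv_eq_zero {ℓ α : Module.Dual ℝ 𝔱} (hℓ : IsHighestWeight 𝔱 H₀ π ℓ)
    (hv : IsWeightVector 𝔱 π ℓ v) (hα : 0 < α H₀)
    (hXY : IsRootVectorPair (adRestrict 𝔱) α X Y) :
    π.deriv X v + Complex.I • π.deriv Y v = 0 := by
  by_contra hne
  exact hℓ.not_isWeight_add hα ⟨_, hne, isWeightVector_deriv_add_I_smul_deriv hv hXY⟩

lemma norm_deriv_apply_sq_eq {c : ℝ} (hv : π.deriv ⁅X, Y⁆ v = (Complex.I * (c : ℂ)) • v)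
    (hzero : π.deriv X v + Complex.I • π.deriv Y v = 0) :
    ‖π.deriv X v‖ ^ 2 = -c / 2 * ‖v‖ ^ 2 := by
  rw [π.deriv_lie_apply] at hv
  have hX : π.deriv X v = -(Complex.I • π.deriv Y v) := eq_neg_of_add_eq_zero_left hzero
  have hnorm : inner ℂ (π.deriv X v) (π.deriv X v) = ((‖π.deriv X v‖ : ℂ)) ^ 2 :=
    inner_self_eq_norm_sq_to_K _
  have hright : inner ℂ (π.deriv X v) (π.deriv X v) =
      Complex.I * inner ℂ v (π.deriv X (π.deriv Y v)) := by
    refine (congrArg (inner ℂ (π.deriv X v)) hX).trans ?_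
    rw [inner_neg_right, inner_smul_right, π.inner_deriv_left X v (π.deriv Y v)]
    ring
  have hleft : inner ℂ (π.deriv X v) (π.deriv X v) =
      -(Complex.I * inner ℂ v (π.deriv Y (π.deriv X v))) := by
    refine (congrArg (inner ℂ · (π.deriv X v)) hX).trans ?_
    simp only [inner_neg_left, inner_smul_left, Complex.conj_I]
    rw [π.inner_deriv_left Y v (π.deriv X v)]
    ring
  have hlie : inner ℂ v (π.deriv X (π.deriv Y v)) - inner ℂ v (π.deriv Y (π.deriv X v)) =
      Complex.I * c * (‖v‖ : ℂ) ^ 2 := by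
    rw [← inner_sub_right, hv, inner_smul_right, inner_self_eq_norm_sq_to_K]
    rfl
  have htwo : (2 : ℂ) * (‖π.deriv X v‖ : ℂ) ^ 2 = -c * (‖v‖ : ℂ) ^ 2 := by
    linear_combination
      (-2) * hnorm + hright + hleft + Complex.I * hlie + c * ‖v‖ ^ 2 * Complex.I_mul_I
  have htwo_real : 2 * ‖π.deriv X v‖ ^ 2 = -c * ‖v‖ ^ 2 := by exact_mod_cast htwo
  linarith

lemma norm_deriv_apply_le_of_isRootVectorPair (hB : IsInnerProduct B) {ℓ α : Module.Dual ℝ 𝔱}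
    (hℓ : IsHighestWeight 𝔱 H₀ π ℓ) (hv : IsWeightVector 𝔱 π ℓ v) (hα : 0 < α H₀)
    (hXY : IsRootVectorPair (adRestrict 𝔱) α X Y) (hlie : ⁅X, Y⁆ ∈ 𝔱) :
    ‖π.deriv X v‖ ≤ Real.sqrt (Real.sqrt (B ⁅X, Y⁆ ⁅X, Y⁆)) *
      Real.sqrt (weightNorm B 𝔱 ℓ ^ 2 + weightNorm B 𝔱 ℓ) * ‖v‖ := by
  have hsq := norm_deriv_apply_sq_eq (hv ⟨_, hlie⟩)
    (deriv_add_I_smul_deriv_eq_zero hℓ hv hα hXY)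
  have hle : -ℓ ⟨_, hlie⟩ ≤ weightNorm B 𝔱 ℓ * Real.sqrt (B ⁅X, Y⁆ ⁅X, Y⁆) :=
    (neg_le_abs _).trans (abs_le_weightNorm_mul_sqrt hB ℓ ⟨_, hlie⟩)
  have hW := weightNorm_nonneg B 𝔱 ℓ
  set W := weightNorm B 𝔱 ℓ
  have hs := Real.sqrt_nonneg (B ⁅X, Y⁆ ⁅X, Y⁆)
  set s := Real.sqrt (B ⁅X, Y⁆ ⁅X, Y⁆)
  refine (sq_le_sq₀ (norm_nonneg _) (by positivity)).1 ?_
  rw [hsq, mul_pow, mul_pow, Real.sq_sqrt hs, Real.sq_sqrt (by positivity)]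
  gcongr
  nlinarith [mul_nonneg hs (sq_nonneg W), mul_nonneg hs hW]

lemma exists_norm_deriv_apply_le (hB : IsInnerProduct B) (h𝔱 : IsMaximalAbelian 𝔱)
    (hH₀ : IsRegularElement 𝔱 H₀) (X : GroupLieAlgebra 𝓘(ℝ, E) G) :
    ∃ C : ℝ, ∀ (π : UnitaryIrrep G) (ℓ : Module.Dual ℝ 𝔱), IsHighestWeight 𝔱 H₀ π ℓ →
      ∀ v, IsWeightVector 𝔱 π ℓ v → ‖π.deriv X v‖ ≤
        C * Real.sqrt (weightNorm B 𝔱 ℓ ^ 2 + weightNorm B 𝔱 ℓ) * ‖v‖ := by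
  have hX : X ∈ (⊤ : Submodule ℝ (GroupLieAlgebra 𝓘(ℝ, E) G)) := trivial
  rw [← span_positive_isRootVectorPair_eq_top hB h𝔱 hH₀] at hX
  induction hX using Submodule.span_induction with
  | mem X hX =>
    rcases hX with hX | ⟨Y, α, hlie, hα, hXY⟩
    · exact ⟨_, fun π ℓ _ v hv => hv.norm_deriv_apply_le hB hX⟩
    · exact ⟨_, fun π ℓ hℓ v hv =>
        norm_deriv_apply_le_of_isRootVectorPair hB hℓ hv hα hXY hlie⟩
  | zero =>
    refine ⟨0, fun π ℓ _ v _ => ?_⟩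
    rw [π.deriv_zero_apply, norm_zero, zero_mul, zero_mul]
  | add X Y _ _ hX hY =>
    obtain ⟨C, hle⟩ := hX
    obtain ⟨C', hle'⟩ := hY
    refine ⟨C + C', fun π ℓ hℓ v hv => ?_⟩
    rw [π.deriv_add_apply, add_mul, add_mul]
    exact norm_add_le_of_le (hle π ℓ hℓ v hv) (hle' π ℓ hℓ v hv)
  | smul c X _ hX =>
    obtain ⟨C, hle⟩ := hX
    refine ⟨|c| * C, fun π ℓ hℓ v hv => ?_⟩
    rw [π.deriv_smul_apply, norm_smul, Complex.norm_real, Real.norm_eq_abs, mul_assoc, mul_assoc]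
    exact mul_le_mul_of_nonneg_left ((hle π ℓ hℓ v hv).trans_eq (mul_assoc _ _ _)) (abs_nonneg c)

end UnitaryIrrep

end HighestWeight

section Casimir

variable {E : Type*} [NormedAddCommGroup E] [NormedSpace ℝ E] {G : Type*} [TopologicalSpace G]

lemma UnitaryIrrep.exists_eq_smul_of_commute_op [Group G] (π : UnitaryIrrep G)
    {S : π.Space →L[ℂ] π.Space} (hS : ∀ g, Commute (π.op g) S) : ∃ c : ℂ, ∀ w, S w = c • w := by
  have : Nonempty (Fin π.dim) := ⟨⟨0, π.dim_pos⟩⟩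
  obtain ⟨c, hc⟩ := Module.End.exists_eigenvalue (S : π.Space →ₗ[ℂ] π.Space)
  have htop : Module.End.eigenspace (S : π.Space →ₗ[ℂ] π.Space) c = ⊤ := by
    refine (π.irreducible _ fun g v hv => ?_).resolve_left hc
    rw [Module.End.mem_eigenspace_iff] at hv ⊢
    have hSv : S v = c • v := hv
    calc S (π.op g v) = π.op g (S v) :=
          (congrArg (fun L : π.Space →L[ℂ] π.Space => L v) (hS g)).symm
      _ = c • π.op g v := by rw [hSv, map_smul]
  exact ⟨c, fun w => Module.End.mem_eigenspace_iff.1 (htop ▸ Submodule.mem_top : w ∈ _)⟩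

variable [ChartedSpace E G] [Group G] {ι : Type*} [Fintype ι]

/-- The operator by which the quadratic Casimir element `∑ eᵢ²` of a family `e` acts; it commutes
with the representation when `e` is orthonormal for an invariant form. -/
noncomputable def UnitaryIrrep.casimir (π : UnitaryIrrep G) (e : ι → E) :
    π.Space →L[ℂ] π.Space :=
  ∑ i, π.derivCLM E (e i) * π.derivCLM E (e i)

variable [LieGroup 𝓘(ℝ, E) ∞ G]

/-- The adjoint action of a group element, as an automorphism of the model space. -/
noncomputable def lieAdEquiv (E : Type*) [NormedAddCommGroup E] [NormedSpace ℝ E] {G : Type*}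
    [TopologicalSpace G] [ChartedSpace E G] [Group G] [LieGroup 𝓘(ℝ, E) ∞ G] (g : G) :
    E ≃ₗ[ℝ] E :=
  have hinv (h : G) : (lieAd E G h : E →ₗ[ℝ] E) ∘ₗ (lieAd E G h⁻¹ : E →ₗ[ℝ] E) = LinearMap.id :=
    LinearMap.ext fun X => by
      have hcomp : lieAd E G h ∘L lieAd E G h⁻¹ = ContinuousLinearMap.id ℝ E := by
        rw [← lieAd_mul, mul_inv_cancel, lieAd_one]
      exact congrArg (fun L : E →L[ℝ] E => L X) hcomp
  LinearEquiv.ofLinearMap (lieAd E G g) (lieAd E G g⁻¹) (hinv g)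
    (by simpa only [inv_inv] using hinv g⁻¹)

variable [FiniteDimensional ℝ E] [T2Space G] [CompactSpace G]

namespace UnitaryIrrep

variable (π : UnitaryIrrep G)

lemma inner_casimir_apply (e : ι → E) (w : π.Space) :
    inner ℂ w (π.casimir e w) = ((-∑ i, ‖π.derivCLM E (e i) w‖ ^ 2 : ℝ) : ℂ) := by
  have hterm (i : ι) : inner ℂ w ((π.derivCLM E (e i) * π.derivCLM E (e i)) w) =
      -((‖π.derivCLM E (e i) w‖ ^ 2 : ℝ) : ℂ) := by
    have hskew := π.inner_derivCLM_left (E := E) (e i) w (π.derivCLM E (e i) w)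
    rw [inner_self_eq_norm_sq_to_K] at hskew
    rw [Complex.ofReal_pow]
    exact (neg_eq_iff_eq_neg.2 hskew).symm
  simp only [casimir, sum_apply, inner_sum, hterm, Finset.sum_neg_distrib, Complex.ofReal_neg,
    Complex.ofReal_sum]

variable [DecidableEq ι] {B : LinearMap.BilinForm ℝ E} {e : Module.Basis ι ℝ E}

lemma commute_op_casimir (hsymm : ∀ X Y, B X Y = B Y X)
    (hinv : ∀ (g : G) X Y, B (lieAd E G g X) (lieAd E G g Y) = B X Y)
    (he : ∀ i j, B (e i) (e j) = if i = j then 1 else 0) (g : G) :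
    Commute (π.op g) (π.casimir e) := by
  let q : E →ₗ[ℝ] E →ₗ[ℝ] (π.Space →L[ℂ] π.Space) :=
    (LinearMap.mul ℝ (π.Space →L[ℂ] π.Space)).compl₁₂ (π.derivCLM E : E →ₗ[ℝ] _)
      (π.derivCLM E : E →ₗ[ℝ] _)
  have hrotate : π.casimir e = π.casimir fun i => lieAd E G g (e i) :=
    sum_apply_apply_basis_eq (f := e.map (lieAdEquiv E g)) hsymm he (fun i j => by
      rw [Module.Basis.map_apply, Module.Basis.map_apply]
      exact (hinv g _ _).trans (he i j)) q
  calc π.op g * π.casimir e = π.casimir (fun i => lieAd E G g (e i)) * π.op g := by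
        simp only [casimir, Finset.mul_sum, Finset.sum_mul]
        refine Finset.sum_congr rfl fun i _ => ?_
        rw [← mul_assoc, π.op_mul_derivCLM, mul_assoc, π.op_mul_derivCLM, mul_assoc]
    _ = π.casimir e * π.op g := by rw [← hrotate]

lemma exists_sum_norm_derivCLM_sq_eq (hsymm : ∀ X Y, B X Y = B Y X)
    (hinv : ∀ (g : G) X Y, B (lieAd E G g X) (lieAd E G g Y) = B X Y)
    (he : ∀ i j, B (e i) (e j) = if i = j then 1 else 0) :
    ∃ z : ℝ, ∀ w : π.Space, ∑ i, ‖π.derivCLM E (e i) w‖ ^ 2 = z * ‖w‖ ^ 2 := by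
  obtain ⟨c, hc⟩ := π.exists_eq_smul_of_commute_op (π.commute_op_casimir hsymm hinv he)
  refine ⟨-c.re, fun w => ?_⟩
  have hinner : inner ℂ w (π.casimir e w) = c * ((‖w‖ ^ 2 : ℝ) : ℂ) := by
    rw [hc, inner_smul_right, inner_self_eq_norm_sq_to_K, Complex.ofReal_pow]
    rfl
  rw [inner_casimir_apply] at hinner
  have hre := congrArg Complex.re hinner
  rw [Complex.ofReal_re, Complex.re_mul_ofReal] at hre
  linarith

end UnitaryIrrep

end Casimir

section DerivedBound

variable {E : Type*} [NormedAddCommGroup E] [NormedSpace ℝ E] [FiniteDimensional ℝ E]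
  {G : Type*} [TopologicalSpace G] [T2Space G] [CompactSpace G] [ChartedSpace E G] [Group G]
  [LieGroup 𝓘(ℝ, E) ∞ G] {B : LinearMap.BilinForm ℝ (GroupLieAlgebra 𝓘(ℝ, E) G)}
  {𝔱 : Submodule ℝ (GroupLieAlgebra 𝓘(ℝ, E) G)} {H₀ : 𝔱}

/-- The Casimir operator is a scalar, so its size can be read off on a highest weight vector. -/
theorem exists_norm_derivCLM_le (hB : IsInnerProduct B) (h𝔱 : IsMaximalAbelian 𝔱)
    (hH₀ : IsRegularElement 𝔱 H₀) :
    ∃ C > (0 : ℝ), ∀ (π : UnitaryIrrep G) (ℓ : Module.Dual ℝ 𝔱), IsHighestWeight 𝔱 H₀ π ℓ →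
      ‖π.derivCLM E‖ ≤ C * Real.sqrt (weightNorm B 𝔱 ℓ ^ 2 + weightNorm B 𝔱 ℓ) := by
  let B₁ : LinearMap.BilinForm ℝ E := B
  obtain ⟨B', hB', hinv⟩ := exists_isPosDefForm_lieAd_invariant G (B := B₁) hB
  obtain ⟨e, he⟩ := hB'.exists_orthonormal_basis
  choose C hle using fun i => UnitaryIrrep.exists_norm_deriv_apply_le hB h𝔱 hH₀
    (e i : GroupLieAlgebra 𝓘(ℝ, E) G)
  let K := Fintype.card (Fin (Module.finrank ℝ E)) • ‖e.equivFunL.toContinuousLinearMap‖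
  have : 0 ≤ K := by positivity
  refine ⟨K * Real.sqrt (∑ i, C i ^ 2) + 1, by positivity, fun π ℓ hℓ => ?_⟩
  obtain ⟨v, hv0, hv⟩ := hℓ.1
  obtain ⟨z, hz⟩ := π.exists_sum_norm_derivCLM_sq_eq hB'.1 hinv he
  have hbasis (i) : ‖π.derivCLM E (e i) v‖ ≤
      C i * Real.sqrt (weightNorm B 𝔱 ℓ ^ 2 + weightNorm B 𝔱 ℓ) * ‖v‖ := by
    have hderiv : π.deriv (e i : GroupLieAlgebra 𝓘(ℝ, E) G) = π.derivCLM E (e i) :=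
      π.deriv_eq_derivCLM _
    exact hderiv ▸ hle i π ℓ hℓ v hv
  refine (e.opNorm_le (by positivity)
    (opNorm_le_of_sum_norm_sq_eq hz hv0 (Real.sqrt_nonneg _) hbasis)).trans ?_
  rw [← mul_assoc]
  gcongr
  exact le_add_of_nonneg_right zero_le_one

end DerivedBound

section Main

variable {E : Type*} [NormedAddCommGroup E] [NormedSpace ℝ E] [FiniteDimensional ℝ E]
  {G : Type*} [TopologicalSpace G] [T2Space G] [CompactSpace G] [ConnectedSpace G]
  [ChartedSpace E G] [Group G] [LieGroup 𝓘(ℝ, E) ∞ G]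
  {B : LinearMap.BilinForm ℝ (GroupLieAlgebra 𝓘(ℝ, E) G)}
  {𝔱 : Submodule ℝ (GroupLieAlgebra 𝓘(ℝ, E) G)} {H₀ : 𝔱}

lemma exists_le_weightNorm (hB : IsInnerProduct B) (h𝔱 : IsMaximalAbelian 𝔱)
    (hH₀ : IsRegularElement 𝔱 H₀) :
    ∃ c > (0 : ℝ), ∀ π : UnitaryIrrep G, π.Nontrivial → ∀ ℓ, IsHighestWeight 𝔱 H₀ π ℓ →
      c ≤ weightNorm B 𝔱 ℓ := by
  obtain ⟨C, hC, hle⟩ := exists_norm_derivCLM_le hB h𝔱 hH₀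
  obtain ⟨a, ha, hlow⟩ := exists_le_norm_derivCLM (E := E) (G := G)
  refine ⟨min 1 (a ^ 2 / (2 * C ^ 2)), by positivity, fun π hπ ℓ hℓ => ?_⟩
  have hW := weightNorm_nonneg B 𝔱 ℓ
  have hderiv := (hlow π hπ).trans (hle π ℓ hℓ)
  set W := weightNorm B 𝔱 ℓ
  by_contra! hlt
  obtain ⟨hlt_one, hlt_div⟩ := lt_min_iff.1 hlt
  rw [lt_div_iff₀ (by positivity)] at hlt_div
  have hsq : a ^ 2 ≤ C ^ 2 * (W ^ 2 + W) := by
    rw [← Real.sq_sqrt (by positivity : 0 ≤ W ^ 2 + W), ← mul_pow]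
    exact pow_le_pow_left₀ ha.le hderiv 2
  have hle_two : C ^ 2 * (W ^ 2 + W) ≤ C ^ 2 * (2 * W) := by
    gcongr
    nlinarith
  linarith

lemma exists_norm_derivCLM_apply_le (hB : IsInnerProduct B) (h𝔱 : IsMaximalAbelian 𝔱)
    (hH₀ : IsRegularElement 𝔱 H₀) :
    ∃ C > (0 : ℝ), ∀ π : UnitaryIrrep G, π.Nontrivial → ∀ ℓ, IsHighestWeight 𝔱 H₀ π ℓ →
      ∀ X : GroupLieAlgebra 𝓘(ℝ, E) G,
        ‖π.derivCLM E (X : E)‖ ≤ C * weightNorm B 𝔱 ℓ * Real.sqrt (B X X) := by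
  obtain ⟨C, hC, hle⟩ := exists_norm_derivCLM_le hB h𝔱 hH₀
  obtain ⟨c, hc, hlow⟩ := exists_le_weightNorm hB h𝔱 hH₀
  let B₁ : LinearMap.BilinForm ℝ E := B
  obtain ⟨D, hD, hnorm⟩ :=
    IsPosDefForm.exists_norm_le_mul_sqrt (b := B₁) hB (LinearMap.id : E →ₗ[ℝ] E)
  refine ⟨C * Real.sqrt (1 + c⁻¹) * D, by positivity, fun π hπ ℓ hℓ X => ?_⟩
  have hcW := hlow π hπ ℓ hℓ
  have hderiv := hle π ℓ hℓ
  set W := weightNorm B 𝔱 ℓ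
  have hW : 0 ≤ W := hc.le.trans hcW
  have hsqrt : Real.sqrt (W ^ 2 + W) ≤ Real.sqrt (1 + c⁻¹) * W := by
    refine Real.sqrt_le_iff.2 ⟨by positivity, ?_⟩
    rw [mul_pow, Real.sq_sqrt (by positivity)]
    have hone : 1 ≤ c⁻¹ * W := by rwa [inv_mul_eq_div, one_le_div hc]
    nlinarith
  calc ‖π.derivCLM E (X : E)‖ ≤ C * (Real.sqrt (1 + c⁻¹) * W) * (D * Real.sqrt (B X X)) :=
        (π.derivCLM E).le_of_opNorm_le_of_le
          (hderiv.trans (mul_le_mul_of_nonneg_left hsqrt hC.le)) (hnorm X)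
    _ = C * Real.sqrt (1 + c⁻¹) * D * W * Real.sqrt (B X X) := by ring

variable {N : ℕ} {A : Matrix (Fin N) (Fin N) ℕ} {lam : ℝ} {Θ : OneSided A → G}

lemma MemLipGroup.exists_lipschitzBound_toHom (hΘ : MemLipGroup B lam Θ) (h0 : 0 ≤ lam)
    (hB : IsInnerProduct B) (h𝔱 : IsMaximalAbelian 𝔱) (hH₀ : IsRegularElement 𝔱 H₀) :
    ∃ C ≥ (0 : ℝ), ∀ π : UnitaryIrrep G, π.Nontrivial → ∀ ℓ, IsHighestWeight 𝔱 H₀ π ℓ →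
      LipschitzBound lam (C * weightNorm B 𝔱 ℓ) fun y => π.toHom (Θ y) := by
  obtain ⟨K, hK⟩ := hΘ
  obtain ⟨c, hc, hlow⟩ := exists_le_weightNorm hB h𝔱 hH₀
  obtain ⟨C, hC, hle⟩ := exists_norm_derivCLM_apply_le hB h𝔱 hH₀
  refine ⟨C * max K 0, by positivity, fun π hπ ℓ hℓ x y => ?_⟩
  have hW : 0 < weightNorm B 𝔱 ℓ := hc.trans_le (hlow π hπ ℓ hℓ)
  have hdist := OneSided.dist_nonneg h0 x y
  have hlie : lieDist B (Θ x) (Θ y) ≤ ENNReal.ofReal (max K 0 * OneSided.dist lam x y) :=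
    (hK x y).trans (ENNReal.ofReal_le_ofReal
      (mul_le_mul_of_nonneg_right (le_max_left _ _) hdist))
  calc dist (π.toHom (Θ x)) (π.toHom (Θ y))
    _ = ‖π.op (Θ x) - π.op (Θ y)‖ := dist_eq_norm (π.op (Θ x)) (π.op (Θ y))
    _ ≤ C * weightNorm B 𝔱 ℓ * (max K 0 * OneSided.dist lam x y) :=
        π.norm_op_sub_le_of_lieDist_le (by positivity) (hle π hπ ℓ hℓ) (by positivity) hlie
    _ = C * max K 0 * weightNorm B 𝔱 ℓ * OneSided.dist lam x y := by ring

end Main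

theorem mainTheorem7_general
    {E : Type*} [NormedAddCommGroup E] [NormedSpace ℝ E] [FiniteDimensional ℝ E]
    {G : Type*} [TopologicalSpace G] [T2Space G] [CompactSpace G] [ConnectedSpace G]
    [ChartedSpace E G] [Group G] [LieGroup 𝓘(ℝ, E) ∞ G]
    {B : LinearMap.BilinForm ℝ (GroupLieAlgebra 𝓘(ℝ, E) G)} (hB : IsInnerProduct B)
    {𝔱 : Submodule ℝ (GroupLieAlgebra 𝓘(ℝ, E) G)} (h𝔱 : IsMaximalAbelian 𝔱)
    {H₀ : 𝔱} (hH₀ : IsRegularElement 𝔱 H₀)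
    {N : ℕ} {A : Matrix (Fin N) (Fin N) ℕ} (hA01 : IsZeroOne A) (hA : IsAperiodic A)
    {lam : ℝ} (hlam0 : 0 < lam) (hlam1 : lam < 1)
    {φ : OneSided A → ℝ} (hφ : MemLip lam φ) (hφ1 : IsNormalizedPotential φ)
    {r : OneSided A → ℝ} (hr : MemLip lam r) {Θ : OneSided A → G} (hΘ : MemLipGroup B lam Θ)
    {w : TwoSided A} {n₀ p₀ : ℕ} (hD : IsDiophantine B 𝔱 H₀ (chainTwists r Θ w n₀ p₀)) :
    ∃ C₀ > (0 : ℝ), ∀ C₁₅ ≥ C₀, ∃ K₀ ≥ (1 : ℝ), ∀ C₁₈ ≥ K₀,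
      ∃ C₂₃ > (0 : ℝ), ∃ C₂₅ > (0 : ℝ),
        ∀ π : UnitaryIrrep G, π.Nontrivial → ∀ ℓ, IsHighestWeight 𝔱 H₀ π ℓ → ∀ b : ℝ,
          1 < frequency B 𝔱 C₁₅ ℓ b ∧
          ∀ h : OneSided A → π.Space, MemLip lam h →
            MemLip lam ((π.transfer φ r Θ (Complex.I * b))^[
              ⌈C₂₅ * Real.log (frequency B 𝔱 C₁₅ ℓ b)⌉₊] h) ∧
            scaledNorm lam C₁₈ (frequency B 𝔱 C₁₅ ℓ b)
                ((π.transfer φ r Θ (Complex.I * b))^[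
                  ⌈C₂₅ * Real.log (frequency B 𝔱 C₁₅ ℓ b)⌉₊] h) ≤
              (1 - frequency B 𝔱 C₁₅ ℓ b ^ (-C₂₃)) *
                scaledNorm lam C₁₈ (frequency B 𝔱 C₁₅ ℓ b) h := by
  obtain ⟨c, hc, hlow⟩ := exists_le_weightNorm hB h𝔱 hH₀
  obtain ⟨K, hK, hπΘ⟩ := hΘ.exists_lipschitzBound_toHom hlam0.le hB h𝔱 hH₀
  obtain ⟨Kr, hKr, hr⟩ := hr.exists_lipschitzBound hlam0.le
  obtain ⟨D, hD, δ, hδ, hdio⟩ := hD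
  set κ := c ^ (halfRootNumber 𝔱 / 2)
  have hκ : 0 < κ := Real.rpow_pos_of_pos hc _
  obtain ⟨K₀, hK₀, hcontr⟩ := exists_scaledNorm_iterate_unitaryTransfer_le hlam0 hlam1 hA01 hA
    hφ hφ1 r w n₀ p₀ (K := Kr + K / κ) (κ := δ * κ ^ D) (by positivity) (by positivity) hD.le
  refine ⟨max 1 (2 / (κ * c)), by positivity, fun C₁₅ hC₁₅ => ⟨K₀, hK₀, fun C₁₈ hC₁₈ => ?_⟩⟩
  obtain ⟨C₂₃, hC₂₃, C₂₅, hC₂₅, hcontr⟩ := hcontr C₁₈ hC₁₈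
  refine ⟨C₂₃, hC₂₃, C₂₅, hC₂₅, fun π hπ ℓ hℓ b => ?_⟩
  have hcW := hlow π hπ ℓ hℓ
  have hβ := two_le_frequency hc hcW ((le_max_right _ _).trans hC₁₅) b
  have hone : 1 ≤ C₁₅ := (le_max_left _ _).trans hC₁₅
  have hκβ := mul_weightNorm_le_frequency hc hcW hone b
  refine ⟨one_lt_two.trans_le hβ, fun h hh => ?_⟩
  rw [UnitaryIrrep.transfer_eq_unitaryTransfer]
  exact hcontr _ _ _ hβ (lipschitzBound_twistedUnitary_of_mul_weightNorm_le hlam0.le hKr hK hκ hr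
      (hπΘ π hπ ℓ hℓ) (abs_le_frequency (zero_le_one.trans hone) b) hκβ)
    (fun v => exists_chainTwists_twistedUnitary_of_mul_weightNorm_le hκ hδ hD.le
      (hc.trans_le hcW) hκβ b (hdio π hπ ℓ hℓ v)) h hh

theorem mainTheorem7
    -- a compact connected Lie group, an inner product on its Lie algebra, a maximal abelian
    -- subalgebra and a Weyl chamber
    {E : Type*} [NormedAddCommGroup E] [NormedSpace ℝ E] [FiniteDimensional ℝ E]
    {G : Type*} [TopologicalSpace G] [T2Space G] [CompactSpace G] [ConnectedSpace G]
    [ChartedSpace E G] [Group G] [LieGroup 𝓘(ℝ, E) ∞ G]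
    (B : LinearMap.BilinForm ℝ (GroupLieAlgebra 𝓘(ℝ, E) G)) (hB : IsInnerProduct B)
    (𝔱 : Submodule ℝ (GroupLieAlgebra 𝓘(ℝ, E) G)) (h𝔱 : IsMaximalAbelian 𝔱)
    (H₀ : 𝔱) (hH₀ : IsRegularElement 𝔱 H₀)
    -- an aperiodic subshift of finite type with metric constant `lam`
    {N : ℕ} (A : Matrix (Fin N) (Fin N) ℕ) (hA01 : IsZeroOne A) (hA : IsAperiodic A)
    (lam : ℝ) (hlam0 : 0 < lam) (hlam1 : lam < 1)
    -- the normalized potential, the roof function and the skewing function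
    (φ : OneSided A → ℝ) (hφ : MemLip lam φ) (hφ1 : IsNormalizedPotential φ)
    (r : OneSided A → ℝ) (hr : MemLip lam r) (hr0 : ∀ x, 0 < r x)
    (Θ : OneSided A → G) (hΘ : MemLipGroup B lam Θ)
    -- the Diophantine assumption
    (hD : ∃ (w : TwoSided A) (n₀ p₀ : ℕ), 1 ≤ p₀ ∧
      IsDiophantine B 𝔱 H₀ (chainTwists r Θ w n₀ p₀)) :
    ∃ C₀ > (0 : ℝ), ∀ C₁₅ ≥ C₀, ∃ K₀ ≥ (1 : ℝ), ∀ C₁₈ ≥ K₀,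
      ∃ C₂₃ > (0 : ℝ), ∃ C₂₅ > (0 : ℝ),
        ∀ π : UnitaryIrrep G, π.Nontrivial → ∀ ℓ, IsHighestWeight 𝔱 H₀ π ℓ → ∀ b : ℝ,
          1 < frequency B 𝔱 C₁₅ ℓ b ∧
          ∀ h : OneSided A → π.Space, MemLip lam h →
            MemLip lam ((π.transfer φ r Θ (Complex.I * b))^[
              ⌈C₂₅ * Real.log (frequency B 𝔱 C₁₅ ℓ b)⌉₊] h) ∧
            scaledNorm lam C₁₈ (frequency B 𝔱 C₁₅ ℓ b)
                ((π.transfer φ r Θ (Complex.I * b))^[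
                  ⌈C₂₅ * Real.log (frequency B 𝔱 C₁₅ ℓ b)⌉₊] h) ≤
              (1 - frequency B 𝔱 C₁₅ ℓ b ^ (-C₂₃)) *
                scaledNorm lam C₁₈ (frequency B 𝔱 C₁₅ ℓ b) h := by
  obtain ⟨w, n₀, p₀, -, hD⟩ := hD
  exact mainTheorem7_general hB h𝔱 hH₀ hA01 hA hlam0 hlam1 hφ hφ1 hr hΘ hD
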